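/- Let $L,\rho_1,\rho_2,\kappa,b>0$ and $\tau,\sigma\in[0,1]$. On the complex space $L^2(0,L)$ let $A=-\partial_x^2$ with $D(A)=H^2(0,L)\cap H^1_0(0,L)$, and let $A^\theta$ be its (spectral) fractional powers, so that $D(A^{1/2})=H^1_0(0,L)$. Let $\mathcal H=[H^1_0(0,L)\times L^2(0,L)]^2$ be the Hilbert space of all $U=(u,w,\psi,v)$ with the inner product $$\langle U,U^*\rangle_{\mathcal H}=\rho_1\langle w,w^*\rangle+\rho_2\langle v,v^*\rangle+\kappa\langle u_x+\psi,u^*_x+\psi^*\rangle+b\langle\psi_x,\psi^*_x\rangle,$$ and let $$\mathcal B U=\Big(w,\ \tfrac1{\rho_1}[\kappa(u_x+\psi)_x-A^\tau w],\ v,\ \tfrac1{\rho_2}[-bA\psi-\kappa(u_x+\psi)-A^\sigma v]\Big)$$ on $D(\mathcal B)=D(A)\times(D(A^{1/2})\cap D(A^\tau))\times D(A)\times(D(A^{1/2})\cap D(A^\sigma))$. Then: (i) $\mathcal B$ is densely defined, dissipative and closable; its closure $\overline{\mathcal B}$ has $0$ in its resolvent set and generates a $C_0$-semigroup of contractions $S(t)$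 on $\mathcal H$. If $\tau,\sigma\le\frac12$, then $\overline{\mathcal B}=\mathcal B$, so that $\mathcal B$ itself has these properties. (ii) For every $U_0\in\mathcal H$ the problem $U'=\mathcal B U$, $U(0)=U_0$ has a unique weak solution $U\in C([0,\infty),\mathcal H)$, namely $U(t)=S(t)U_0$. Here a weak solution is a $U\in C([0,\infty),\mathcal H)$ with $U(0)=U_0$ such that for every $V\in D(\mathcal B^*)$ and $t\ge0$, $\langle U(t),V\rangle=\langle U_0,V\rangle+\int_0^t\langle U(s),\mathcal B^*V\rangle\,ds$. (iii) For $k\in\mathbb N$, if $U_0\in D(\mathcal B^k)$, then $U\in\bigcap_{j=0}^kC^{k-j}([0,\infty),D(\mathcal B^j))$, where $D(\mathcal B^j)$ carries the graph norm of $I,\mathcal B,\dots,\mathcal B^j$. The same holds with $\overline{\mathcal B}$ in place of $\mathcal B$ throughout this sentence: if $U_0\in D(\overline{\mathcal B}^{\,k})$, then $U\in\bigcap_{j=0}^kC^{k-j}([0,\infty),D(\overline{\mathcal B}^{\,j}))$. -/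

import Mathlib

open MeasureTheory Set Filter Topology
open scoped ContDiff NNReal ENNReal

noncomputable section

namespace Timoshenko

/-! ### Function spaces on the interval `(0, L)` -/

/-- The complex Hilbert space `L²(0, L)`. -/
abbrev L2 (L : ℝ) : Type := Lp ℂ 2 (volume.restrict (Ioo (0 : ℝ) L))

/-- The test functions `C_c^∞((0, L); ℂ)`. -/
def testFn (L : ℝ) : Submodule ℂ (ℝ → ℂ) where
  carrier := {φ | ContDiff ℝ ∞ φ ∧ HasCompactSupport φ ∧ tsupport φ ⊆ Ioo 0 L}
  zero_mem' := ⟨contDiff_const, HasCompactSupport.zero, by simp [tsupport]⟩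
  add_mem' := fun {a b} ha hb => ⟨ha.1.add hb.1, ha.2.1.add hb.2.1,
    (tsupport_add a b).trans (union_subset ha.2.2 hb.2.2)⟩
  smul_mem' := fun c φ h => ⟨contDiff_const.smul h.1, h.2.1.smul_left (f := fun _ => c),
    (closure_mono (Function.support_const_smul_subset c φ)).trans h.2.2⟩

/-- `g ∈ L²(0, L)` is the weak derivative of `f ∈ L²(0, L)`. -/
def IsWeakDeriv (L : ℝ) (f g : L2 L) : Prop :=
  ∀ φ ∈ testFn L, ∫ x in Ioo 0 L, f x * deriv φ x = -∫ x in Ioo 0 L, g x * φ x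

theorem testFn_cont {L : ℝ} {φ : ℝ → ℂ} (h : φ ∈ testFn L) : Continuous φ := h.1.continuous

theorem testFn_deriv {L : ℝ} {φ : ℝ → ℂ} (h : φ ∈ testFn L) : deriv φ ∈ testFn L := by
  refine ⟨?_, h.2.1.deriv, (tsupport_deriv_subset (𝕜 := ℝ)).trans h.2.2⟩
  exact (contDiff_infty_iff_deriv.1 h.1).2

theorem testFn_memLp {L : ℝ} {φ : ℝ → ℂ} (h : φ ∈ testFn L) (p : ℝ≥0∞) :
    MemLp φ p (volume.restrict (Ioo (0 : ℝ) L)) :=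
  (testFn_cont h).memLp_of_hasCompactSupport h.2.1

theorem integrable_mul_test {L : ℝ} (f : L2 L) {φ : ℝ → ℂ} (h : φ ∈ testFn L) :
    Integrable (fun x => f x * φ x) (volume.restrict (Ioo (0 : ℝ) L)) :=
  (Lp.memLp f).integrable_mul (testFn_memLp h 2)

theorem IsWeakDeriv.add {L : ℝ} {f g f' g' : L2 L} (h : IsWeakDeriv L f g)
    (h' : IsWeakDeriv L f' g') : IsWeakDeriv L (f + f') (g + g') := by
  intro φ hφ
  have e1 : ∫ x in Ioo 0 L, (f + f') x * deriv φ x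
      = ∫ x in Ioo 0 L, (f x * deriv φ x + f' x * deriv φ x) := by
    refine integral_congr_ae ?_
    filter_upwards [Lp.coeFn_add f f'] with x hx
    rw [hx, Pi.add_apply, add_mul]
  have e2 : ∫ x in Ioo 0 L, (g + g') x * φ x = ∫ x in Ioo 0 L, (g x * φ x + g' x * φ x) := by
    refine integral_congr_ae ?_
    filter_upwards [Lp.coeFn_add g g'] with x hx
    rw [hx, Pi.add_apply, add_mul]
  rw [e1, e2, integral_add (integrable_mul_test f (testFn_deriv hφ))
    (integrable_mul_test f' (testFn_deriv hφ)), integral_add (integrable_mul_test g hφ)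
    (integrable_mul_test g' hφ), h φ hφ, h' φ hφ]
  ring

theorem IsWeakDeriv.smul {L : ℝ} {f g : L2 L} (c : ℂ) (h : IsWeakDeriv L f g) :
    IsWeakDeriv L (c • f) (c • g) := by
  intro φ hφ
  have e1 : ∫ x in Ioo 0 L, (c • f) x * deriv φ x = ∫ x in Ioo 0 L, c * (f x * deriv φ x) := by
    refine integral_congr_ae ?_
    filter_upwards [Lp.coeFn_smul c f] with x hx
    rw [hx, Pi.smul_apply, smul_eq_mul, mul_assoc]
  have e2 : ∫ x in Ioo 0 L, (c • g) x * φ x = ∫ x in Ioo 0 L, c * (g x * φ x) := by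
    refine integral_congr_ae ?_
    filter_upwards [Lp.coeFn_smul c g] with x hx
    rw [hx, Pi.smul_apply, smul_eq_mul, mul_assoc]
  rw [e1, e2, integral_const_mul, integral_const_mul, h φ hφ]
  ring

theorem integral_zero_mul (L : ℝ) (χ : ℝ → ℂ) : ∫ x in Ioo 0 L, (0 : L2 L) x * χ x = 0 := by
  rw [integral_congr_ae (g := fun _ => (0 : ℂ))]
  · simp
  · filter_upwards [Lp.coeFn_zero ℂ 2 (volume.restrict (Ioo 0 L))] with x hx
    rw [hx, Pi.zero_apply, zero_mul]

theorem IsWeakDeriv.zero (L : ℝ) : IsWeakDeriv L 0 0 := by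
  intro φ hφ
  rw [integral_zero_mul, integral_zero_mul, neg_zero]

theorem IsWeakDeriv.unique {L : ℝ} {f g g' : L2 L} (h : IsWeakDeriv L f g)
    (h' : IsWeakDeriv L f g') : g = g' := by
  have hd : IsWeakDeriv L 0 (g - g') := by
    simpa [sub_eq_add_neg] using h.add (h'.smul (-1))
  have key : ∀ᵐ x ∂(volume : Measure ℝ), x ∈ Ioo 0 L → (g - g') x = 0 := by
    refine isOpen_Ioo.ae_eq_zero_of_integral_contDiff_smul_eq_zero ?_ ?_
    · refine IntegrableOn.locallyIntegrableOn ?_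
      exact (Lp.memLp (g - g')).integrable (by norm_num)
    · intro φ h1 h2 h3
      have ht : (fun x => (φ x : ℂ)) ∈ testFn L := by
        refine ⟨Complex.ofRealCLM.contDiff.comp h1, h2.comp_left (g := fun y : ℝ => (y : ℂ))
          Complex.ofReal_zero, ?_⟩
        refine (closure_mono ?_).trans h3
        intro x hx
        simpa using hx
      have e := hd _ ht
      rw [integral_zero_mul] at e
      have e' : ∫ x in Ioo 0 L, (g - g') x * (φ x : ℂ) = 0 := by
        simpa using e.symm
      have hs : ∫ x, φ x • (g - g') x = ∫ x in Ioo 0 L, φ x • (g - g') x := by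
        refine (setIntegral_eq_integral_of_forall_compl_eq_zero ?_).symm
        intro x hx
        have : φ x = 0 := image_eq_zero_of_notMem_tsupport fun hx' => hx (h3 hx')
        simp [this]
      rw [hs, ← e']
      refine integral_congr_ae (Eventually.of_forall fun x => ?_)
      simp [mul_comm]
  have : g - g' = 0 := by
    refine Lp.ext ?_
    have k2 := (ae_restrict_iff' measurableSet_Ioo).2 key
    filter_upwards [k2, Lp.coeFn_zero ℂ 2 (volume.restrict (Ioo 0 L))] with x hx h0
    rw [hx, h0]; rfl
  exact sub_eq_zero.1 this

/-- The weak derivative `d/dx` as an unbounded operator on `L²(0, L)`, with domain `H¹(0, L)`. -/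
def dx (L : ℝ) : L2 L →ₗ.[ℂ] L2 L where
  domain :=
    { carrier := {f | ∃ g, IsWeakDeriv L f g}
      zero_mem' := ⟨0, IsWeakDeriv.zero L⟩
      add_mem' := fun ⟨g, hg⟩ ⟨g', hg'⟩ => ⟨g + g', hg.add hg'⟩
      smul_mem' := fun c _ ⟨g, hg⟩ => ⟨c • g, hg.smul c⟩ }
  toFun :=
    { toFun := fun f => f.2.choose
      map_add' := fun f f' =>
        (f + f').2.choose_spec.unique (f.2.choose_spec.add f'.2.choose_spec)
      map_smul' := fun c f => (c • f).2.choose_spec.unique (f.2.choose_spec.smul c) }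

theorem dx_spec {L : ℝ} (f : (dx L).domain) : IsWeakDeriv L f (dx L f) := f.2.choose_spec

theorem dx_eq {L : ℝ} (f : (dx L).domain) {g : L2 L} (h : IsWeakDeriv L f g) : dx L f = g :=
  (dx_spec f).unique h

/-- The pairs `(φ, φ')` in `L²(0, L) × L²(0, L)`, for `φ` a test function. -/
def testGraph (L : ℝ) : Submodule ℂ (L2 L × L2 L) where
  carrier := {q | ∃ φ ∈ testFn L, q.1 =ᵐ[volume.restrict (Ioo 0 L)] φ ∧
    q.2 =ᵐ[volume.restrict (Ioo 0 L)] deriv φ}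
  zero_mem' := ⟨0, (testFn L).zero_mem, Lp.coeFn_zero _ _ _, by
    have : deriv (0 : ℝ → ℂ) = 0 := by ext x; simp
    rw [this]; exact Lp.coeFn_zero _ _ _⟩
  add_mem' := by
    rintro a b ⟨φ, hφ, h1, h2⟩ ⟨χ, hχ, k1, k2⟩
    refine ⟨φ + χ, (testFn L).add_mem hφ hχ, ?_, ?_⟩
    · exact (Lp.coeFn_add _ _).trans (h1.add k1)
    · refine (Lp.coeFn_add _ _).trans ((h2.add k2).trans (Eventually.of_forall fun x => ?_))
      exact (deriv_add (hφ.1.differentiable (by simp) x)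
        (hχ.1.differentiable (by simp) x)).symm
  smul_mem' := by
    rintro c a ⟨φ, hφ, h1, h2⟩
    refine ⟨c • φ, (testFn L).smul_mem c hφ, ?_, ?_⟩
    · exact (Lp.coeFn_smul _ _).trans (h1.const_smul c)
    · refine (Lp.coeFn_smul _ _).trans ((h2.const_smul c).trans (Eventually.of_forall fun x => ?_))
      exact (deriv_const_smul c (hφ.1.differentiable (by simp) x)).symm

/-- The pairs `(u, u')` with `u ∈ H¹₀(0, L)`: the closure of the test functions in the norm
of `H¹`. -/
def H10graph (L : ℝ) : Submodule ℂ (L2 L × L2 L) := (testGraph L).topologicalClosure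

/-- The space `H¹₀(0, L)`, the closure of `C_c^∞(0, L)` in `H¹(0, L)`. -/
def H10 (L : ℝ) : Submodule ℂ (L2 L) := (H10graph L).map (LinearMap.fst ℂ _ _)

theorem testGraph_isWeakDeriv {L : ℝ} {q : L2 L × L2 L} (h : q ∈ testGraph L) :
    IsWeakDeriv L q.1 q.2 := by
  obtain ⟨φ, hφ, h1, h2⟩ := h
  intro χ hχ
  have e1 : ∫ x in Ioo 0 L, q.1 x * deriv χ x = ∫ x, φ x * deriv χ x := by
    rw [integral_congr_ae (g := fun x => φ x * deriv χ x)]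
    · refine setIntegral_eq_integral_of_forall_compl_eq_zero fun x hx => ?_
      rw [image_eq_zero_of_notMem_tsupport (fun hx' => hx (hφ.2.2 hx')), zero_mul]
    · filter_upwards [h1] with x hx
      rw [hx]
  have e2 : ∫ x in Ioo 0 L, q.2 x * χ x = ∫ x, deriv φ x * χ x := by
    rw [integral_congr_ae (g := fun x => deriv φ x * χ x)]
    · refine setIntegral_eq_integral_of_forall_compl_eq_zero fun x hx => ?_
      rw [image_eq_zero_of_notMem_tsupport (fun hx' => hx (hχ.2.2 hx')), mul_zero]
    · filter_upwards [h2] with x hx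
      rw [hx]
  rw [e1, e2]
  have hp : ∀ {a b : ℝ → ℂ}, a ∈ testFn L → b ∈ testFn L → Integrable (a * b) volume := by
    intro a b ha hb
    exact ((testFn_cont ha).mul (testFn_cont hb)).integrable_of_hasCompactSupport
      (ha.2.1.mul_right)
  exact integral_mul_deriv_eq_deriv_mul_of_integrable
    (fun x _ => (hφ.1.differentiable (by simp) x).hasDerivAt)
    (fun x _ => (hχ.1.differentiable (by simp) x).hasDerivAt)
    (hp hφ (testFn_deriv hχ)) (hp (testFn_deriv hφ) hχ) (hp hφ hχ)

theorem continuous_integral_mul {L : ℝ} {φ : ℝ → ℂ} (h : φ ∈ testFn L) :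
    Continuous fun f : L2 L => ∫ x in Ioo 0 L, f x * φ x := by
  have hm : MemLp (fun x => star (φ x)) 2 (volume.restrict (Ioo (0 : ℝ) L)) :=
    (testFn_memLp h 2).star
  have e : (fun f : L2 L => ∫ x in Ioo 0 L, f x * φ x)
      = fun f => inner ℂ (hm.toLp _) f := by
    ext f
    rw [L2.inner_def]
    refine integral_congr_ae ?_
    filter_upwards [hm.coeFn_toLp] with x hx
    rw [hx]
    simp
  rw [e]
  exact continuous_const.inner continuous_id

theorem H10graph_isWeakDeriv {L : ℝ} {q : L2 L × L2 L} (h : q ∈ H10graph L) :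
    IsWeakDeriv L q.1 q.2 := by
  intro φ hφ
  have hc : IsClosed {q : L2 L × L2 L | ∫ x in Ioo 0 L, q.1 x * deriv φ x
      = -∫ x in Ioo 0 L, q.2 x * φ x} :=
    isClosed_eq ((continuous_integral_mul (testFn_deriv hφ)).comp continuous_fst)
      ((continuous_integral_mul hφ).comp continuous_snd).neg
  exact closure_minimal (fun q hq => testGraph_isWeakDeriv hq φ hφ) hc h

theorem H10_le (L : ℝ) : H10 L ≤ (dx L).domain := by
  rintro _ ⟨q, hq, rfl⟩
  exact ⟨q.2, H10graph_isWeakDeriv hq⟩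

/-- The derivative `u ↦ u_x` on `H¹₀(0, L)`. -/
def grad (L : ℝ) : H10 L →ₗ[ℂ] L2 L := (dx L).toFun ∘ₗ Submodule.inclusion (H10_le L)

theorem grad_mem {L : ℝ} (u : H10 L) : ((u : L2 L), grad L u) ∈ H10graph L := by
  obtain ⟨_, q, hq, rfl⟩ := u
  have : grad L ⟨_, q, hq, rfl⟩ = q.2 := dx_eq _ (H10graph_isWeakDeriv hq)
  rw [this]
  exact hq

theorem test_bound {L : ℝ} {q : L2 L × L2 L} (h : q ∈ testGraph L) :
    ‖q.1‖ ≤ (measureUnivNNReal (volume.restrict (Ioo (0 : ℝ) L)) : ℝ) ^ (1 / 2 : ℝ) *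
      (measureUnivNNReal (volume.restrict (Ioo (0 : ℝ) L)) : ℝ) ^ (1 / 2 : ℝ) * ‖q.2‖ := by
  obtain ⟨φ, hφ, h1, h2⟩ := h
  set μ := volume.restrict (Ioo (0 : ℝ) L) with hμ
  have hφ' := testFn_deriv hφ
  -- the `L¹` norm of the derivative
  have hI : ∫ x, ‖deriv φ x‖ ∂μ ≤ (measureUnivNNReal μ : ℝ) ^ (1 / 2 : ℝ) * ‖q.2‖ := by
    have a1 : ∫ x, ‖deriv φ x‖ ∂μ = (eLpNorm (deriv φ) 1 μ).toReal := by
      rw [integral_norm_eq_lintegral_enorm (testFn_cont hφ').aestronglyMeasurable,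
        eLpNorm_one_eq_lintegral_enorm]
    have a2 : ‖q.2‖ = (eLpNorm (deriv φ) 2 μ).toReal := by
      rw [Lp.norm_def, eLpNorm_congr_ae h2]
    have a3 := eLpNorm_le_eLpNorm_mul_rpow_measure_univ (μ := μ) (p := 1) (q := 2)
      (by norm_num) (testFn_cont hφ').aestronglyMeasurable
    have a4 : ((1 : ℝ≥0∞).toReal⁻¹ : ℝ) - (2 : ℝ≥0∞).toReal⁻¹ = 1 / 2 := by norm_num
    rw [one_div, one_div, a4] at a3
    have a5 := ENNReal.toReal_mono (ENNReal.mul_ne_top (testFn_memLp hφ' 2).2.ne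
      (ENNReal.rpow_ne_top_of_nonneg (by norm_num) (measure_ne_top μ _))) a3
    rw [ENNReal.toReal_mul, ← ENNReal.toReal_rpow] at a5
    rw [a1, a2, mul_comm]
    exact a5
  have hpt : ∀ x, ‖φ x‖ ≤ ∫ x, ‖deriv φ x‖ ∂μ := by
    intro x
    by_cases hx : x ∈ Ioo 0 L
    · have f0 : φ 0 = 0 := image_eq_zero_of_notMem_tsupport fun h0 => by
        simpa using (hφ.2.2 h0).1
      have e : ∫ y in (0 : ℝ)..x, deriv φ y = φ x := by
        rw [intervalIntegral.integral_deriv_eq_sub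
          (fun y _ => hφ.1.differentiable (by simp) y)
          ((testFn_cont hφ').intervalIntegrable _ _), f0, sub_zero]
      rw [← e]
      refine (intervalIntegral.norm_integral_le_integral_norm hx.1.le).trans ?_
      rw [intervalIntegral.integral_of_le hx.1.le, integral_Ioc_eq_integral_Ioo]
      refine setIntegral_mono_set ?_ (Eventually.of_forall fun y => norm_nonneg _)
        (Ioo_subset_Ioo_right hx.2.le).eventuallyLE
      exact ((testFn_memLp hφ' 1).integrable le_rfl).norm
    · rw [image_eq_zero_of_notMem_tsupport fun h0 => hx (hφ.2.2 h0), norm_zero]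
      exact integral_nonneg fun _ => norm_nonneg _
  have hb := Lp.norm_le_of_ae_bound (f := q.1) (C := ∫ x, ‖deriv φ x‖ ∂μ)
    (integral_nonneg fun _ => norm_nonneg _) (by
      filter_upwards [h1] with x hx
      rw [hx]; exact hpt x)
  have e2 : ((2 : ℝ≥0∞).toReal⁻¹ : ℝ) = 1 / 2 := by norm_num
  rw [e2] at hb
  rw [mul_assoc]
  exact hb.trans (mul_le_mul_of_nonneg_left hI (by positivity))

/-- The Poincaré inequality on `H¹₀(0, L)`. -/
theorem exists_poincare (L : ℝ) : ∃ C : ℝ, 0 ≤ C ∧ ∀ u : H10 L, ‖u‖ ≤ C * ‖grad L u‖ := by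
  obtain ⟨K, hK0, hK⟩ : ∃ K : ℝ, 0 ≤ K ∧ ∀ q ∈ testGraph L, ‖q.1‖ ≤ K * ‖q.2‖ := by
    refine ⟨(measureUnivNNReal (volume.restrict (Ioo (0 : ℝ) L)) : ℝ) ^ (1 / 2 : ℝ) *
      (measureUnivNNReal (volume.restrict (Ioo (0 : ℝ) L)) : ℝ) ^ (1 / 2 : ℝ), ?_, ?_⟩
    · positivity
    · intro q hq
      exact test_bound hq
  refine ⟨K, hK0, fun u => ?_⟩
  have hc : IsClosed {q : L2 L × L2 L | ‖q.1‖ ≤ K * ‖q.2‖} :=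
    isClosed_le continuous_fst.norm (continuous_const.mul continuous_snd.norm)
  have hs : closure (testGraph L : Set (L2 L × L2 L)) ⊆ {q | ‖q.1‖ ≤ K * ‖q.2‖} :=
    closure_minimal hK hc
  have hm : ((u : L2 L), grad L u) ∈ closure (testGraph L : Set (L2 L × L2 L)) := grad_mem u
  have := hs hm
  rw [Set.mem_ofPred_eq] at this
  rw [Submodule.coe_norm]
  exact this

/-! ### Unbounded operators -/

section Operators

variable {E : Type*} [NormedAddCommGroup E]

/-- The composition `B ∘ T` of unbounded operators, on `{x ∈ D(T) | T x ∈ D(B)}`. -/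
def pcomp [Module ℂ E] (B T : E →ₗ.[ℂ] E) : E →ₗ.[ℂ] E where
  domain := (B.domain.comap T.toFun).map T.domain.subtype
  toFun :=
    { toFun := fun x => B ⟨T ⟨x, by obtain ⟨_, y, _, rfl⟩ := x; exact y.2⟩, by
        obtain ⟨_, y, hy, rfl⟩ := x; exact hy⟩
      map_add' := fun x y => by
        rw [← B.map_add]
        congr 1
        exact Subtype.ext (T.map_add ⟨x, _⟩ ⟨y, _⟩)
      map_smul' := fun c x => by
        rw [RingHom.id_apply, ← B.map_smul]
        congr 1
        exact Subtype.ext (T.map_smul c ⟨x, _⟩) }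

/-- The powers of an unbounded operator: `B⁰ = I` on the whole space and `Bⁿ⁺¹ = Bⁿ ∘ B` on
`D(Bⁿ⁺¹) = {x ∈ D(B) | B x ∈ D(Bⁿ)}`. -/
def ppow [Module ℂ E] (B : E →ₗ.[ℂ] E) : ℕ → (E →ₗ.[ℂ] E)
  | 0 => LinearMap.id.toPMap ⊤
  | n + 1 => pcomp (ppow B n) B

theorem ppow_domain_succ_le [Module ℂ E] (B : E →ₗ.[ℂ] E) (n : ℕ) :
    (ppow B (n + 1)).domain ≤ (ppow B n).domain := by
  induction n with
  | zero => exact fun _ _ => Submodule.mem_top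
  | succ n ih =>
    rintro _ ⟨y, hy, rfl⟩
    exact ⟨y, ih hy, rfl⟩

theorem ppow_domain_anti [Module ℂ E] (B : E →ₗ.[ℂ] E) :
    Antitone fun n => (ppow B n).domain :=
  antitone_nat_of_succ_le (ppow_domain_succ_le B)

/-- The space `D(Bʲ)`, as a type of its own: it will carry the graph norm. -/
def PowDomain [Module ℂ E] (B : E →ₗ.[ℂ] E) (j : ℕ) : Type _ := ↥(ppow B j).domain

instance [Module ℂ E] (B : E →ₗ.[ℂ] E) (j : ℕ) : AddCommGroup (PowDomain B j) :=
  inferInstanceAs (AddCommGroup ↥(ppow B j).domain)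

instance [Module ℂ E] (B : E →ₗ.[ℂ] E) (j : ℕ) : Module ℂ (PowDomain B j) :=
  inferInstanceAs (Module ℂ ↥(ppow B j).domain)

/-- The inclusion of `D(Bʲ)` in the whole space. -/
def PowDomain.val [Module ℂ E] {B : E →ₗ.[ℂ] E} {j : ℕ} (x : PowDomain B j) : E :=
  ((show ↥(ppow B j).domain from x) : E)

/-- The map `x ↦ (x, B x, …, Bʲ x)` on `D(Bʲ)`. -/
def powGraph [NormedSpace ℂ E] (B : E →ₗ.[ℂ] E) (j : ℕ) :
    PowDomain B j →ₗ[ℂ] (Fin (j + 1) → E) :=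
  LinearMap.pi fun i => (ppow B i).toFun ∘ₗ
    Submodule.inclusion (ppow_domain_anti B (Nat.lt_succ_iff.1 i.2))

theorem powGraph_injective [NormedSpace ℂ E] (B : E →ₗ.[ℂ] E) (j : ℕ) :
    Function.Injective (powGraph B j) := fun _ _ h => Subtype.ext (congrFun h 0)

/-- `D(Bʲ)` carries the graph norm `max (‖x‖, ‖B x‖, …, ‖Bʲ x‖)`. -/
instance [NormedSpace ℂ E] (B : E →ₗ.[ℂ] E) (j : ℕ) : NormedAddCommGroup (PowDomain B j) :=
  NormedAddCommGroup.induced _ _ (powGraph B j) (powGraph_injective B j)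

instance [NormedSpace ℂ E] (B : E →ₗ.[ℂ] E) (j : ℕ) : NormedSpace ℂ (PowDomain B j) :=
  NormedSpace.induced ℂ (PowDomain B j) (Fin (j + 1) → E) (powGraph B j)

/-- `U ∈ Cᵐ([0, ∞), D(Bʲ))`. -/
def IsCmInto [NormedSpace ℂ E] (B : E →ₗ.[ℂ] E) (m j : ℕ) (U : ℝ → E) : Prop :=
  ∃ V : ℝ → PowDomain B j, (∀ t, 0 ≤ t → (V t).val = U t) ∧ ContDiffOn ℝ m V (Ici 0)

/-- `B` is dissipative: `Re ⟨B x, x⟩ ≤ 0` for every `x ∈ D(B)`. -/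
def IsDissipative [InnerProductSpace ℂ E] (B : E →ₗ.[ℂ] E) : Prop :=
  ∀ x : B.domain, (inner ℂ (B x) (x : E)).re ≤ 0

/-- `z` lies in the resolvent set of `B`: the operator `z - B : D(B) → E` is bijective, with
bounded inverse. -/
def InResolventSet [NormedSpace ℂ E] (B : E →ₗ.[ℂ] E) (z : ℂ) : Prop :=
  ∃ R : E →L[ℂ] E, (∀ y : E, ∃ h : R y ∈ B.domain, z • R y - B ⟨R y, h⟩ = y) ∧
    ∀ x : B.domain, R (z • (x : E) - B x) = x

/-- A `C₀`-semigroup of contractions on `E`. -/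
structure ContractionSemigroup (E : Type*) [NormedAddCommGroup E] [NormedSpace ℂ E] where
  toFun : ℝ≥0 → E →L[ℂ] E
  map_zero : toFun 0 = ContinuousLinearMap.id ℂ E
  map_add : ∀ s t, toFun (s + t) = (toFun s).comp (toFun t)
  continuous_apply : ∀ x, Continuous fun t => toFun t x
  norm_le_one : ∀ t, ‖toFun t‖ ≤ 1

/-- `B` is the infinitesimal generator of `S`: one has `x ∈ D(B)` and `B x = y` if and only if
`(S(t) x - x) / t → y` as `t → 0⁺`. -/
def IsGenerator [NormedSpace ℂ E] (B : E →ₗ.[ℂ] E) (S : ContractionSemigroup E) : Prop :=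
  ∀ x y : E, (x, y) ∈ B.graph ↔
    Tendsto (fun t : ℝ≥0 => (t : ℝ)⁻¹ • (S.toFun t x - x)) (𝓝[>] 0) (𝓝 y)

/-- `U` is a weak solution in `C([0, ∞), E)` of `U' = B U`, `U(0) = U₀`: it is continuous, and for
every `V ∈ D(B*)` the function `t ↦ ⟨V, U(t)⟩` is absolutely continuous with derivative
`⟨B* V, U(t)⟩`, that is,
`⟨V, U(t)⟩ = ⟨V, U₀⟩ + ∫₀ᵗ ⟨B* V, U(s)⟩ ds`. -/
structure IsWeakSolution [InnerProductSpace ℂ E] [CompleteSpace E] (B : E →ₗ.[ℂ] E) (U₀ : E)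
    (U : ℝ → E) : Prop where
  continuousOn : ContinuousOn U (Ici 0)
  initial : U 0 = U₀
  weak : ∀ V : B.adjoint.domain, ∀ t : ℝ, 0 ≤ t →
    inner ℂ (V : E) (U t) = inner ℂ (V : E) U₀ + ∫ s in (0 : ℝ)..t, inner ℂ (B.adjoint V) (U s)

end Operators

/-! ### The Dirichlet Laplacian and its fractional powers -/

/-- The operator `A = -d²/dx²` with `D(A) = H²(0, L) ∩ H¹₀(0, L)`. -/
def lapA (L : ℝ) : L2 L →ₗ.[ℂ] L2 L := -((ppow (dx L) 2).domRestrict (H10 L))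

theorem memLp_sine (L : ℝ) (n : ℕ) :
    MemLp (fun x : ℝ => ((√(2 / L) * Real.sin ((n + 1) * Real.pi * x / L) : ℝ) : ℂ)) 2
      (volume.restrict (Ioo (0 : ℝ) L)) := by
  refine MemLp.of_bound (Continuous.aestronglyMeasurable (by fun_prop)) (√(2 / L)) ?_
  refine Eventually.of_forall fun x => ?_
  rw [Complex.norm_real, Real.norm_eq_abs, abs_mul, abs_of_nonneg (Real.sqrt_nonneg _)]
  exact mul_le_of_le_one_right (Real.sqrt_nonneg _) (Real.abs_sin_le_one _)

/-- The orthonormal basis `√(2/L) sin((n+1)πx/L)`, `n = 0, 1, …`, of eigenfunctions of `A`. -/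
def eigenfn (L : ℝ) (n : ℕ) : L2 L := (memLp_sine L n).toLp _

/-- The eigenvalues `((n+1)π/L)²` of `A`. -/
def eigenval (L : ℝ) (n : ℕ) : ℝ := ((n + 1) * Real.pi / L) ^ 2

/-- The `n`-th term `λₙ^θ ⟨eₙ, f⟩ eₙ` of the expansion of `A^θ f`. -/
def fracTerm (L θ : ℝ) (f : L2 L) (n : ℕ) : L2 L :=
  (((eigenval L n ^ θ : ℝ) : ℂ) * inner ℂ (eigenfn L n) f) • eigenfn L n

theorem fracTerm_add (L θ : ℝ) (f g : L2 L) :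
    fracTerm L θ (f + g) = fracTerm L θ f + fracTerm L θ g := by
  ext1 n
  simp only [fracTerm, Pi.add_apply, inner_add_right, mul_add, add_smul]

theorem fracTerm_smul (L θ : ℝ) (c : ℂ) (f : L2 L) :
    fracTerm L θ (c • f) = c • fracTerm L θ f := by
  ext1 n
  simp only [fracTerm, Pi.smul_apply, inner_smul_right, smul_smul]
  ring_nf

theorem fracTerm_zero (L θ : ℝ) : fracTerm L θ 0 = 0 := by
  simpa using fracTerm_smul L θ 0 0

/-- The fractional power `A^θ f = ∑ λₙ^θ ⟨eₙ, f⟩ eₙ`, defined on all `f ∈ L²(0, L)` for which the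
series converges in `L²(0, L)`. -/
def fracA (L θ : ℝ) : L2 L →ₗ.[ℂ] L2 L where
  domain :=
    { carrier := {f | Summable (fracTerm L θ f)}
      zero_mem' := by
        change Summable (fracTerm L θ 0)
        rw [fracTerm_zero]
        exact summable_zero
      add_mem' := fun {f g} hf hg => by
        change Summable (fracTerm L θ (f + g))
        rw [fracTerm_add]
        exact Summable.add hf hg
      smul_mem' := fun c f hf => by
        change Summable (fracTerm L θ (c • f))
        rw [fracTerm_smul]
        exact Summable.const_smul c hf }
  toFun :=
    { toFun := fun f => ∑' n, fracTerm L θ f n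
      map_add' := fun f g => by
        rw [Submodule.coe_add, fracTerm_add]
        exact Summable.tsum_add f.2 g.2
      map_smul' := fun c f => by
        rw [Submodule.coe_smul, fracTerm_smul]
        exact Summable.tsum_const_smul c f.2 }

/-! ### The energy space -/

/-- The constants of the beam: its length `L` and the positive coefficients
`ρ₁ = ρA`, `ρ₂ = ρI`, `κ = kAG`, `b = EI`. -/
structure Beam where
  L : ℝ
  ρ₁ : ℝ
  ρ₂ : ℝ
  κ : ℝ
  b : ℝ
  L_pos : 0 < L
  ρ₁_pos : 0 < ρ₁
  ρ₂_pos : 0 < ρ₂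
  κ_pos : 0 < κ
  b_pos : 0 < b

/-- The phase space `[H¹₀(0, L) × L²(0, L)]²` of all `U = (u, w, ψ, v)`. -/
def Energy (p : Beam) : Type := ↥(H10 p.L) × L2 p.L × ↥(H10 p.L) × L2 p.L

namespace Energy

variable {p : Beam}

instance : AddCommGroup (Energy p) :=
  inferInstanceAs (AddCommGroup (↥(H10 p.L) × L2 p.L × ↥(H10 p.L) × L2 p.L))

instance : Module ℂ (Energy p) :=
  inferInstanceAs (Module ℂ (↥(H10 p.L) × L2 p.L × ↥(H10 p.L) × L2 p.L))

/-- The element `(u, w, ψ, v)`. -/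
def mk (u : H10 p.L) (w : L2 p.L) (ψ : H10 p.L) (v : L2 p.L) : Energy p := (u, w, ψ, v)

/-- The displacement `u`. -/
def u (U : Energy p) : H10 p.L := U.1

/-- The velocity `w`. -/
def w (U : Energy p) : L2 p.L := U.2.1

/-- The rotation angle `ψ`. -/
def ψ (U : Energy p) : H10 p.L := U.2.2.1

/-- The angular velocity `v`. -/
def v (U : Energy p) : L2 p.L := U.2.2.2

/-- The shear strain `u_x + ψ`. -/
def shear (U : Energy p) : L2 p.L := grad p.L U.u + (U.ψ : L2 p.L)

@[simp] theorem u_add (U V : Energy p) : (U + V).u = U.u + V.u := rfl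
@[simp] theorem w_add (U V : Energy p) : (U + V).w = U.w + V.w := rfl
@[simp] theorem ψ_add (U V : Energy p) : (U + V).ψ = U.ψ + V.ψ := rfl
@[simp] theorem v_add (U V : Energy p) : (U + V).v = U.v + V.v := rfl
@[simp] theorem u_sub (U V : Energy p) : (U - V).u = U.u - V.u := rfl
@[simp] theorem w_sub (U V : Energy p) : (U - V).w = U.w - V.w := rfl
@[simp] theorem ψ_sub (U V : Energy p) : (U - V).ψ = U.ψ - V.ψ := rfl
@[simp] theorem v_sub (U V : Energy p) : (U - V).v = U.v - V.v := rfl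
@[simp] theorem u_smul (c : ℂ) (U : Energy p) : (c • U).u = c • U.u := rfl
@[simp] theorem w_smul (c : ℂ) (U : Energy p) : (c • U).w = c • U.w := rfl
@[simp] theorem ψ_smul (c : ℂ) (U : Energy p) : (c • U).ψ = c • U.ψ := rfl
@[simp] theorem v_smul (c : ℂ) (U : Energy p) : (c • U).v = c • U.v := rfl

@[simp] theorem shear_add (U V : Energy p) : (U + V).shear = U.shear + V.shear := by
  simp only [shear, u_add, ψ_add, map_add, Submodule.coe_add]
  abel

@[simp] theorem shear_smul (c : ℂ) (U : Energy p) : (c • U).shear = c • U.shear := by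
  simp only [shear, u_smul, ψ_smul, map_smul, Submodule.coe_smul, smul_add]

/-- The components as linear maps. -/
def wL : Energy p →ₗ[ℂ] L2 p.L := ⟨⟨w, fun _ _ => rfl⟩, fun _ _ => rfl⟩

def ψL : Energy p →ₗ[ℂ] H10 p.L := ⟨⟨ψ, fun _ _ => rfl⟩, fun _ _ => rfl⟩

def vL : Energy p →ₗ[ℂ] L2 p.L := ⟨⟨v, fun _ _ => rfl⟩, fun _ _ => rfl⟩

def shearL : Energy p →ₗ[ℂ] L2 p.L := ⟨⟨shear, shear_add⟩, shear_smul⟩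

/-- The energy inner product
`ρ₁⟨w, w*⟩ + ρ₂⟨v, v*⟩ + κ⟨u_x + ψ, u*_x + ψ*⟩ + b⟨ψ_x, ψ*_x⟩`. -/
def energyInner (U V : Energy p) : ℂ :=
  (p.ρ₁ : ℂ) * inner ℂ U.w V.w + (p.ρ₂ : ℂ) * inner ℂ U.v V.v
    + (p.κ : ℂ) * inner ℂ U.shear V.shear + (p.b : ℂ) * inner ℂ (grad p.L U.ψ) (grad p.L V.ψ)

theorem re_energyInner (U : Energy p) : (energyInner U U).re =
    p.ρ₁ * ‖U.w‖ ^ 2 + p.ρ₂ * ‖U.v‖ ^ 2 + p.κ * ‖U.shear‖ ^ 2 + p.b * ‖grad p.L U.ψ‖ ^ 2 := by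
  have h : energyInner U U = ((p.ρ₁ * ‖U.w‖ ^ 2 + p.ρ₂ * ‖U.v‖ ^ 2 + p.κ * ‖U.shear‖ ^ 2
      + p.b * ‖grad p.L U.ψ‖ ^ 2 : ℝ) : ℂ) := by
    simp only [energyInner, inner_self_eq_norm_sq_to_K]
    push_cast
    rfl
  rw [h, Complex.ofReal_re]

/-- The energy inner product makes the phase space an inner product space. -/
@[reducible] def core : InnerProductSpace.Core ℂ (Energy p) where
  inner := energyInner
  conj_inner_symm U V := by
    simp only [energyInner, map_add, map_mul, Complex.conj_ofReal, inner_conj_symm]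
  re_inner_nonneg U := by
    have h1 := p.ρ₁_pos
    have h2 := p.ρ₂_pos
    have h3 := p.κ_pos
    have h4 := p.b_pos
    change 0 ≤ (energyInner U U).re
    rw [re_energyInner]
    positivity
  add_left U V W := by
    simp only [energyInner, w_add, v_add, ψ_add, shear_add, map_add, inner_add_left]
    ring
  smul_left U V c := by
    simp only [energyInner, w_smul, v_smul, ψ_smul, shear_smul, map_smul, inner_smul_left]
    ring
  definite U h := by
    have h1 := p.ρ₁_pos
    have h2 := p.ρ₂_pos
    have h3 := p.κ_pos
    have h4 := p.b_pos
    have h := congrArg Complex.re h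
    rw [re_energyInner, Complex.zero_re] at h
    have k1 : 0 ≤ p.ρ₁ * ‖U.w‖ ^ 2 := by positivity
    have k2 : 0 ≤ p.ρ₂ * ‖U.v‖ ^ 2 := by positivity
    have k3 : 0 ≤ p.κ * ‖U.shear‖ ^ 2 := by positivity
    have k4 : 0 ≤ p.b * ‖grad p.L U.ψ‖ ^ 2 := by positivity
    have z : ∀ {c r : ℝ}, 0 < c → c * r ^ 2 = 0 → r = 0 := by
      intro c r hc h
      have := (mul_eq_zero.1 h).resolve_left hc.ne'
      exact pow_eq_zero_iff two_ne_zero |>.1 this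
    obtain ⟨C, -, hC⟩ := exists_poincare p.L
    have hz : ∀ f : H10 p.L, ‖grad p.L f‖ = 0 → f = 0 := by
      intro f hf
      have := hC f
      rw [hf, mul_zero] at this
      exact norm_le_zero_iff.1 this
    have e1 : U.w = 0 := norm_eq_zero.1 (z h1 (by linarith))
    have e2 : U.v = 0 := norm_eq_zero.1 (z h2 (by linarith))
    have e3 : U.shear = 0 := norm_eq_zero.1 (z h3 (by linarith))
    have e4 : U.ψ = 0 := hz _ (z h4 (by linarith))
    have e5 : U.u = 0 := by
      refine hz _ ?_
      rw [shear, e4, Submodule.coe_zero, add_zero] at e3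
      rw [e3, norm_zero]
    exact Prod.ext e5 (Prod.ext e1 (Prod.ext e4 e2))

instance : NormedAddCommGroup (Energy p) := core.toNormedAddCommGroup

instance : InnerProductSpace ℂ (Energy p) := InnerProductSpace.ofCore core.toCore

theorem inner_def (U V : Energy p) : inner ℂ U V = energyInner U V := rfl

theorem norm_sq (U : Energy p) : ‖U‖ ^ 2 =
    p.ρ₁ * ‖U.w‖ ^ 2 + p.ρ₂ * ‖U.v‖ ^ 2 + p.κ * ‖U.shear‖ ^ 2 + p.b * ‖grad p.L U.ψ‖ ^ 2 := by
  rw [← re_energyInner, ← inner_def]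
  exact (inner_self_eq_norm_sq (𝕜 := ℂ) U).symm

theorem u_norm_le (U : Energy p) :
    ‖grad p.L U.u‖ ≤ ‖U.shear‖ + ‖U.ψ‖ := by
  have : grad p.L U.u = U.shear - (U.ψ : L2 p.L) := by
    rw [shear, add_sub_cancel_right]
  rw [this]
  exact norm_sub_le _ _

/-- The energy norm controls all the components. -/
theorem exists_bound (p : Beam) : ∃ C : ℝ, 0 ≤ C ∧ ∀ U : Energy p, ‖U.w‖ ≤ C * ‖U‖ ∧
    ‖U.v‖ ≤ C * ‖U‖ ∧ ‖U.shear‖ ≤ C * ‖U‖ ∧ ‖grad p.L U.ψ‖ ≤ C * ‖U‖ := by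
  have h1 := p.ρ₁_pos
  have h2 := p.ρ₂_pos
  have h3 := p.κ_pos
  have h4 := p.b_pos
  have key : ∀ {c a r : ℝ}, 0 < c → 0 ≤ r → c * a ^ 2 ≤ r ^ 2 → a ≤ (√c)⁻¹ * r := by
    intro c a r hc hr h
    have hs : 0 < √c := Real.sqrt_pos.2 hc
    rw [← div_eq_inv_mul, le_div_iff₀ hs]
    refine le_of_sq_le_sq ?_ hr
    rw [mul_pow, Real.sq_sqrt hc.le]
    linarith
  refine ⟨(√p.ρ₁)⁻¹ + (√p.ρ₂)⁻¹ + (√p.κ)⁻¹ + (√p.b)⁻¹, by positivity, fun U => ?_⟩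
  have hn := norm_sq U
  have k1 : 0 ≤ p.ρ₁ * ‖U.w‖ ^ 2 := by positivity
  have k2 : 0 ≤ p.ρ₂ * ‖U.v‖ ^ 2 := by positivity
  have k3 : 0 ≤ p.κ * ‖U.shear‖ ^ 2 := by positivity
  have k4 : 0 ≤ p.b * ‖grad p.L U.ψ‖ ^ 2 := by positivity
  have g1 : 0 ≤ (√p.ρ₁)⁻¹ * ‖U‖ := by positivity
  have g2 : 0 ≤ (√p.ρ₂)⁻¹ * ‖U‖ := by positivity
  have g3 : 0 ≤ (√p.κ)⁻¹ * ‖U‖ := by positivity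
  have g4 : 0 ≤ (√p.b)⁻¹ * ‖U‖ := by positivity
  have f1 := key (a := ‖U.w‖) h1 (norm_nonneg U) (by linarith)
  have f2 := key (a := ‖U.v‖) h2 (norm_nonneg U) (by linarith)
  have f3 := key (a := ‖U.shear‖) h3 (norm_nonneg U) (by linarith)
  have f4 := key (a := ‖grad p.L U.ψ‖) h4 (norm_nonneg U) (by linarith)
  refine ⟨?_, ?_, ?_, ?_⟩ <;> linarith

/-- The phase space is complete, hence a Hilbert space. -/
instance : CompleteSpace (Energy p) := by
  obtain ⟨C, hC0, hC⟩ := exists_bound p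
  obtain ⟨K, hK0, hK⟩ := exists_poincare p.L
  -- a bounded linear image of a Cauchy sequence converges
  have cau : ∀ (T : Energy p → L2 p.L) (M : ℝ), (∀ U V, T (U - V) = T U - T V) →
      (∀ U, ‖T U‖ ≤ M * ‖U‖) → ∀ s : ℕ → Energy p, CauchySeq s →
      ∃ f, Tendsto (fun n => T (s n)) atTop (𝓝 f) := by
    intro T M hs hb s hc
    refine cauchySeq_tendsto_of_complete ?_
    have hl : LipschitzWith (Real.toNNReal M) T := by
      refine LipschitzWith.of_dist_le_mul fun U V => ?_
      rw [dist_eq_norm, dist_eq_norm, ← hs]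
      exact (hb _).trans (mul_le_mul_of_nonneg_right (Real.le_coe_toNNReal M) (norm_nonneg _))
    exact hc.map hl.uniformContinuous
  have bψ : ∀ U : Energy p, ‖U.ψ‖ ≤ K * (C * ‖U‖) := fun U =>
    (hK _).trans (mul_le_mul_of_nonneg_left (hC U).2.2.2 hK0)
  have bu : ∀ U : Energy p, ‖grad p.L U.u‖ ≤ (C + K * C) * ‖U‖ := fun U => by
    have h1 := u_norm_le U
    have h2 := (hC U).2.2.1
    have h3 := bψ U
    nlinarith
  refine Metric.complete_of_cauchySeq_tendsto fun s hs => ?_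
  obtain ⟨w, hw⟩ := cau (fun U => U.w) C (fun _ _ => rfl) (fun U => (hC U).1) s hs
  obtain ⟨v, hv⟩ := cau (fun U => U.v) C (fun _ _ => rfl) (fun U => (hC U).2.1) s hs
  obtain ⟨f, hf⟩ := cau (fun U => (U.ψ : L2 p.L)) (K * C) (fun _ _ => rfl)
    (fun U => by rw [mul_assoc]; exact bψ U) s hs
  obtain ⟨f', hf'⟩ := cau (fun U => grad p.L U.ψ) C (fun U V => by rw [ψ_sub, map_sub])
    (fun U => (hC U).2.2.2) s hs
  obtain ⟨g, hg⟩ := cau (fun U => (U.u : L2 p.L)) (K * (C + K * C)) (fun _ _ => rfl)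
    (fun U => by
      rw [mul_assoc]
      exact (hK _).trans (mul_le_mul_of_nonneg_left (bu U) hK0)) s hs
  obtain ⟨g', hg'⟩ := cau (fun U => grad p.L U.u) (C + K * C) (fun U V => by rw [u_sub, map_sub])
    bu s hs
  have lim : ∀ {a : ℕ → H10 p.L} {f f' : L2 p.L}, Tendsto (fun n => (a n : L2 p.L)) atTop (𝓝 f) →
      Tendsto (fun n => grad p.L (a n)) atTop (𝓝 f') → ∃ z : H10 p.L, (z : L2 p.L) = f ∧
        grad p.L z = f' := by
    intro a f f' h h'
    have hm : (f, f') ∈ H10graph p.L :=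
      (testGraph p.L).isClosed_topologicalClosure.mem_of_tendsto (h.prodMk_nhds h')
        (Eventually.of_forall fun n => grad_mem (a n))
    exact ⟨⟨f, (f, f'), hm, rfl⟩, rfl, dx_eq _ (H10graph_isWeakDeriv hm)⟩
  obtain ⟨ψ, rfl, rfl⟩ := lim hf hf'
  obtain ⟨u, rfl, rfl⟩ := lim hg hg'
  refine ⟨mk u w ψ v, ?_⟩
  rw [tendsto_iff_norm_sub_tendsto_zero]
  have hz : Tendsto (fun n => ‖s n - mk u w ψ v‖ ^ 2) atTop (𝓝 0) := by
    have e : ∀ n, ‖s n - mk u w ψ v‖ ^ 2 = p.ρ₁ * ‖(s n).w - w‖ ^ 2 + p.ρ₂ * ‖(s n).v - v‖ ^ 2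
        + p.κ * ‖(grad p.L (s n).u - grad p.L u) + (((s n).ψ : L2 p.L) - ψ)‖ ^ 2
        + p.b * ‖grad p.L (s n).ψ - grad p.L ψ‖ ^ 2 := by
      intro n
      rw [norm_sq, shear, u_sub, ψ_sub, map_sub, map_sub, Submodule.coe_sub]
      rfl
    simp only [e]
    have t := ((((hw.sub_const w).norm.pow 2).const_mul p.ρ₁).add
      (((hv.sub_const v).norm.pow 2).const_mul p.ρ₂)).add
      ((((hg'.sub_const (grad p.L u)).add (hf.sub_const (ψ : L2 p.L))).norm.pow 2).const_mul p.κ)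
      |>.add (((hf'.sub_const (grad p.L ψ)).norm.pow 2).const_mul p.b)
    simpa using t
  have := hz.sqrt
  simpa [Real.sqrt_sq] using this

end Energy

/-! ### The operator of the Timoshenko system -/

/-- The domain `D(A) × (D(A^{1/2}) ∩ D(A^τ)) × D(A) × (D(A^{1/2}) ∩ D(A^σ))`, where
`D(A^{1/2}) = H¹₀(0, L)`. -/
def domB (p : Beam) (τ σ : ℝ) : Submodule ℂ (Energy p) where
  carrier := {U | (U.u : L2 p.L) ∈ (lapA p.L).domain ∧
    (U.w ∈ H10 p.L ∧ U.w ∈ (fracA p.L τ).domain) ∧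
    (U.ψ : L2 p.L) ∈ (lapA p.L).domain ∧
    (U.v ∈ H10 p.L ∧ U.v ∈ (fracA p.L σ).domain)}
  zero_mem' := ⟨Submodule.zero_mem _, ⟨Submodule.zero_mem _, Submodule.zero_mem _⟩,
    Submodule.zero_mem _, ⟨Submodule.zero_mem _, Submodule.zero_mem _⟩⟩
  add_mem' := fun h k => ⟨Submodule.add_mem _ h.1 k.1,
    ⟨Submodule.add_mem _ h.2.1.1 k.2.1.1, Submodule.add_mem _ h.2.1.2 k.2.1.2⟩,
    Submodule.add_mem _ h.2.2.1 k.2.2.1,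
    ⟨Submodule.add_mem _ h.2.2.2.1 k.2.2.2.1, Submodule.add_mem _ h.2.2.2.2 k.2.2.2.2⟩⟩
  smul_mem' := fun c _ h => ⟨Submodule.smul_mem _ c h.1,
    ⟨Submodule.smul_mem _ c h.2.1.1, Submodule.smul_mem _ c h.2.1.2⟩,
    Submodule.smul_mem _ c h.2.2.1,
    ⟨Submodule.smul_mem _ c h.2.2.2.1, Submodule.smul_mem _ c h.2.2.2.2⟩⟩

theorem grad_mem_dx {p : Beam} {u : H10 p.L} (h : (u : L2 p.L) ∈ (lapA p.L).domain) :
    grad p.L u ∈ (dx p.L).domain := by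
  obtain ⟨y, hy, e⟩ := h.2
  obtain ⟨z, -, e'⟩ := hy
  have : grad p.L u = dx p.L y := congrArg (dx p.L) (Subtype.ext e.symm)
  rw [this, ← show (z : L2 p.L) = dx p.L y from e']
  exact z.2

theorem shear_mem_dx {p : Beam} {τ σ : ℝ} (U : domB p τ σ) : U.1.shear ∈ (dx p.L).domain :=
  Submodule.add_mem _ (grad_mem_dx U.2.1) (H10_le p.L U.1.ψ.2)

/-- The second component `ρ₁⁻¹[κ(u_x + ψ)_x - A^τ w]` of `B U`. -/
def opB₂ (p : Beam) (τ σ : ℝ) : domB p τ σ →ₗ[ℂ] L2 p.L :=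
  (p.ρ₁ : ℂ)⁻¹ • ((p.κ : ℂ) • ((dx p.L).toFun ∘ₗ
      (Energy.shearL ∘ₗ (domB p τ σ).subtype).codRestrict (dx p.L).domain shear_mem_dx)
    - (fracA p.L τ).toFun ∘ₗ
      (Energy.wL ∘ₗ (domB p τ σ).subtype).codRestrict (fracA p.L τ).domain
        fun U => U.2.2.1.2)

/-- The fourth component `ρ₂⁻¹[-bAψ - κ(u_x + ψ) - A^σ v]` of `B U`. -/
def opB₄ (p : Beam) (τ σ : ℝ) : domB p τ σ →ₗ[ℂ] L2 p.L :=
  (p.ρ₂ : ℂ)⁻¹ • (-((p.b : ℂ) • ((lapA p.L).toFun ∘ₗ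
      ((H10 p.L).subtype ∘ₗ Energy.ψL ∘ₗ (domB p τ σ).subtype).codRestrict (lapA p.L).domain
        fun U => U.2.2.2.1))
    - (p.κ : ℂ) • (Energy.shearL ∘ₗ (domB p τ σ).subtype)
    - (fracA p.L σ).toFun ∘ₗ
      (Energy.vL ∘ₗ (domB p τ σ).subtype).codRestrict (fracA p.L σ).domain
        fun U => U.2.2.2.2.2)

/-- The operator
`B U = (w, ρ₁⁻¹[κ(u_x + ψ)_x - A^τ w], v, ρ₂⁻¹[-bAψ - κ(u_x + ψ) - A^σ v])`
on the domain `domB`. -/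
def opB (p : Beam) (τ σ : ℝ) : Energy p →ₗ.[ℂ] Energy p where
  domain := domB p τ σ
  toFun :=
    { toFun := fun U => Energy.mk ⟨U.1.w, U.2.2.1.1⟩ (opB₂ p τ σ U) ⟨U.1.v, U.2.2.2.2.1⟩
        (opB₄ p τ σ U)
      map_add' := fun U V => by
        rw [map_add, map_add]
        rfl
      map_smul' := fun c U => by
        rw [map_smul, map_smul]
        rfl }

theorem opB_apply (p : Beam) (τ σ : ℝ) (U : (opB p τ σ).domain) :
    opB p τ σ U = Energy.mk
      ⟨U.1.w, U.2.2.1.1⟩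
      ((p.ρ₁ : ℂ)⁻¹ • ((p.κ : ℂ) • dx p.L ⟨U.1.shear, shear_mem_dx U⟩
        - fracA p.L τ ⟨U.1.w, U.2.2.1.2⟩))
      ⟨U.1.v, U.2.2.2.2.1⟩
      ((p.ρ₂ : ℂ)⁻¹ • (-((p.b : ℂ) • lapA p.L ⟨U.1.ψ, U.2.2.2.1⟩)
        - (p.κ : ℂ) • U.1.shear - fracA p.L σ ⟨U.1.v, U.2.2.2.2.2⟩)) := rfl

end Timoshenko

end

/-! The form `⟨B U, U⟩` contains only the two damping terms, so `B` is dissipative; solving the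
stationary beam equations shows that `B` is bounded below with dense range, and that it is
surjective when `τ, σ ≤ 1/2`. Hence the closure of `B` is the inverse of a bounded dissipative
operator `R`, and generates the contraction semigroup `S(t)`, the strong limit of
`exp (t (R - ε)⁻¹)` as `ε → 0⁺`. If `W` is the difference of two weak solutions, then
`Y(t) = ∫₀ᵗ W` solves `Y = R W` with `Y(0) = 0`, and dissipativity forces `Y` to vanish.

The closure of `B` commutes with `S(t)`, but when `B` is not closed the invariance of `D(B)` needs
a separate argument: `D(B)` differs from the domain of the closure through the requirements
`u, ψ ∈ D(A)`, `w ∈ D(A^τ)` and `v ∈ D(A^σ)`. Now `u` and `ψ` solve damped wave equations, of the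
form `ρ y'' + A^θ y' + κ A y = f`, whose sine coefficients are damped oscillators. An energy
estimate weighted by the eigenvalue bounds the coefficients of `A y(t)` by the data, uniformly in
the mode, so `y(t)` stays in `D(A)`; by the equation, its velocity then stays in `D(A^θ)`. -/

noncomputable section

namespace Timoshenko

/-! ### Orbits and generators of contraction semigroups -/

section Generator

variable {E : Type*} [NormedAddCommGroup E] [NormedSpace ℂ E] {S : ContractionSemigroup E}
  {T : E →ₗ.[ℂ] E} {x y : E}

namespace ContractionSemigroup

/-- The orbit `t ↦ S(t) x` as a function on `ℝ`, constant for `t ≤ 0`. -/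
def orbit (S : ContractionSemigroup E) (x : E) (t : ℝ) : E := S.toFun t.toNNReal x

theorem norm_apply_le (S : ContractionSemigroup E) (t : ℝ≥0) (x : E) : ‖S.toFun t x‖ ≤ ‖x‖ :=
  (S.toFun t).le_of_opNorm_le_of_le (S.norm_le_one t) le_rfl |>.trans_eq (one_mul _)

@[simp]
theorem orbit_coe (S : ContractionSemigroup E) (x : E) (t : ℝ≥0) : S.orbit x t = S.toFun t x := by
  rw [orbit, Real.toNNReal_coe]

@[simp]
theorem orbit_zero (S : ContractionSemigroup E) (x : E) : S.orbit x 0 = x := by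
  simp [orbit, S.map_zero]

theorem continuous_orbit (S : ContractionSemigroup E) (x : E) : Continuous (S.orbit x) :=
  (S.continuous_apply x).comp continuous_real_toNNReal

theorem orbit_add (S : ContractionSemigroup E) (x : E) {s t : ℝ} (hs : 0 ≤ s) (ht : 0 ≤ t) :
    S.orbit x (s + t) = S.toFun s.toNNReal (S.orbit x t) := by
  simp only [orbit, Real.toNNReal_add hs ht, S.map_add, ContinuousLinearMap.comp_apply]

theorem orbit_apply (S : ContractionSemigroup E) (x : E) (s : ℝ≥0) {t : ℝ} (ht : 0 ≤ t) :
    S.orbit (S.toFun s x) t = S.toFun s (S.orbit x t) := by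
  lift t to ℝ≥0 using ht
  simp only [orbit_coe, ← ContinuousLinearMap.comp_apply, ← S.map_add, add_comm]

theorem hasDerivWithinAt_orbit_zero_iff :
    HasDerivWithinAt (S.orbit x) y (Ici 0) 0 ↔
      Tendsto (fun t : ℝ≥0 => (t : ℝ)⁻¹ • (S.toFun t x - x)) (𝓝[>] 0) (𝓝 y) := by
  rw [← hasDerivWithinAt_Ioi_iff_Ici, hasDerivWithinAt_iff_tendsto_slope' self_notMem_Ioi,
    ← NNReal.coe_zero, ← NNReal.map_coe_nhdsGT, tendsto_map'_iff]
  simp [Function.comp_def, slope_def_module]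

theorem hasDerivWithinAt_orbit_Ici (h : HasDerivWithinAt (S.orbit x) y (Ici 0) 0) {t : ℝ}
    (ht : 0 ≤ t) : HasDerivWithinAt (S.orbit x) (S.orbit y t) (Ici t) t := by
  have hshift : HasDerivWithinAt (fun r => S.toFun t.toNNReal (S.orbit x (r - t)))
      (S.toFun t.toNNReal y) (Ici t) t := by
    refine ((S.toFun t.toNNReal).restrictScalars ℝ).hasFDerivAt.comp_hasDerivWithinAt t ?_
    simpa [Function.comp_def] using h.scomp_of_eq t ((hasDerivWithinAt_id t (Ici t)).sub_const t)
      (fun r (hr : t ≤ r) => sub_nonneg.2 hr) (sub_self t).symm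
  refine hshift.congr_of_mem (fun r hr => ?_) self_mem_Ici
  rw [← S.orbit_add x ht (sub_nonneg.2 hr), add_sub_cancel]

variable [CompleteSpace E]

theorem orbit_eq_add_integral (h : HasDerivWithinAt (S.orbit x) y (Ici 0) 0) {t : ℝ}
    (ht : 0 ≤ t) : S.orbit x t = x + ∫ s in (0 : ℝ)..t, S.orbit y s := by
  have hint (r : ℝ) : HasDerivAt (fun r => ∫ s in (0 : ℝ)..r, S.orbit y s) (S.orbit y r) r :=
    ((S.continuous_orbit y).integral_hasStrictDerivAt 0 r).hasDerivAt
  have hconst := constant_of_has_deriv_right_zero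
    (f := fun r => S.orbit x r - ∫ s in (0 : ℝ)..r, S.orbit y s) (a := 0) (b := t)
    ((S.continuous_orbit x).continuousOn.sub fun r _ => (hint r).continuousAt.continuousWithinAt)
    (fun r hr => by
      simpa using (hasDerivWithinAt_orbit_Ici h hr.1).fun_sub (hint r).hasDerivWithinAt)
    t (right_mem_Icc.2 ht)
  simpa [sub_eq_iff_eq_add] using hconst

theorem hasDerivWithinAt_orbit (h : HasDerivWithinAt (S.orbit x) y (Ici 0) 0) {t : ℝ}
    (ht : 0 ≤ t) : HasDerivWithinAt (S.orbit x) (S.orbit y t) (Ici 0) t :=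
  (((S.continuous_orbit y).integral_hasStrictDerivAt 0 t).hasDerivAt.const_add
    x).hasDerivWithinAt.congr (fun _ hr => orbit_eq_add_integral h hr) (orbit_eq_add_integral h ht)

theorem hasDerivWithinAt_orbit_integral (S : ContractionSemigroup E) (x : E) {t : ℝ}
    (ht : 0 ≤ t) :
    HasDerivWithinAt (S.orbit (∫ s in (0 : ℝ)..t, S.orbit x s)) (S.orbit x t - x) (Ici 0) 0 := by
  have hc := S.continuous_orbit x
  have hi (a b : ℝ) : IntervalIntegrable (S.orbit x) volume a b := hc.intervalIntegrable a b
  have hshift : HasDerivAt (fun h => (∫ s in (0 : ℝ)..(h + t), S.orbit x s)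
      - ∫ s in (0 : ℝ)..h, S.orbit x s) (S.orbit x t - x) 0 := by
    have ht := ((hc.integral_hasStrictDerivAt 0 (0 + t)).hasDerivAt.comp_add_const 0 t)
    simpa using ht.fun_sub (hc.integral_hasStrictDerivAt 0 0).hasDerivAt
  refine hshift.hasDerivWithinAt.congr_of_mem (fun h (hh : 0 ≤ h) => ?_) self_mem_Ici
  calc S.orbit (∫ s in (0 : ℝ)..t, S.orbit x s) h
      = ∫ s in (0 : ℝ)..t, S.toFun h.toNNReal (S.orbit x s) :=
        ((S.toFun h.toNNReal).intervalIntegral_comp_comm (hi 0 t)).symm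
    _ = ∫ s in (0 : ℝ)..t, S.orbit x (h + s) :=
        intervalIntegral.integral_congr fun s hs =>
          (S.orbit_add x hh (uIcc_of_le ht ▸ hs).1).symm
    _ = ∫ s in h..(h + t), S.orbit x s := by
        rw [intervalIntegral.integral_comp_add_left, add_zero]
    _ = _ := (intervalIntegral.integral_interval_sub_left (hi _ _) (hi _ _)).symm

end ContractionSemigroup

namespace IsGenerator

open ContractionSemigroup

theorem mem_graph_iff (hT : IsGenerator T S) :
    (x, y) ∈ T.graph ↔ HasDerivWithinAt (S.orbit x) y (Ici 0) 0 :=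
  (hT x y).trans hasDerivWithinAt_orbit_zero_iff.symm

theorem map_graph (hT : IsGenerator T S) (t : ℝ≥0) (h : (x, y) ∈ T.graph) :
    (S.toFun t x, S.toFun t y) ∈ T.graph := by
  rw [hT.mem_graph_iff] at h ⊢
  have ht := ((S.toFun t).restrictScalars ℝ).hasFDerivAt.comp_hasDerivWithinAt (0 : ℝ) h
  exact ht.congr_of_mem (fun r hr => S.orbit_apply x t hr) self_mem_Ici

theorem integral_mem_graph [CompleteSpace E] (hT : IsGenerator T S) (x : E) {t : ℝ}
    (ht : 0 ≤ t) : (∫ s in (0 : ℝ)..t, S.orbit x s, S.orbit x t - x) ∈ T.graph :=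
  hT.mem_graph_iff.2 (S.hasDerivWithinAt_orbit_integral x ht)

end IsGenerator

end Generator

/-! ### Densely defined operators with a bounded dissipative inverse -/

section BoundedInverse

variable {E : Type*} [NormedAddCommGroup E] [InnerProductSpace ℂ E]

/-- A bounded operator is dissipative if `Re ⟨R x, x⟩ ≤ 0` for every `x`. This is the notion
`IsDissipative` for everywhere defined operators. -/
def IsBoundedDissipative (R : E →L[ℂ] E) : Prop := ∀ x, (inner ℂ (R x) x).re ≤ 0

/-- The bounded operator `R` is the inverse of the unbounded operator `T`, which is thereby a
bijection of its domain onto `E`. -/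
def IsBoundedInverse (R : E →L[ℂ] E) (T : E →ₗ.[ℂ] E) : Prop :=
  ∀ x y, (x, y) ∈ T.graph ↔ R y = x

variable {B T : E →ₗ.[ℂ] E} {R : E →L[ℂ] E}

theorem IsBoundedDissipative.inner_apply_eq_zero (hR : IsBoundedDissipative R) {y : E}
    (hy : R y = 0) (z : E) : inner ℂ (R z) y = 0 := by
  set a : ℂ := inner ℂ (R z) y
  have hquad (r : ℝ) : (‖a‖ ^ 2 * (inner ℂ (R z) z).re) * (r * r) + ‖a‖ ^ 2 * r + 0 ≤ 0 := by
    have hexpand : inner ℂ (R (y + (r * a) • z)) (y + (r * a) • z)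
        = ((‖a‖ ^ 2 * (r * r) : ℝ) : ℂ) * inner ℂ (R z) z + ((‖a‖ ^ 2 * r : ℝ) : ℂ) := by
      have ha : (starRingEnd ℂ) a * a = ((‖a‖ ^ 2 : ℝ) : ℂ) := by
        rw [mul_comm, Complex.mul_conj, Complex.normSq_eq_norm_sq]
      have ha' : inner ℂ (R z) y = a := rfl
      rw [map_add, hy, zero_add, map_smul, inner_smul_left, inner_add_right, inner_smul_right, ha']
      simp only [map_mul, Complex.conj_ofReal]
      push_cast at ha ⊢
      linear_combination ((r : ℂ) + r ^ 2 * inner ℂ (R z) z) * ha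
    have h := hR (y + (r * a) • z)
    rw [hexpand, Complex.add_re, Complex.ofReal_re, Complex.re_ofReal_mul] at h
    linarith
  have hdiscrim := discrim_le_zero_of_nonpos hquad
  simpa [discrim, sq_nonpos_iff] using hdiscrim

theorem IsBoundedDissipative.eq_zero_of_apply_eq_zero (hR : IsBoundedDissipative R)
    (hd : DenseRange R) {y : E} (hy : R y = 0) : y = 0 :=
  hd.eq_zero_of_inner_right ℂ fun z => hR.inner_apply_eq_zero hy z

theorem exists_leftInverse_of_norm_le [CompleteSpace E] {K : ℝ}
    (hK : ∀ x : B.domain, ‖(x : E)‖ ≤ K * ‖B x‖) (hr : DenseRange B) :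
    ∃ R : E →L[ℂ] E, ∀ x, R (B x) = x :=
  ⟨LinearMap.extendOfNorm B.domain.subtype B.toFun,
    LinearMap.extendOfNorm_eq (f := B.domain.subtype) (e := B.toFun) hr ⟨K, hK⟩⟩

theorem IsDissipative.isBoundedDissipative_leftInverse (hB : IsDissipative B)
    (hr : DenseRange B) (hR : ∀ x, R (B x) = x) : IsBoundedDissipative R := by
  intro y
  induction y using hr.induction_on with
  | hp =>
    exact isClosed_le (Complex.continuous_re.comp (R.continuous.inner continuous_id))
      continuous_const
  | ih x =>
    rw [hR, ← inner_conj_symm, Complex.conj_re]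
    exact hB x

theorem denseRange_leftInverse (hd : Dense (B.domain : Set E)) (hR : ∀ x, R (B x) = x) :
    DenseRange R :=
  hd.mono fun x hx => ⟨B ⟨x, hx⟩, hR ⟨x, hx⟩⟩

theorem mem_closure_graph_iff (hr : DenseRange B) (hR : ∀ x, R (B x) = x) {x y : E} :
    (x, y) ∈ B.graph.topologicalClosure ↔ R y = x := by
  constructor
  · refine fun h => closure_minimal ?_
      (isClosed_eq (R.continuous.comp continuous_snd) continuous_fst) h
    rintro ⟨_, _⟩ hz
    obtain ⟨z, rfl, rfl⟩ := (LinearPMap.mem_graph_iff _).1 hz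
    exact hR z
  · rintro rfl
    induction y using hr.induction_on with
    | hp => exact B.graph.isClosed_topologicalClosure.preimage (R.continuous.prodMk continuous_id)
    | ih z =>
      rw [hR]
      exact B.graph.le_topologicalClosure (B.mem_graph z)

theorem isClosable_of_leftInverse (hr : DenseRange B) (hR : ∀ x, R (B x) = x)
    (hinj : ∀ y, R y = 0 → y = 0) : B.IsClosable := by
  refine ⟨B.graph.topologicalClosure.toLinearPMap, (Submodule.toLinearPMap_graph_eq _ ?_).symm⟩
  rintro ⟨_, y⟩ h rfl
  exact hinj y ((mem_closure_graph_iff hr hR).1 h)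

theorem isBoundedInverse_closure (hcl : B.IsClosable) (hr : DenseRange B)
    (hR : ∀ x, R (B x) = x) : IsBoundedInverse R B.closure := fun x y => by
  rw [← hcl.graph_closure_eq_closure_graph, mem_closure_graph_iff hr hR]

theorem IsDissipative.exists_isBoundedInverse_closure [CompleteSpace E] {K : ℝ}
    (hB : IsDissipative B) (hd : Dense (B.domain : Set E)) (hr : DenseRange B)
    (hK : ∀ x : B.domain, ‖(x : E)‖ ≤ K * ‖B x‖) :
    ∃ R : E →L[ℂ] E, B.IsClosable ∧ IsBoundedInverse R B.closure ∧
      IsBoundedDissipative R ∧ DenseRange R := by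
  obtain ⟨R, hR⟩ := exists_leftInverse_of_norm_le hK hr
  have hdiss := hB.isBoundedDissipative_leftInverse hr hR
  have hdR := denseRange_leftInverse hd hR
  have hcl := isClosable_of_leftInverse hr hR fun _ => hdiss.eq_zero_of_apply_eq_zero hdR
  exact ⟨R, hcl, isBoundedInverse_closure hcl hr hR, hdiss, hdR⟩

theorem IsBoundedInverse.inResolventSet_zero (hR : IsBoundedInverse R T) :
    InResolventSet T 0 := by
  refine ⟨-R, fun y => ?_, fun x => ?_⟩
  · obtain ⟨z, hz, hTz⟩ := (LinearPMap.mem_graph_iff _).1 ((hR (-R y) (-y)).2 (map_neg R y))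
    refine ⟨(show (z : E) = (-R) y from hz) ▸ z.2, ?_⟩
    rw [show (⟨(-R) y, _⟩ : T.domain) = z from Subtype.ext hz.symm, hTz]
    simp
  · have hRT := (hR _ _).1 (T.mem_graph x)
    simpa using hRT

theorem IsBoundedInverse.eq_of_le (hR : IsBoundedInverse R T) (hBT : B ≤ T)
    (hs : Function.Surjective B) : T = B := by
  refine (LinearPMap.eq_of_le_of_domain_eq hBT (le_antisymm hBT.1 fun x hx => ?_)).symm
  obtain ⟨z, hz⟩ := hs (T ⟨x, hx⟩)
  have hRx : R (T ⟨x, hx⟩) = x := (hR _ _).1 (T.mem_graph ⟨x, hx⟩)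
  have hRz : R (T ⟨x, hx⟩) = z :=
    (hR _ _).1 (LinearPMap.le_graph_of_le hBT (hz ▸ B.mem_graph z))
  exact (hRx.symm.trans hRz) ▸ z.2

end BoundedInverse

/-! ### Weak solutions -/

section WeakSolution

variable {E : Type*} [NormedAddCommGroup E] [InnerProductSpace ℂ E] [CompleteSpace E]
  {B : E →ₗ.[ℂ] E} {R : E →L[ℂ] E} {S : ContractionSemigroup E} {x : E} {U : ℝ → E}

theorem inner_intervalIntegral (w : E) {f : ℝ → E} (hf : Continuous f) (a b : ℝ) :
    inner ℂ w (∫ s in a..b, f s) = ∫ s in a..b, inner ℂ w (f s) :=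
  ((innerSL ℂ w).intervalIntegral_comp_comm (hf.intervalIntegrable a b)).symm

theorem inner_adjoint_apply_of_mem_closure_graph (hd : Dense (B.domain : Set E))
    (V : B.adjoint.domain) {y : E} (h : (x, y) ∈ B.graph.topologicalClosure) :
    inner ℂ (B.adjoint V) x = inner ℂ (V : E) y := by
  refine closure_minimal ?_ (isClosed_eq
    (continuous_const.inner continuous_fst) (continuous_const.inner continuous_snd)) h
  rintro ⟨_, _⟩ hz
  obtain ⟨z, rfl, rfl⟩ := (LinearPMap.mem_graph_iff _).1 hz
  exact LinearPMap.adjoint_isFormalAdjoint hd V z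

theorem IsGenerator.isWeakSolution_orbit (hd : Dense (B.domain : Set E)) (hcl : B.IsClosable)
    (hS : IsGenerator B.closure S) (x : E) : IsWeakSolution B x (S.orbit x) := by
  refine ⟨(S.continuous_orbit x).continuousOn, S.orbit_zero x, fun V t ht => ?_⟩
  have h := inner_adjoint_apply_of_mem_closure_graph hd V
    (hcl.graph_closure_eq_closure_graph ▸ hS.integral_mem_graph x ht)
  rw [inner_sub_right, inner_intervalIntegral _ (S.continuous_orbit x)] at h
  rw [h, add_sub_cancel]

theorem IsWeakSolution.exists_continuous (hU : IsWeakSolution B x U) :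
    ∃ W, Continuous W ∧ EqOn W U (Ici 0) ∧ IsWeakSolution B x W := by
  have hmax (t : ℝ) : max t 0 ∈ Ici 0 := le_max_right t 0
  have hc : Continuous fun t => U (max t 0) :=
    hU.continuousOn.comp_continuous (continuous_id.max continuous_const) hmax
  have heq : EqOn (fun t => U (max t 0)) U (Ici 0) := fun t (ht : 0 ≤ t) => by
    simp only [max_eq_left ht]
  refine ⟨_, hc, heq, hc.continuousOn, (heq self_mem_Ici).trans hU.initial, fun V t ht => ?_⟩
  refine (congrArg _ (heq ht)).trans ((hU.weak V t ht).trans ?_)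
  refine congrArg _ (intervalIntegral.integral_congr fun s hs => ?_)
  exact congrArg _ (heq (uIcc_of_le ht ▸ hs).1).symm

-- The test vectors are `R* z`, for which `B* R* z = z`.
theorem IsWeakSolution.leftInverse_sub_initial (hU : IsWeakSolution B x U) (hc : Continuous U)
    (hd : Dense (B.domain : Set E)) (hR : ∀ x, R (B x) = x) {t : ℝ} (ht : 0 ≤ t) :
    R (U t - x) = ∫ s in (0 : ℝ)..t, U s := by
  refine ext_inner_left ℂ fun z => ?_
  have hz (x : B.domain) : inner ℂ z (x : E) = inner ℂ (R.adjoint z) (B x) := by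
    rw [ContinuousLinearMap.adjoint_inner_left, hR]
  let V : B.adjoint.domain := ⟨_, LinearPMap.mem_adjoint_domain_of_exists _ ⟨z, hz⟩⟩
  have hV : B.adjoint V = z := LinearPMap.adjoint_apply_eq hd V hz
  rw [← ContinuousLinearMap.adjoint_inner_left, inner_sub_right, sub_eq_iff_eq_add',
    inner_intervalIntegral _ hc]
  simpa only [hV] using hU.weak V t ht

theorem IsBoundedDissipative.eq_zero_of_apply_eq_integral (hR : IsBoundedDissipative R)
    (hdR : DenseRange R) {W : ℝ → E} (hW : Continuous W)
    (h : ∀ t, 0 ≤ t → R (W t) = ∫ s in (0 : ℝ)..t, W s) {t : ℝ} (ht : 0 ≤ t) : W t = 0 := by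
  set Y : ℝ → E := fun t => ∫ s in (0 : ℝ)..t, W s with hY
  have hderiv (s : ℝ) : HasDerivAt (fun t => ‖Y t‖ ^ 2) (2 * (inner ℂ (Y s) (W s)).re) s := by
    let _ : InnerProductSpace ℝ E := InnerProductSpace.rclikeToReal ℂ E
    exact (hW.integral_hasStrictDerivAt 0 s).hasDerivAt.norm_sq
  have hanti : AntitoneOn (fun t => ‖Y t‖ ^ 2) (Ici 0) := by
    refine antitoneOn_of_hasDerivWithinAt_nonpos (convex_Ici 0)
      (fun s _ => (hderiv s).continuousAt.continuousWithinAt)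
      (fun s _ => (hderiv s).hasDerivWithinAt) fun s hs => ?_
    rw [show Y s = R (W s) from (h s (interior_subset hs)).symm]
    linarith [hR (W s)]
  have hYt : ‖Y t‖ ^ 2 ≤ 0 := by simpa [hY] using hanti self_mem_Ici ht ht
  refine hR.eq_zero_of_apply_eq_zero hdR ?_
  rw [h t ht]
  exact norm_eq_zero.1 (sq_nonpos_iff _ |>.1 hYt)

theorem IsWeakSolution.unique (hd : Dense (B.domain : Set E)) (hdiss : IsBoundedDissipative R)
    (hdR : DenseRange R) (hR : ∀ x, R (B x) = x) {U' : ℝ → E} (hU : IsWeakSolution B x U)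
    (hU' : IsWeakSolution B x U') {t : ℝ} (ht : 0 ≤ t) : U' t = U t := by
  obtain ⟨W, hc, hWU, hW⟩ := hU.exists_continuous
  obtain ⟨W', hc', hWU', hW'⟩ := hU'.exists_continuous
  rw [← hWU ht, ← hWU' ht, ← sub_eq_zero]
  refine hdiss.eq_zero_of_apply_eq_integral hdR (hc'.sub hc) (fun t ht => ?_) ht
  calc R (W' t - W t) = R (W' t - x) - R (W t - x) := by rw [← map_sub, sub_sub_sub_cancel_right]
    _ = (∫ s in (0 : ℝ)..t, W' s) - ∫ s in (0 : ℝ)..t, W s := by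
      rw [hW'.leftInverse_sub_initial hc' hd hR ht, hW.leftInverse_sub_initial hc hd hR ht]
    _ = ∫ s in (0 : ℝ)..t, (W' s - W s) :=
      (intervalIntegral.integral_sub (hc'.intervalIntegrable _ _) (hc.intervalIntegrable _ _)).symm

end WeakSolution

/-! ### The semigroup generated by the inverse of a bounded dissipative operator -/

section Exponential

variable {E : Type*} [NormedAddCommGroup E] [InnerProductSpace ℂ E] [CompleteSpace E]
  {G H : E →L[ℂ] E}

theorem hasDerivAt_exp_smul_apply (G : E →L[ℂ] E) (x : E) (t : ℝ) :
    HasDerivAt (fun t : ℝ => NormedSpace.exp (t • G) x) (NormedSpace.exp (t • G) (G x)) t :=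
  ((ContinuousLinearMap.apply ℂ E x).restrictScalars ℝ).hasFDerivAt.comp_hasDerivAt t
    (hasDerivAt_exp_smul_const (𝕂 := ℝ) G t)

theorem continuous_exp_smul_apply (G : E →L[ℂ] E) (x : E) :
    Continuous fun t : ℝ => NormedSpace.exp (t • G) x :=
  continuous_iff_continuousAt.2 fun t => (hasDerivAt_exp_smul_apply G x t).continuousAt

theorem exp_smul_apply_comm (h : Commute G H) (t : ℝ) (x : E) :
    NormedSpace.exp (t • G) (H x) = H (NormedSpace.exp (t • G) x) :=
  DFunLike.congr_fun ((h.smul_left t).exp_left).eq x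

theorem exp_add_smul (G : E →L[ℂ] E) (s t : ℝ) :
    NormedSpace.exp ((s + t) • G) = NormedSpace.exp (s • G) * NormedSpace.exp (t • G) := by
  let _ : NormedAlgebra ℚ (E →L[ℂ] E) := NormedAlgebra.restrictScalars ℚ ℂ _
  rw [add_smul]
  exact NormedSpace.exp_add_of_commute (((Commute.refl G).smul_left s).smul_right t)

theorem IsBoundedDissipative.norm_exp_smul_apply_le (hG : IsBoundedDissipative G) {t : ℝ}
    (ht : 0 ≤ t) (x : E) : ‖NormedSpace.exp (t • G) x‖ ≤ ‖x‖ := by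
  have hderiv (s : ℝ) : HasDerivAt (fun s : ℝ => ‖NormedSpace.exp (s • G) x‖ ^ 2)
      (2 * (inner ℂ (G (NormedSpace.exp (s • G) x)) (NormedSpace.exp (s • G) x)).re) s := by
    let _ : InnerProductSpace ℝ E := InnerProductSpace.rclikeToReal ℂ E
    have h := (hasDerivAt_exp_smul_apply G x s).norm_sq
    rw [exp_smul_apply_comm (Commute.refl G), real_inner_comm] at h
    exact h
  have hanti : AntitoneOn (fun s : ℝ => ‖NormedSpace.exp (s • G) x‖ ^ 2) (Ici 0) :=
    antitoneOn_of_hasDerivWithinAt_nonpos (convex_Ici 0)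
      (fun s _ => (hderiv s).continuousAt.continuousWithinAt)
      (fun s _ => (hderiv s).hasDerivWithinAt) fun s _ => by
        linarith [hG (NormedSpace.exp (s • G) x)]
  have h := hanti self_mem_Ici ht ht
  simp only [zero_smul, NormedSpace.exp_zero, one_apply_eq_self] at h
  exact le_of_sq_le_sq h (norm_nonneg _)

theorem IsBoundedDissipative.norm_exp_smul_sub_exp_smul_le (hG : IsBoundedDissipative G) {s t : ℝ}
    (hs : 0 ≤ s) (ht : 0 ≤ t) (x : E) :
    ‖NormedSpace.exp (t • G) x - NormedSpace.exp (s • G) x‖ ≤ ‖G x‖ * |t - s| :=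
  (convex_Ici (0 : ℝ)).norm_image_sub_le_of_norm_hasDerivWithin_le
    (fun r _ => (hasDerivAt_exp_smul_apply G x r).hasDerivWithinAt)
    (fun _ hr => hG.norm_exp_smul_apply_le hr _) hs ht

theorem hasDerivAt_exp_smul_exp_smul_apply (h : Commute G H) (x : E) (t s : ℝ) :
    HasDerivAt (fun s : ℝ => NormedSpace.exp (s • G) (NormedSpace.exp ((t - s) • H) x))
      (NormedSpace.exp (s • G) (NormedSpace.exp ((t - s) • H) (G x - H x))) s := by
  have hG := (ContinuousLinearMap.restrictScalarsL ℂ E E ℝ ℝ).hasFDerivAt.comp_hasDerivAt s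
    (hasDerivAt_exp_smul_const (𝕂 := ℝ) G s)
  have hH : HasDerivAt (fun s : ℝ => NormedSpace.exp ((t - s) • H) x)
      (-(NormedSpace.exp ((t - s) • H) (H x))) s := by
    simpa using! (hasDerivAt_exp_smul_apply H x (t - s)).scomp s ((hasDerivAt_id s).const_sub t)
  have hprod : HasDerivAt
      (fun s : ℝ => NormedSpace.exp (s • G) (NormedSpace.exp ((t - s) • H) x))
      (NormedSpace.exp (s • G) (G (NormedSpace.exp ((t - s) • H) x))
        + NormedSpace.exp (s • G) (-(NormedSpace.exp ((t - s) • H) (H x)))) s := hG.clm_apply hH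
  rwa [← exp_smul_apply_comm h.symm, ← map_add, ← sub_eq_add_neg, ← map_sub] at hprod

theorem IsBoundedDissipative.norm_exp_smul_sub_exp_smul_le_of_commute
    (hG : IsBoundedDissipative G) (hH : IsBoundedDissipative H) (hc : Commute G H) {t : ℝ}
    (ht : 0 ≤ t) (x : E) :
    ‖NormedSpace.exp (t • G) x - NormedSpace.exp (t • H) x‖ ≤ ‖G x - H x‖ * t := by
  have h := (convex_Icc (0 : ℝ) t).norm_image_sub_le_of_norm_hasDerivWithin_le
    (fun s _ => (hasDerivAt_exp_smul_exp_smul_apply hc x t s).hasDerivWithinAt)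
    (fun s hs => (hG.norm_exp_smul_apply_le hs.1 _).trans
      (hH.norm_exp_smul_apply_le (sub_nonneg.2 hs.2) _))
    (left_mem_Icc.2 ht) (right_mem_Icc.2 ht)
  simpa [abs_of_nonneg ht] using h

end Exponential

section Yosida

variable {E : Type*} [NormedAddCommGroup E] [InnerProductSpace ℂ E]

theorem tendsto_apply_zero_of_denseRange {ι κ : Type*} {l : Filter ι} {T : ι → E →L[ℂ] E}
    {g : κ → E} {M : ℝ} (hT : ∀ᶠ i in l, ∀ x, ‖T i x‖ ≤ M * ‖x‖) (hd : DenseRange g)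
    (h : ∀ z, Tendsto (fun i => T i (g z)) l (𝓝 0)) (x : E) :
    Tendsto (fun i => T i x) l (𝓝 0) := by
  rw [Metric.tendsto_nhds]
  intro ε hε
  obtain ⟨z, hz⟩ := hd.exists_dist_lt x (show 0 < ε / 2 / (|M| + 1) by positivity)
  rw [dist_eq_norm, lt_div_iff₀ (by positivity)] at hz
  filter_upwards [hT, Metric.tendsto_nhds.1 (h z) (ε / 2) (by positivity)] with i hTi hi
  rw [dist_zero_right] at hi ⊢
  have hM : M * ‖x - g z‖ ≤ ‖x - g z‖ * (|M| + 1) := by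
    rw [mul_comm]
    exact mul_le_mul_of_nonneg_left ((le_abs_self M).trans (by linarith)) (norm_nonneg _)
  calc ‖T i x‖ = ‖T i (x - g z) + T i (g z)‖ := by rw [← map_add, sub_add_cancel]
    _ ≤ M * ‖x - g z‖ + ‖T i (g z)‖ := (norm_add_le _ _).trans (by gcongr; exact hTi _)
    _ < ε := by linarith

/-- The Yosida approximation `(R - ε)⁻¹` of the inverse of `R`; for dissipative `R` and `ε > 0`
the operator `R - ε` is invertible. -/
def yosida (R : E →L[ℂ] E) (ε : ℝ) : E →L[ℂ] E := Ring.inverse (R - (ε : ℂ) • 1)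

theorem commute_yosida (R : E →L[ℂ] E) (ε δ : ℝ) : Commute (yosida R ε) (yosida R δ) :=
  Commute.ringInverse_ringInverse <|
    ((Commute.refl R).sub_right ((Commute.one_right R).smul_right _)).sub_left
      (((Commute.one_left R).sub_right ((Commute.refl _).smul_right _)).smul_left _)

variable [CompleteSpace E] {R : E →L[ℂ] E} {ε : ℝ}

namespace IsBoundedDissipative

theorem isUnit_sub_smul_one (hR : IsBoundedDissipative R) (hε : 0 < ε) :
    IsUnit (R - (ε : ℂ) • 1) := by
  refine ContinuousLinearMap.isUnit_of_forall_le_norm_inner_map _ (c := ⟨ε, hε.le⟩) hε fun x => ?_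
  have hre : (inner ℂ ((R - (ε : ℂ) • 1) x) x).re = (inner ℂ (R x) x).re - ε * ‖x‖ ^ 2 := by
    have hx := inner_self_eq_norm_sq (𝕜 := ℂ) x
    simp only [RCLike.re_to_complex] at hx
    simp only [sub_apply, smul_apply, one_apply_eq_self, inner_sub_left, inner_smul_left,
      Complex.conj_ofReal, Complex.sub_re, Complex.re_ofReal_mul, hx]
  have hle := (neg_le_abs _).trans (Complex.abs_re_le_norm (inner ℂ ((R - (ε : ℂ) • 1) x) x))
  change ‖x‖ ^ 2 * ε ≤ _
  linarith [hR x]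

theorem apply_yosida (hR : IsBoundedDissipative R) (hε : 0 < ε) (x : E) :
    R (yosida R ε x) = x + (ε : ℂ) • yosida R ε x :=
  sub_eq_iff_eq_add.1
    (DFunLike.congr_fun (Ring.mul_inverse_cancel _ (hR.isUnit_sub_smul_one hε)) x)

theorem yosida_apply (hR : IsBoundedDissipative R) (hε : 0 < ε) (x : E) :
    yosida R ε (R x) = x + (ε : ℂ) • yosida R ε x := by
  have h := DFunLike.congr_fun (Ring.inverse_mul_cancel _ (hR.isUnit_sub_smul_one hε)) x
  change yosida R ε (R x - (ε : ℂ) • x) = x at h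
  rwa [map_sub, map_smul, sub_eq_iff_eq_add] at h

theorem commute_yosida_self (hR : IsBoundedDissipative R) (hε : 0 < ε) :
    Commute (yosida R ε) R :=
  ContinuousLinearMap.ext fun x => (hR.yosida_apply hε x).trans (hR.apply_yosida hε x).symm

theorem re_inner_yosida_le (hR : IsBoundedDissipative R) (hε : 0 < ε) (x : E) :
    (inner ℂ (yosida R ε x) x).re ≤ -(ε * ‖yosida R ε x‖ ^ 2) := by
  have hx : x = R (yosida R ε x) - (ε : ℂ) • yosida R ε x := by
    rw [hR.apply_yosida hε, add_sub_cancel_right]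
  have hsq := inner_self_eq_norm_sq (𝕜 := ℂ) (yosida R ε x)
  have hsymm := inner_re_symm (𝕜 := ℂ) (yosida R ε x) (R (yosida R ε x))
  simp only [RCLike.re_to_complex] at hsq hsymm
  calc (inner ℂ (yosida R ε x) x).re
      = (inner ℂ (R (yosida R ε x)) (yosida R ε x)).re - ε * ‖yosida R ε x‖ ^ 2 := by
        nth_rw 2 [hx]
        rw [inner_sub_right, inner_smul_right, Complex.sub_re, Complex.re_ofReal_mul, hsq, hsymm]
    _ ≤ -(ε * ‖yosida R ε x‖ ^ 2) := by linarith [hR (yosida R ε x)]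

theorem isBoundedDissipative_yosida (hR : IsBoundedDissipative R) (hε : 0 < ε) :
    IsBoundedDissipative (yosida R ε) := fun x =>
  (hR.re_inner_yosida_le hε x).trans (neg_nonpos.2 (mul_nonneg hε.le (sq_nonneg _)))

theorem norm_smul_yosida_apply_le (hR : IsBoundedDissipative R) (hε : 0 < ε) (x : E) :
    ‖(ε : ℂ) • yosida R ε x‖ ≤ ‖x‖ := by
  rw [norm_smul, Complex.norm_real, Real.norm_of_nonneg hε.le]
  rcases (norm_nonneg (yosida R ε x)).eq_or_lt with h0 | hpos
  · rw [← h0, mul_zero]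
    exact norm_nonneg x
  · have hcs : -(inner ℂ (yosida R ε x) x).re ≤ ‖yosida R ε x‖ * ‖x‖ :=
      (neg_le_abs _).trans ((Complex.abs_re_le_norm _).trans (norm_inner_le_norm _ _))
    refine le_of_mul_le_mul_left ?_ hpos
    linarith [hR.re_inner_yosida_le hε x]

theorem norm_yosida_apply_le (hR : IsBoundedDissipative R) (hε : 0 < ε) (x : E) :
    ‖yosida R ε (R x)‖ ≤ 2 * ‖x‖ := by
  rw [hR.yosida_apply hε, two_mul]
  exact (norm_add_le _ _).trans (by gcongr; exact hR.norm_smul_yosida_apply_le hε x)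

theorem tendsto_yosida_apply (hR : IsBoundedDissipative R) (hd : DenseRange R) (x : E) :
    Tendsto (fun ε => yosida R ε (R x)) (𝓝[>] 0) (𝓝 x) := by
  have hsmall : Tendsto (fun ε : ℝ => ((ε : ℂ) • yosida R ε) x) (𝓝[>] 0) (𝓝 0) := by
    refine tendsto_apply_zero_of_denseRange (M := 1) ?_ hd (fun z => ?_) x
    · filter_upwards [self_mem_nhdsWithin] with ε hε x
      simpa using hR.norm_smul_yosida_apply_le hε x
    · have hlim : Tendsto (fun ε : ℝ => ε * (2 * ‖z‖)) (𝓝[>] 0) (𝓝 0) := by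
        have hid : Tendsto (fun ε : ℝ => ε) (𝓝[>] 0) (𝓝 0) := nhdsWithin_le_nhds
        simpa using hid.mul_const (2 * ‖z‖)
      refine squeeze_zero_norm' ?_ hlim
      filter_upwards [self_mem_nhdsWithin] with ε (hε : 0 < ε)
      rw [smul_apply, norm_smul, Complex.norm_real, Real.norm_of_nonneg hε.le]
      exact mul_le_mul_of_nonneg_left (hR.norm_yosida_apply_le hε z) hε.le
  have hsum : Tendsto (fun ε : ℝ => x + ((ε : ℂ) • yosida R ε) x) (𝓝[>] 0) (𝓝 x) := by
    simpa using hsmall.const_add x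
  refine hsum.congr' ?_
  filter_upwards [self_mem_nhdsWithin] with ε hε
  exact (hR.yosida_apply hε x).symm

theorem exists_tendsto_exp_yosida (hR : IsBoundedDissipative R) (hd : DenseRange R) (t : ℝ≥0)
    (x : E) : ∃ y, Tendsto (fun ε => NormedSpace.exp ((t : ℝ) • yosida R ε) x) (𝓝[>] 0) (𝓝 y) := by
  have hpos : ∀ᶠ q : ℝ × ℝ in 𝓝[>] 0 ×ˢ 𝓝[>] 0, 0 < q.1 ∧ 0 < q.2 :=
    (eventually_mem_nhdsWithin (a := (0 : ℝ)) (s := Ioi 0)).prod_mk eventually_mem_nhdsWithin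
  rw [← cauchy_map_iff_exists_tendsto, cauchy_map_iff', tendsto_uniformity_iff_dist_tendsto_zero]
  simp only [dist_eq_norm]
  refine tendsto_zero_iff_norm_tendsto_zero.1 (tendsto_apply_zero_of_denseRange (M := 2)
    (T := fun q : ℝ × ℝ => NormedSpace.exp ((t : ℝ) • yosida R q.1)
      - NormedSpace.exp ((t : ℝ) • yosida R q.2)) ?_ hd (fun z => ?_) x)
  · filter_upwards [hpos] with q hq x
    rw [two_mul]
    exact (norm_sub_le _ _).trans (add_le_add
      ((hR.isBoundedDissipative_yosida hq.1).norm_exp_smul_apply_le t.2 x)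
      ((hR.isBoundedDissipative_yosida hq.2).norm_exp_smul_apply_le t.2 x))
  · have hlim : Tendsto (fun q : ℝ × ℝ => ‖yosida R q.1 (R z) - yosida R q.2 (R z)‖ * (t : ℝ))
        (𝓝[>] 0 ×ˢ 𝓝[>] 0) (𝓝 0) := by
      have h := hR.tendsto_yosida_apply hd z
      simpa using ((h.comp tendsto_fst).sub (h.comp tendsto_snd)).norm.mul_const (t : ℝ)
    refine squeeze_zero_norm' ?_ hlim
    filter_upwards [hpos] with q hq
    exact (hR.isBoundedDissipative_yosida hq.1).norm_exp_smul_sub_exp_smul_le_of_commute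
      (hR.isBoundedDissipative_yosida hq.2) (commute_yosida R _ _) t.2 (R z)

/-- The strong limit of `exp (t (R - ε)⁻¹)` as `ε → 0⁺`. -/
def expInverse (hR : IsBoundedDissipative R) (hd : DenseRange R) (t : ℝ≥0) : E →L[ℂ] E :=
  continuousLinearMapOfTendsto (l := 𝓝[>] (0 : ℝ))
    (fun ε => NormedSpace.exp ((t : ℝ) • yosida R ε))
    (tendsto_pi_nhds.2 fun x => (hR.exists_tendsto_exp_yosida hd t x).choose_spec)

theorem tendsto_expInverse (hR : IsBoundedDissipative R) (hd : DenseRange R) (t : ℝ≥0) (x : E) :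
    Tendsto (fun ε => NormedSpace.exp ((t : ℝ) • yosida R ε) x) (𝓝[>] 0)
      (𝓝 (hR.expInverse hd t x)) :=
  (hR.exists_tendsto_exp_yosida hd t x).choose_spec

theorem norm_expInverse_apply_le (hR : IsBoundedDissipative R) (hd : DenseRange R) (t : ℝ≥0)
    (x : E) : ‖hR.expInverse hd t x‖ ≤ ‖x‖ := by
  refine le_of_tendsto (hR.tendsto_expInverse hd t x).norm ?_
  filter_upwards [self_mem_nhdsWithin] with ε hε
  exact (hR.isBoundedDissipative_yosida hε).norm_exp_smul_apply_le t.2 x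

theorem tendsto_exp_yosida_apply (hR : IsBoundedDissipative R) (hd : DenseRange R) (t : ℝ≥0)
    {y : ℝ → E} {x : E} (hy : Tendsto y (𝓝[>] 0) (𝓝 x)) :
    Tendsto (fun ε => NormedSpace.exp ((t : ℝ) • yosida R ε) (y ε)) (𝓝[>] 0)
      (𝓝 (hR.expInverse hd t x)) := by
  have hdiff : Tendsto (fun ε => NormedSpace.exp ((t : ℝ) • yosida R ε) (y ε - x)) (𝓝[>] 0)
      (𝓝 0) := by
    refine squeeze_zero_norm' ?_ (tendsto_iff_norm_sub_tendsto_zero.1 hy)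
    filter_upwards [self_mem_nhdsWithin] with ε hε
    exact (hR.isBoundedDissipative_yosida hε).norm_exp_smul_apply_le t.2 _
  simpa using hdiff.add (hR.tendsto_expInverse hd t x)

theorem expInverse_apply_comm (hR : IsBoundedDissipative R) (hd : DenseRange R) (t : ℝ≥0)
    (x : E) : hR.expInverse hd t (R x) = R (hR.expInverse hd t x) := by
  refine tendsto_nhds_unique (hR.tendsto_expInverse hd t (R x)) ?_
  refine ((R.continuous.tendsto _).comp (hR.tendsto_expInverse hd t x)).congr' ?_
  filter_upwards [self_mem_nhdsWithin] with ε hε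
  exact (exp_smul_apply_comm (hR.commute_yosida_self hε) _ _).symm

theorem lipschitzWith_expInverse_apply (hR : IsBoundedDissipative R) (hd : DenseRange R) (z : E) :
    LipschitzWith (2 * ‖z‖₊) fun t => hR.expInverse hd t (R z) := by
  refine LipschitzWith.of_dist_le_mul fun t s => ?_
  rw [dist_eq_norm]
  refine le_of_tendsto
    ((hR.tendsto_expInverse hd t _).sub (hR.tendsto_expInverse hd s _)).norm ?_
  filter_upwards [self_mem_nhdsWithin] with ε hε
  refine ((hR.isBoundedDissipative_yosida hε).norm_exp_smul_sub_exp_smul_le s.2 t.2 _).trans ?_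
  exact mul_le_mul_of_nonneg_right (hR.norm_yosida_apply_le hε z) (abs_nonneg _)

theorem continuous_expInverse_apply (hR : IsBoundedDissipative R) (hd : DenseRange R) (x : E) :
    Continuous fun t => hR.expInverse hd t x := by
  refine continuous_iff_continuousAt.2 fun s => tendsto_sub_nhds_zero_iff.1 ?_
  refine tendsto_apply_zero_of_denseRange (M := 2)
    (T := fun t => hR.expInverse hd t - hR.expInverse hd s) ?_ hd (fun z => ?_) x
  · refine Eventually.of_forall fun t x => (norm_sub_le _ _).trans ?_
    rw [two_mul]
    exact add_le_add (hR.norm_expInverse_apply_le hd t x) (hR.norm_expInverse_apply_le hd s x)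
  · exact tendsto_sub_nhds_zero_iff.2
      ((hR.lipschitzWith_expInverse_apply hd z).continuous.tendsto s)

/-- The contraction semigroup `exp (t R⁻¹)`. -/
def semigroup (hR : IsBoundedDissipative R) (hd : DenseRange R) : ContractionSemigroup E where
  toFun := hR.expInverse hd
  map_zero := by
    ext x
    exact tendsto_nhds_unique (hR.tendsto_expInverse hd 0 x) (by simp)
  map_add s t := by
    ext x
    refine tendsto_nhds_unique (hR.tendsto_expInverse hd (s + t) x)
      ((hR.tendsto_exp_yosida_apply hd s (hR.tendsto_expInverse hd t x)).congr fun ε => ?_)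
    rw [NNReal.coe_add, exp_add_smul]
    rfl
  continuous_apply := hR.continuous_expInverse_apply hd
  norm_le_one t := ContinuousLinearMap.opNorm_le_bound _ zero_le_one fun x =>
    (hR.norm_expInverse_apply_le hd t x).trans_eq (one_mul _).symm

theorem exp_yosida_apply_sub (R : E →L[ℂ] E) (ε t : ℝ) (x : E) :
    NormedSpace.exp (t • yosida R ε) x - x
      = ∫ s in (0 : ℝ)..t, NormedSpace.exp (s • yosida R ε) (yosida R ε x) := by
  rw [intervalIntegral.integral_eq_sub_of_hasDerivAt
    (fun s _ => hasDerivAt_exp_smul_apply (yosida R ε) x s)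
    ((continuous_exp_smul_apply _ _).intervalIntegrable _ _)]
  simp

theorem semigroup_orbit_sub (hR : IsBoundedDissipative R) (hd : DenseRange R) (x : E) {t : ℝ}
    (ht : 0 ≤ t) : (hR.semigroup hd).orbit (R x) t - R x
      = ∫ s in (0 : ℝ)..t, (hR.semigroup hd).orbit x s := by
  have hlim : Tendsto (fun ε => NormedSpace.exp (t • yosida R ε) (R x) - R x) (𝓝[>] 0)
      (𝓝 ((hR.semigroup hd).orbit (R x) t - R x)) := by
    lift t to ℝ≥0 using ht
    rw [ContractionSemigroup.orbit_coe]
    exact (hR.tendsto_expInverse hd t (R x)).sub_const _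
  simp only [exp_yosida_apply_sub] at hlim
  refine tendsto_nhds_unique hlim ?_
  refine intervalIntegral.tendsto_integral_filter_of_dominated_convergence (fun _ => 2 * ‖x‖)
    (Eventually.of_forall fun ε => (continuous_exp_smul_apply _ _).aestronglyMeasurable) ?_
    intervalIntegrable_const (Eventually.of_forall fun s hs => ?_)
  · filter_upwards [self_mem_nhdsWithin] with ε hε
    refine Eventually.of_forall fun s hs => ?_
    rw [uIoc_of_le ht] at hs
    exact ((hR.isBoundedDissipative_yosida hε).norm_exp_smul_apply_le hs.1.le _).trans
      (hR.norm_yosida_apply_le hε x)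
  · rw [uIoc_of_le ht] at hs
    lift s to ℝ≥0 using hs.1.le
    rw [ContractionSemigroup.orbit_coe]
    exact hR.tendsto_exp_yosida_apply hd s (hR.tendsto_yosida_apply hd x)

theorem hasDerivWithinAt_semigroup_orbit (hR : IsBoundedDissipative R) (hd : DenseRange R)
    (x : E) : HasDerivWithinAt ((hR.semigroup hd).orbit (R x)) x (Ici 0) 0 := by
  have hint := ((((hR.semigroup hd).continuous_orbit x).integral_hasStrictDerivAt
    0 0).hasDerivAt.const_add (R x)).hasDerivWithinAt (s := Ici 0)
  rw [ContractionSemigroup.orbit_zero] at hint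
  refine hint.congr_of_mem (fun t ht => ?_) self_mem_Ici
  rw [← hR.semigroup_orbit_sub hd x ht, add_sub_cancel]

theorem isGenerator_semigroup (hR : IsBoundedDissipative R) (hd : DenseRange R)
    {T : E →ₗ.[ℂ] E} (hT : IsBoundedInverse R T) : IsGenerator T (hR.semigroup hd) := by
  intro x y
  rw [hT, ← ContractionSemigroup.hasDerivWithinAt_orbit_zero_iff]
  refine ⟨?_, fun h => ?_⟩
  · rintro rfl
    exact hR.hasDerivWithinAt_semigroup_orbit hd y
  · have hRx : HasDerivWithinAt ((hR.semigroup hd).orbit (R x)) (R y) (Ici 0) 0 :=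
      ((R.restrictScalars ℝ).hasFDerivAt.comp_hasDerivWithinAt 0 h).congr_of_mem
        (fun t _ => hR.expInverse_apply_comm hd _ x) self_mem_Ici
    exact (uniqueDiffWithinAt_Ici 0).eq_deriv _ hRx (hR.hasDerivWithinAt_semigroup_orbit hd x)

end IsBoundedDissipative

end Yosida

/-! ### Regularity of orbits in the domains of powers -/

section PowDomain

variable {E : Type*} [NormedAddCommGroup E] [NormedSpace ℂ E] {A T : E →ₗ.[ℂ] E}
  {S : ContractionSemigroup E} {x y : E} {j n : ℕ}

theorem mem_graph_pcomp :
    (x, y) ∈ (pcomp A T).graph ↔ ∃ z, (x, z) ∈ T.graph ∧ (z, y) ∈ A.graph := by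
  simp only [LinearPMap.mem_graph_iff]
  constructor
  · rintro ⟨⟨_, w, hw, rfl⟩, hx, hy⟩
    exact ⟨T w, ⟨w, hx, rfl⟩, ⟨T w, hw⟩, rfl, hy⟩
  · rintro ⟨_, ⟨w, hx, rfl⟩, ⟨v, hv⟩, rfl, hy⟩
    exact ⟨⟨w, w, hv, rfl⟩, hx, hy⟩

theorem mem_graph_ppow_zero : (x, y) ∈ (ppow T 0).graph ↔ x = y := by
  simp only [LinearPMap.mem_graph_iff]
  constructor
  · rintro ⟨z, rfl, rfl⟩
    rfl
  · rintro rfl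
    exact ⟨⟨x, Submodule.mem_top⟩, rfl, rfl⟩

theorem mem_graph_ppow_succ :
    (x, y) ∈ (ppow T (n + 1)).graph ↔ ∃ z, (x, z) ∈ T.graph ∧ (z, y) ∈ (ppow T n).graph :=
  mem_graph_pcomp

theorem mem_graph_ppow_succ' :
    (x, y) ∈ (ppow T (n + 1)).graph ↔ ∃ z, (x, z) ∈ (ppow T n).graph ∧ (z, y) ∈ T.graph := by
  induction n generalizing x with
  | zero => simp only [mem_graph_ppow_succ, mem_graph_ppow_zero, exists_eq_right, exists_eq_left']
  | succ n ih =>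
    rw [mem_graph_ppow_succ]
    simp only [ih, mem_graph_ppow_succ (n := n)]
    constructor
    · rintro ⟨a, ha, b, hab, hb⟩
      exact ⟨b, ⟨a, ha, hab⟩, hb⟩
    · rintro ⟨b, ⟨a, ha, hab⟩, hb⟩
      exact ⟨a, ha, b, hab, hb⟩

theorem ppow_one (T : E →ₗ.[ℂ] E) : ppow T 1 = T := by
  refine LinearPMap.eq_of_eq_graph (Submodule.ext fun ⟨x, y⟩ => ?_)
  simp only [mem_graph_ppow_succ, mem_graph_ppow_zero, exists_eq_right]

theorem mem_ppow_domain_succ (h : (x, y) ∈ T.graph) :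
    x ∈ (ppow T (n + 1)).domain ↔ y ∈ (ppow T n).domain := by
  simp only [LinearPMap.mem_domain_iff, mem_graph_ppow_succ]
  constructor
  · rintro ⟨w, z, hxz, hzw⟩
    obtain rfl := LinearPMap.mem_graph_snd_inj _ hxz h rfl
    exact ⟨w, hzw⟩
  · rintro ⟨w, hyw⟩
    exact ⟨w, y, h, hyw⟩

/-- Every `S(t)` maps the graph of `T` into itself: it leaves `D(T)` invariant and commutes with
`T` there. -/
def HasInvariantGraph (T : E →ₗ.[ℂ] E) (S : ContractionSemigroup E) : Prop :=
  ∀ (t : ℝ≥0) ⦃x y : E⦄, (x, y) ∈ T.graph → (S.toFun t x, S.toFun t y) ∈ T.graph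

theorem IsGenerator.hasInvariantGraph (hA : IsGenerator A S) : HasInvariantGraph A S :=
  fun t _ _ => hA.map_graph t

namespace HasInvariantGraph

theorem of_le (hA : HasInvariantGraph A S) (hTA : T ≤ A)
    (hdom : ∀ (t : ℝ≥0), ∀ x ∈ T.domain, S.toFun t x ∈ T.domain) : HasInvariantGraph T S := by
  intro t x y hxy
  obtain ⟨y', hy'⟩ := LinearPMap.mem_domain_iff.1
    (hdom t x (LinearPMap.mem_domain_of_mem_graph hxy))
  have hle := LinearPMap.le_graph_of_le hTA
  obtain rfl := LinearPMap.mem_graph_snd_inj _ (hA t (hle hxy)) (hle hy') rfl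
  exact hy'

theorem ppow (hT : HasInvariantGraph T S) (n : ℕ) : HasInvariantGraph (ppow T n) S := by
  induction n with
  | zero =>
    intro t x y h
    rw [mem_graph_ppow_zero] at h ⊢
    rw [h]
  | succ n ih =>
    intro t x y h
    rw [mem_graph_ppow_succ] at h ⊢
    obtain ⟨z, hxz, hzy⟩ := h
    exact ⟨_, hT t hxz, ih t hzy⟩

/-- The orbit of a point of `D(Tʲ)`, as a path in the normed space `PowDomain T j`. -/
def powOrbit (hT : HasInvariantGraph T S) (x : PowDomain T j) (t : ℝ) : PowDomain T j :=
  show ↥(Timoshenko.ppow T j).domain from ⟨S.orbit x.val t,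
    LinearPMap.mem_domain_of_mem_graph (hT.ppow j t.toNNReal (LinearPMap.mem_graph _ x))⟩

end HasInvariantGraph

theorem val_powGraph_mem_graph (x : PowDomain T j) (i : Fin (j + 1)) :
    (x.val, powGraph T j x i) ∈ (ppow T i).graph :=
  (ppow T i).mem_graph (Submodule.inclusion (ppow_domain_anti T (Nat.lt_succ_iff.1 i.2)) x)

theorem isInducing_powGraph (T : E →ₗ.[ℂ] E) (j : ℕ) : IsInducing (powGraph T j) :=
  (AddMonoidHomClass.isometry_of_norm (powGraph T j) fun _ => rfl).isUniformInducing.isInducing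

theorem hasDerivWithinAt_of_powGraph {f : ℝ → PowDomain T j} {f' : PowDomain T j} {s : Set ℝ}
    {t : ℝ} (h : HasDerivWithinAt (fun r => powGraph T j (f r)) (powGraph T j f') s t) :
    HasDerivWithinAt f f' s t := by
  rw [hasDerivWithinAt_iff_tendsto_slope] at h ⊢
  rw [(isInducing_powGraph T j).tendsto_nhds_iff]
  refine h.congr fun r => ?_
  simp only [slope_def_module, Function.comp_apply]
  rw [← map_sub, ← Complex.coe_smul, ← Complex.coe_smul, map_smul]

namespace HasInvariantGraph

theorem powGraph_powOrbit (hT : HasInvariantGraph T S) (x : PowDomain T j) (t : ℝ)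
    (i : Fin (j + 1)) (h : (x.val, y) ∈ (Timoshenko.ppow T i).graph) :
    powGraph T j (hT.powOrbit x t) i = S.orbit y t :=
  LinearPMap.mem_graph_snd_inj _ (val_powGraph_mem_graph (hT.powOrbit x t) i)
    (hT.ppow i t.toNNReal h) rfl

theorem continuous_powOrbit (hT : HasInvariantGraph T S) (x : PowDomain T j) :
    Continuous (hT.powOrbit x) := by
  refine (isInducing_powGraph T j).continuous_iff.2 (continuous_pi fun i => ?_)
  exact (S.continuous_orbit _).congr fun t =>
    (hT.powGraph_powOrbit x t i (val_powGraph_mem_graph x i)).symm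

theorem hasDerivWithinAt_powOrbit [CompleteSpace E] (hT : HasInvariantGraph T S)
    (hA : IsGenerator A S) (hTA : T ≤ A) {x y : PowDomain T j} (h : (x.val, y.val) ∈ T.graph)
    {t : ℝ} (ht : 0 ≤ t) :
    HasDerivWithinAt (hT.powOrbit x) (hT.powOrbit y t) (Ici 0) t := by
  refine hasDerivWithinAt_of_powGraph (hasDerivWithinAt_pi.2 fun i => ?_)
  have hy := val_powGraph_mem_graph y i
  obtain ⟨z, hxz, hzy⟩ := mem_graph_ppow_succ'.1 (mem_graph_ppow_succ.2 ⟨_, h, hy⟩)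
  simp only [hT.powGraph_powOrbit x _ i hxz, hT.powGraph_powOrbit y _ i hy]
  exact ContractionSemigroup.hasDerivWithinAt_orbit
    (hA.mem_graph_iff.1 (LinearPMap.le_graph_of_le hTA hzy)) ht

theorem contDiffOn_powOrbit [CompleteSpace E] (hT : HasInvariantGraph T S)
    (hA : IsGenerator A S) (hTA : T ≤ A) {m : ℕ} (x : PowDomain T j)
    (hx : x.val ∈ (Timoshenko.ppow T (j + m)).domain) :
    ContDiffOn ℝ m (hT.powOrbit x) (Ici 0) := by
  induction m generalizing x with
  | zero => exact contDiffOn_zero.2 (hT.continuous_powOrbit x).continuousOn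
  | succ m ih =>
    obtain ⟨y, hxy⟩ : ∃ y, (x.val, y) ∈ T.graph := by
      have hx₁ : x.val ∈ (Timoshenko.ppow T 1).domain := ppow_domain_anti T (by omega) hx
      rw [ppow_one] at hx₁
      exact LinearPMap.mem_domain_iff.1 hx₁
    have hy : y ∈ (Timoshenko.ppow T (j + m)).domain := (mem_ppow_domain_succ hxy).1 hx
    let y' : PowDomain T j :=
      show ↥(Timoshenko.ppow T j).domain from ⟨y, ppow_domain_anti T (Nat.le_add_right j m) hy⟩
    have hderiv (t : ℝ) (ht : t ∈ Ici 0) :=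
      hT.hasDerivWithinAt_powOrbit hA hTA (x := x) (y := y') hxy ht
    rw [Nat.cast_add_one, contDiffOn_succ_iff_derivWithin (uniqueDiffOn_Ici 0)]
    refine ⟨fun t ht => (hderiv t ht).differentiableWithinAt, fun h => by simp at h, ?_⟩
    exact (ih y' hy).congr fun t ht => (hderiv t ht).derivWithin (uniqueDiffOn_Ici 0 t ht)

theorem isCmInto_orbit [CompleteSpace E] (hT : HasInvariantGraph T S) (hA : IsGenerator A S)
    (hTA : T ≤ A) (hx : x ∈ (Timoshenko.ppow T n).domain) (hj : j ≤ n) :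
    IsCmInto T (n - j) j (S.orbit x) :=
  ⟨hT.powOrbit (show ↥(Timoshenko.ppow T j).domain from ⟨x, ppow_domain_anti T hj hx⟩),
    fun _ _ => rfl, hT.contDiffOn_powOrbit hA hTA _ (by rwa [Nat.add_sub_cancel' hj])⟩

end HasInvariantGraph

end PowDomain

/-! ### Completeness of the sines -/

section Sine

/-- The frequency `(n+1)π/L`, the square root of the `n`-th eigenvalue of `A`. -/
def freq (L : ℝ) (n : ℕ) : ℝ := (n + 1) * Real.pi / L

/-- The normalised sines `√(2/L) sin((n+1)πx/L)` on the whole line, of which `eigenfn` is the class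
in `L²(0, L)`. -/
def sinFn (L : ℝ) (n : ℕ) (x : ℝ) : ℝ := √(2 / L) * Real.sin (freq L n * x)

theorem eigenval_eq (L : ℝ) (n : ℕ) : eigenval L n = freq L n ^ 2 := rfl

theorem coeFn_eigenfn (L : ℝ) (n : ℕ) :
    eigenfn L n =ᵐ[volume.restrict (Ioo 0 L)] fun x => (sinFn L n x : ℂ) := by
  refine (memLp_sine L n).coeFn_toLp.trans (Eventually.of_forall fun x => ?_)
  simp only [sinFn, freq, div_mul_eq_mul_div]

variable {L : ℝ} {n m : ℕ}

theorem freq_pos (hL : 0 < L) (n : ℕ) : 0 < freq L n :=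
  div_pos (mul_pos (by positivity) Real.pi_pos) hL

theorem eigenval_pos (hL : 0 < L) (n : ℕ) : 0 < eigenval L n := pow_pos (freq_pos hL n) 2

theorem freq_mul_length (hL : 0 < L) (n : ℕ) : freq L n * L = ((n + 1 : ℕ) : ℝ) * Real.pi := by
  rw [freq, div_mul_cancel₀ _ hL.ne', Nat.cast_add_one]

theorem inner_eq_integral_of_real {f g : L2 L} {F G : ℝ → ℝ}
    (hf : f =ᵐ[volume.restrict (Ioo 0 L)] fun x => (F x : ℂ))
    (hg : g =ᵐ[volume.restrict (Ioo 0 L)] fun x => (G x : ℂ)) :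
    inner ℂ f g = ((∫ x in Ioo 0 L, F x * G x : ℝ) : ℂ) := by
  rw [L2.inner_def, ← integral_complex_ofReal]
  refine integral_congr_ae ?_
  filter_upwards [hf, hg] with x hx hx'
  rw [hx, hx', RCLike.inner_apply, Complex.conj_ofReal, Complex.ofReal_mul, mul_comm]

theorem integral_cos_mul_eq_zero {c : ℝ} (hc : c ≠ 0) (h : Real.sin (c * L) = 0) :
    ∫ x in (0 : ℝ)..L, Real.cos (c * x) = 0 := by
  rw [intervalIntegral.integral_comp_mul_left Real.cos hc, integral_cos, h, mul_zero,
    Real.sin_zero, sub_zero, smul_zero]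

theorem integral_cos_freq_add (hL : 0 < L) (n m : ℕ) :
    ∫ x in (0 : ℝ)..L, Real.cos ((freq L n + freq L m) * x) = 0 := by
  refine integral_cos_mul_eq_zero (add_pos (freq_pos hL n) (freq_pos hL m)).ne' ?_
  rw [add_mul, freq_mul_length hL, freq_mul_length hL, ← add_mul]
  exact_mod_cast Real.sin_nat_mul_pi (n + 1 + (m + 1))

theorem freq_injective (hL : 0 < L) : Function.Injective (freq L) := by
  intro n m h
  have h' : ((n + 1 : ℕ) : ℝ) = (m + 1 : ℕ) := by
    refine mul_right_cancel₀ Real.pi_ne_zero ?_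
    rw [← freq_mul_length hL, ← freq_mul_length hL, h]
  exact Nat.succ_injective (Nat.cast_injective h')

theorem integral_cos_freq_sub (hL : 0 < L) (h : n ≠ m) :
    ∫ x in (0 : ℝ)..L, Real.cos ((freq L n - freq L m) * x) = 0 := by
  refine integral_cos_mul_eq_zero (sub_ne_zero.2 ((freq_injective hL).ne h)) ?_
  rw [sub_mul, freq_mul_length hL, freq_mul_length hL, ← sub_mul]
  exact_mod_cast Real.sin_int_mul_pi (((n + 1 : ℕ) : ℤ) - ((m + 1 : ℕ) : ℤ))

theorem sinFn_mul_sinFn (hL : 0 < L) (n m : ℕ) (x : ℝ) :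
    sinFn L n x * sinFn L m x = L⁻¹ *
      (Real.cos ((freq L n - freq L m) * x) - Real.cos ((freq L n + freq L m) * x)) := by
  have hs : √(2 / L) * √(2 / L) = 2 / L := Real.mul_self_sqrt (by positivity)
  rw [sub_mul, add_mul, Real.cos_sub, Real.cos_add, sinFn, sinFn]
  linear_combination (Real.sin (freq L n * x) * Real.sin (freq L m * x)) * hs

theorem orthonormal_eigenfn (hL : 0 < L) : Orthonormal ℂ (eigenfn L) := by
  rw [orthonormal_iff_ite]
  intro n m
  rw [inner_eq_integral_of_real (coeFn_eigenfn L n) (coeFn_eigenfn L m),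
    ← integral_Ioc_eq_integral_Ioo, ← intervalIntegral.integral_of_le hL.le]
  simp only [sinFn_mul_sinFn hL]
  rw [intervalIntegral.integral_const_mul, intervalIntegral.integral_sub
    (Continuous.intervalIntegrable (by fun_prop) _ _)
    (Continuous.intervalIntegrable (by fun_prop) _ _), integral_cos_freq_add hL, sub_zero]
  split_ifs with h
  · subst h
    simp only [sub_self, zero_mul, Real.cos_zero, intervalIntegral.integral_const, sub_zero,
      smul_eq_mul, mul_one, inv_mul_cancel₀ hL.ne', Complex.ofReal_one]
  · rw [integral_cos_freq_sub hL h, mul_zero, Complex.ofReal_zero]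

theorem inner_eigenfn_eq (L : ℝ) (n : ℕ) (f : L2 L) :
    inner ℂ (eigenfn L n) f = ∫ x in Ioo 0 L, (sinFn L n x : ℂ) * f x := by
  rw [L2.inner_def]
  refine integral_congr_ae ?_
  filter_upwards [coeFn_eigenfn L n] with x hx
  rw [hx, RCLike.inner_apply, Complex.conj_ofReal, mul_comm]

end Sine

section Completeness

variable {E : Type*} [NormedAddCommGroup E] [NormedSpace ℝ E] {L : ℝ} {g : ℝ → E} {φ : ℝ → ℝ}

theorem integrableOn_continuous_smul (hφ : Continuous φ) (hg : IntegrableOn g (Ioo 0 L)) :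
    IntegrableOn (fun x => φ x • g x) (Ioo 0 L) :=
  hg.continuousOn_smul_of_subset hφ.continuousOn isCompact_Icc measurableSet_Ioo Ioo_subset_Icc_self

theorem integral_polynomial_cos_smul_eq_zero (hg : IntegrableOn g (Ioo 0 L))
    (h : ∀ k : ℕ, ∫ x in Ioo 0 L, Real.cos (Real.pi / L * x) ^ k • g x = 0)
    (p : Polynomial ℝ) : ∫ x in Ioo 0 L, p.eval (Real.cos (Real.pi / L * x)) • g x = 0 := by
  induction p using Polynomial.induction_on' with
  | add p q hp hq =>
    simp only [Polynomial.eval_add, add_smul]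
    rw [integral_add, hp, hq, add_zero]
    all_goals exact integrableOn_continuous_smul (by fun_prop) hg
  | monomial k a =>
    simp only [Polynomial.eval_monomial, mul_smul]
    rw [integral_smul, h, smul_zero]

-- `x ↦ cos (πx/L)` is a homeomorphism of `[0, L]` onto `[-1, 1]`, so the polynomials in it are
-- uniformly dense by Weierstrass.
theorem integral_continuous_smul_eq_zero (hg : IntegrableOn g (Ioo 0 L))
    (h : ∀ k : ℕ, ∫ x in Ioo 0 L, Real.cos (Real.pi / L * x) ^ k • g x = 0)
    (hφ : Continuous φ) : ∫ x in Ioo 0 L, φ x • g x = 0 := by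
  refine norm_le_zero_iff.1 (le_of_forall_pos_le_add fun ε hε => ?_)
  set C := ∫ x in Ioo 0 L, ‖g x‖
  have : 0 ≤ C := integral_nonneg fun x => norm_nonneg _
  obtain ⟨p, hp⟩ := exists_polynomial_near_of_continuousOn (-1) 1
    (fun u => φ (L / Real.pi * Real.arccos u)) (by fun_prop) (ε / (C + 1)) (by positivity)
  have hclose (x : ℝ) (hx : x ∈ Ioo 0 L) :
      |φ x - p.eval (Real.cos (Real.pi / L * x))| ≤ ε / (C + 1) := by
    have hL : 0 < L := hx.1.trans hx.2
    have harccos : Real.arccos (Real.cos (Real.pi / L * x)) = Real.pi / L * x := by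
      refine Real.arccos_cos (mul_nonneg (by positivity) hx.1.le) ?_
      rw [div_mul_eq_mul_div, div_le_iff₀ hL]
      exact mul_le_mul_of_nonneg_left hx.2.le Real.pi_pos.le
    have hcancel : L / Real.pi * (Real.pi / L * x) = x := by field_simp
    have hpx := hp _ ⟨Real.neg_one_le_cos (Real.pi / L * x), Real.cos_le_one _⟩
    rw [harccos, hcancel, abs_sub_comm] at hpx
    exact hpx.le
  calc ‖∫ x in Ioo 0 L, φ x • g x‖
      = ‖∫ x in Ioo 0 L, (φ x - p.eval (Real.cos (Real.pi / L * x))) • g x‖ := by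
        simp only [sub_smul]
        rw [integral_sub (integrableOn_continuous_smul hφ hg)
          (integrableOn_continuous_smul (by fun_prop) hg),
          integral_polynomial_cos_smul_eq_zero hg h, sub_zero]
    _ ≤ ∫ x in Ioo 0 L, ε / (C + 1) * ‖g x‖ := by
        refine norm_integral_le_of_norm_le (hg.norm.const_mul _)
          (ae_restrict_of_forall_mem measurableSet_Ioo fun x hx => ?_)
        rw [norm_smul]
        exact mul_le_mul_of_nonneg_right (hclose x hx) (norm_nonneg _)
    _ = ε / (C + 1) * C := integral_const_mul _ _
    _ ≤ 0 + ε := by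
        rw [zero_add, div_mul_eq_mul_div, div_le_iff₀ (by positivity)]
        nlinarith

theorem ae_eq_zero_of_integral_cos_pow_smul [CompleteSpace E] (hg : IntegrableOn g (Ioo 0 L))
    (h : ∀ k : ℕ, ∫ x in Ioo 0 L, Real.cos (Real.pi / L * x) ^ k • g x = 0) :
    ∀ᵐ x ∂volume.restrict (Ioo 0 L), g x = 0 := by
  refine (ae_restrict_iff' measurableSet_Ioo).2 <|
    isOpen_Ioo.ae_eq_zero_of_integral_contDiff_smul_eq_zero hg.locallyIntegrableOn
      fun φ hφ _ hsupp => ?_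
  rw [← setIntegral_eq_integral_of_forall_compl_eq_zero (s := Ioo 0 L) fun x hx => ?_]
  · exact integral_continuous_smul_eq_zero hg h hφ.continuous
  · rw [image_eq_zero_of_notMem_tsupport fun hx' => hx (hsupp hx'), zero_smul]

theorem cos_mul_sin_succ_mul (m : ℕ) (θ : ℝ) :
    Real.cos θ * Real.sin ((m + 1 : ℕ) * θ) =
      2⁻¹ * (Real.sin ((m + 2 : ℕ) * θ) + Real.sin (m * θ)) := by
  have hadd : ((m + 2 : ℕ) : ℝ) * θ = (m + 1 : ℕ) * θ + θ := by push_cast; ring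
  have hsub : (m : ℝ) * θ = (m + 1 : ℕ) * θ - θ := by push_cast; ring
  rw [hadd, hsub, Real.sin_add, Real.sin_sub]
  ring

theorem integral_cos_pow_smul_sin_smul_eq_zero (hg : IntegrableOn g (Ioo 0 L))
    (h : ∀ n : ℕ, ∫ x in Ioo 0 L, Real.sin (n * (Real.pi / L * x)) • g x = 0) (k n : ℕ) :
    ∫ x in Ioo 0 L, Real.cos (Real.pi / L * x) ^ k • Real.sin (n * (Real.pi / L * x)) • g x
      = 0 := by
  induction k generalizing n with
  | zero => simpa only [pow_zero, one_smul] using h n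
  | succ k ih =>
    cases n with
    | zero =>
      simp only [Nat.cast_zero, zero_mul, Real.sin_zero, zero_smul, smul_zero, integral_zero]
    | succ m =>
      simp only [smul_smul, pow_succ, mul_assoc, cos_mul_sin_succ_mul, mul_left_comm _ (2⁻¹ : ℝ),
        mul_add, add_smul] at ih ⊢
      rw [integral_add]
      · simp only [mul_smul, integral_smul] at ih ⊢
        rw [ih, ih, smul_zero, add_zero]
      all_goals exact integrableOn_continuous_smul (by fun_prop) hg

theorem ae_eq_zero_of_integral_sin_smul [CompleteSpace E] (hg : IntegrableOn g (Ioo 0 L))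
    (h : ∀ n : ℕ, ∫ x in Ioo 0 L, Real.sin (n * (Real.pi / L * x)) • g x = 0) :
    ∀ᵐ x ∂volume.restrict (Ioo 0 L), g x = 0 := by
  have hsin := ae_eq_zero_of_integral_cos_pow_smul
    (integrableOn_continuous_smul (by fun_prop) hg)
    fun k => integral_cos_pow_smul_sin_smul_eq_zero hg h k 1
  filter_upwards [hsin, ae_restrict_mem measurableSet_Ioo] with x hx hxL
  have hL : 0 < L := hxL.1.trans hxL.2
  refine (smul_eq_zero.1 hx).resolve_left (Real.sin_pos_of_pos_of_lt_pi ?_ ?_).ne'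
  · have := hxL.1
    positivity
  · rw [Nat.cast_one, one_mul, div_mul_eq_mul_div, div_lt_iff₀ hL]
    exact mul_lt_mul_of_pos_left hxL.2 Real.pi_pos

theorem eq_zero_of_inner_eigenfn (hL : 0 < L) {f : L2 L}
    (hf : ∀ n, inner ℂ (eigenfn L n) f = 0) : f = 0 := by
  have hfi : IntegrableOn f (Ioo 0 L) := (Lp.memLp f).integrable one_le_two
  refine (Lp.eq_zero_iff_ae_eq_zero).2 (ae_eq_zero_of_integral_sin_smul hfi fun n => ?_)
  cases n with
  | zero => simp only [Nat.cast_zero, zero_mul, Real.sin_zero, zero_smul, integral_zero]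
  | succ n =>
    have hsqrt : (√(2 / L) : ℂ) ≠ 0 := Complex.ofReal_ne_zero.2 (by positivity)
    refine (mul_eq_zero.1 ?_).resolve_left hsqrt
    rw [← integral_const_mul, ← hf n, inner_eigenfn_eq]
    refine integral_congr_ae (Eventually.of_forall fun x => ?_)
    simp only [sinFn, freq, Complex.real_smul, Complex.ofReal_mul, mul_assoc, mul_div_assoc,
      Nat.cast_add_one]

end Completeness

/-! ### Weak derivatives and `H¹₀` -/

section WeakDeriv

variable {L : ℝ} {f g h : L2 L} {φ : ℝ → ℂ} {q : L2 L × L2 L} {n : ℕ}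

theorem setIntegral_Ioo_mul_testFn {F : ℝ → ℂ} (hf : f =ᵐ[volume.restrict (Ioo 0 L)] F)
    (hφ : φ ∈ testFn L) : ∫ x in Ioo 0 L, f x * φ x = ∫ x, F x * φ x := by
  have hfφ : (fun x => f x * φ x) =ᵐ[volume.restrict (Ioo 0 L)] fun x => F x * φ x := by
    filter_upwards [hf] with x hx
    rw [hx]
  rw [integral_congr_ae hfφ]
  refine setIntegral_eq_integral_of_forall_compl_eq_zero fun x hx => ?_
  rw [image_eq_zero_of_notMem_tsupport (fun hx' => hx (hφ.2.2 hx')), mul_zero]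

theorem isWeakDeriv_of_hasDerivAt {F F' : ℝ → ℂ} (hF : ∀ x, HasDerivAt F (F' x) x)
    (hF' : Continuous F') (hf : f =ᵐ[volume.restrict (Ioo 0 L)] F)
    (hg : g =ᵐ[volume.restrict (Ioo 0 L)] F') : IsWeakDeriv L f g := by
  intro χ hχ
  have hFc : Continuous F := continuous_iff_continuousAt.2 fun x => (hF x).continuousAt
  have hint {a b : ℝ → ℂ} (ha : Continuous a) (hb : b ∈ testFn L) : Integrable (a * b) volume :=
    (ha.mul (testFn_cont hb)).integrable_of_hasCompactSupport hb.2.1.mul_left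
  rw [setIntegral_Ioo_mul_testFn hf (testFn_deriv hχ), setIntegral_Ioo_mul_testFn hg hχ]
  exact integral_mul_deriv_eq_deriv_mul_of_integrable (fun x _ => hF x)
    (fun x _ => (hχ.1.differentiable (by simp) x).hasDerivAt)
    (hint hFc (testFn_deriv hχ)) (hint hF' hχ) (hint hFc hχ)

theorem exists_testGraph (hφ : φ ∈ testFn L) :
    ∃ q ∈ testGraph L, q.1 =ᵐ[volume.restrict (Ioo 0 L)] φ ∧
      q.2 =ᵐ[volume.restrict (Ioo 0 L)] deriv φ := by
  have hq := (testFn_memLp hφ 2).coeFn_toLp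
  have hq' := (testFn_memLp (testFn_deriv hφ) 2).coeFn_toLp
  exact ⟨((testFn_memLp hφ 2).toLp _, (testFn_memLp (testFn_deriv hφ) 2).toLp _),
    ⟨φ, hφ, hq, hq'⟩, hq, hq'⟩

theorem exists_testGraph_snd (hq : q ∈ testGraph L) : ∃ r, (q.2, r) ∈ testGraph L := by
  obtain ⟨φ, hφ, -, hq'⟩ := hq
  have hr := (testFn_memLp (testFn_deriv (testFn_deriv hφ)) 2).coeFn_toLp
  exact ⟨_, deriv φ, testFn_deriv hφ, hq', hr⟩

theorem testFn_conj (hφ : φ ∈ testFn L) : (fun x => (starRingEnd ℂ) (φ x)) ∈ testFn L := by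
  refine ⟨Complex.conjCLE.contDiff.comp hφ.1,
    hφ.2.1.comp_left (g := fun z => (starRingEnd ℂ) z) (map_zero _), ?_⟩
  refine (closure_mono fun x hx => ?_).trans hφ.2.2
  rw [Function.mem_support] at hx ⊢
  exact fun hφx => hx (by simp only [hφx, map_zero])

theorem deriv_conj_testFn (hφ : φ ∈ testFn L) (x : ℝ) :
    deriv (fun x => (starRingEnd ℂ) (φ x)) x = (starRingEnd ℂ) (deriv φ x) :=
  (Complex.conjCLE.toContinuousLinearMap.hasFDerivAt.comp_hasDerivAt x
    (hφ.1.differentiable (by simp) x).hasDerivAt).deriv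

theorem inner_eq_integral_conj (hf : f =ᵐ[volume.restrict (Ioo 0 L)] φ) :
    inner ℂ f g = ∫ x in Ioo 0 L, g x * (starRingEnd ℂ) (φ x) := by
  rw [L2.inner_def]
  refine integral_congr_ae ?_
  filter_upwards [hf] with x hx
  rw [hx, RCLike.inner_apply]

theorem isWeakDeriv_iff_inner :
    IsWeakDeriv L f g ↔ ∀ q ∈ testGraph L, inner ℂ q.2 f = -inner ℂ q.1 g := by
  constructor
  · rintro h q ⟨φ, hφ, hq, hq'⟩
    rw [inner_eq_integral_conj hq, inner_eq_integral_conj hq', ← h _ (testFn_conj hφ)]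
    simp only [deriv_conj_testFn hφ]
  · intro h φ hφ
    obtain ⟨q, hqt, hq, hq'⟩ := exists_testGraph (testFn_conj hφ)
    have hqφ := h q hqt
    rw [inner_eq_integral_conj hq, inner_eq_integral_conj hq'] at hqφ
    simpa only [deriv_conj_testFn hφ, Complex.conj_conj] using hqφ

theorem inner_H10graph (hq : q ∈ H10graph L) (hg : IsWeakDeriv L g h) :
    inner ℂ q.2 g = -inner ℂ q.1 h := by
  have hclosed : IsClosed {q : L2 L × L2 L | inner ℂ q.2 g = -inner ℂ q.1 h} :=
    isClosed_eq (continuous_snd.inner continuous_const) (continuous_fst.inner continuous_const).neg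
  exact closure_minimal (fun q hq => isWeakDeriv_iff_inner.1 hg q hq) hclosed hq

theorem inner_grad (u : H10 L) (hg : IsWeakDeriv L g h) :
    inner ℂ (grad L u) g = -inner ℂ (u : L2 L) h :=
  inner_H10graph (grad_mem u) hg

theorem isWeakDeriv_grad (u : H10 L) : IsWeakDeriv L u (grad L u) :=
  H10graph_isWeakDeriv (grad_mem u)

theorem exists_grad_eq (hq : q ∈ H10graph L) : ∃ hu : q.1 ∈ H10 L, grad L ⟨q.1, hu⟩ = q.2 :=
  ⟨⟨q, hq, rfl⟩, dx_eq _ (H10graph_isWeakDeriv hq)⟩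

theorem isWeakDeriv_of_inner_grad
    (hgrad : ∀ u : H10 L, inner ℂ (grad L u) g = -inner ℂ (u : L2 L) h) : IsWeakDeriv L g h := by
  refine isWeakDeriv_iff_inner.2 fun q hq => ?_
  obtain ⟨hu, hq'⟩ := exists_grad_eq ((testGraph L).le_topologicalClosure hq)
  rw [← hq']
  exact hgrad ⟨q.1, hu⟩

end WeakDeriv

section VanishingTrace

theorem tendsto_Lp_of_ae_bounded {α E : Type*} [MeasurableSpace α] {μ : Measure α}
    [IsFiniteMeasure μ] [NormedAddCommGroup E] {p : ℝ≥0∞} [Fact (1 ≤ p)] (hp : p ≠ ⊤)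
    {f : ℕ → Lp E p μ} {g : Lp E p μ} {C : ℝ} (hb : ∀ n, ∀ᵐ x ∂μ, ‖f n x‖ ≤ C)
    (hl : ∀ᵐ x ∂μ, Tendsto (fun n => f n x) atTop (𝓝 (g x))) : Tendsto f atTop (𝓝 g) := by
  refine (Lp.tendsto_Lp_iff_tendsto_eLpNorm' _ _).2 <|
    tendsto_Lp_finite_of_tendsto_ae Fact.out hp (fun n => Lp.aestronglyMeasurable (f n))
      (Lp.memLp g) (unifIntegrable_of Fact.out hp (fun n => Lp.aestronglyMeasurable (f n))
        fun ε _ => ⟨(C + 1).toNNReal, fun n => ?_⟩) hl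
  rw [eLpNorm_congr_ae (g := 0), eLpNorm_zero]
  · exact zero_le
  · filter_upwards [hb n] with x hx
    refine indicator_of_notMem (fun hx' => ?_) _
    have hx'' : C + 1 ≤ ‖f n x‖ := (Real.le_coe_toNNReal _).trans hx'
    linarith

theorem exists_norm_le_mul_of_contDiff {E : Type*} [NormedAddCommGroup E] [NormedSpace ℝ E]
    {F : ℝ → E} {L : ℝ} (hF : ContDiff ℝ 1 F) (h0 : F 0 = 0) (hL : F L = 0) :
    ∃ C, 0 ≤ C ∧ ∀ x ∈ Ioo 0 L, ‖F x‖ ≤ C * (x * (L - x)) := by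
  obtain ⟨B, hB⟩ := isCompact_Icc.exists_bound_of_continuousOn
    (s := Icc 0 L) (hF.continuous_deriv le_rfl).continuousOn
  refine ⟨|2 * B / L|, abs_nonneg _, fun x hx => ?_⟩
  have hLpos : 0 < L := hx.1.trans hx.2
  have hmean {a : ℝ} (ha : a ∈ Icc 0 L) (hFa : F a = 0) : ‖F x‖ ≤ B * |x - a| := by
    have := (convex_Icc 0 L).norm_image_sub_le_of_norm_deriv_le
      (fun y _ => hF.differentiable one_ne_zero y) hB ha (Ioo_subset_Icc_self hx)
    rwa [hFa, sub_zero] at this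
  have hx0 := hmean ⟨le_rfl, hLpos.le⟩ h0
  have hxL := hmean ⟨hLpos.le, le_rfl⟩ hL
  rw [sub_zero, abs_of_pos hx.1] at hx0
  rw [abs_sub_comm, abs_of_pos (sub_pos.2 hx.2)] at hxL
  calc ‖F x‖ = ((L - x) * ‖F x‖ + x * ‖F x‖) / L := by field_simp; ring
    _ ≤ ((L - x) * (B * x) + x * (B * (L - x))) / L := by
        gcongr
        · exact (sub_pos.2 hx.2).le
        · exact hx.1.le
    _ = 2 * B / L * (x * (L - x)) := by ring
    _ ≤ |2 * B / L| * (x * (L - x)) :=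
        mul_le_mul_of_nonneg_right (le_abs_self _) (mul_pos hx.1 (sub_pos.2 hx.2)).le

/-- A smooth step from `0` on `(-∞, 1]` to `1` on `[2, ∞)`. -/
def step (y : ℝ) : ℝ := Real.smoothTransition (y - 1)

theorem contDiff_step : ContDiff ℝ ∞ step :=
  Real.smoothTransition.contDiff.comp (contDiff_id.sub contDiff_const)

theorem step_eq_zero {y : ℝ} (hy : y ≤ 1) : step y = 0 :=
  Real.smoothTransition.zero_of_nonpos (by linarith)

theorem step_eq_one {y : ℝ} (hy : 2 ≤ y) : step y = 1 :=
  Real.smoothTransition.one_of_one_le (by linarith)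

theorem abs_step_le_one (y : ℝ) : |step y| ≤ 1 := by
  rw [step, abs_of_nonneg (Real.smoothTransition.nonneg _)]
  exact Real.smoothTransition.le_one _

theorem deriv_step_eq_zero_of_lt {y : ℝ} (hy : y < 1) : deriv step y = 0 :=
  ((hasDerivAt_const y (0 : ℝ)).congr_of_eventuallyEq <| by
    filter_upwards [Iio_mem_nhds hy] with z hz using step_eq_zero hz.le).deriv

theorem deriv_step_eq_zero_of_gt {y : ℝ} (hy : 2 < y) : deriv step y = 0 :=
  ((hasDerivAt_const y (1 : ℝ)).congr_of_eventuallyEq <| by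
    filter_upwards [Ioi_mem_nhds hy] with z hz using step_eq_one hz.le).deriv

theorem exists_abs_mul_deriv_step_le : ∃ M : ℝ, ∀ y, |y * deriv step y| ≤ M := by
  have hcont : Continuous fun y => y * deriv step y :=
    continuous_id.mul (contDiff_step.continuous_deriv (by simp))
  have hsupp : HasCompactSupport fun y => y * deriv step y := by
    refine HasCompactSupport.intro (isCompact_Icc (a := (1 : ℝ)) (b := 2)) fun y hy => ?_
    rw [mem_Icc, not_and_or, not_le, not_le] at hy
    rcases hy with hy | hy
    · rw [deriv_step_eq_zero_of_lt hy, mul_zero]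
    · rw [deriv_step_eq_zero_of_gt hy, mul_zero]
  exact hsupp.exists_bound_of_continuous hcont

/-- The product of `F` with a cutoff which vanishes near the end points of `(0, L)` and tends to `1`
inside as `k → ∞`. -/
def cutoff (L : ℝ) (F : ℝ → ℂ) (k : ℕ) (x : ℝ) : ℂ := (step (k * (x * (L - x))) : ℂ) * F x

variable {L : ℝ} {F : ℝ → ℂ} {x : ℝ}

theorem cutoff_mem_testFn (hL : 0 < L) (hF : ContDiff ℝ ∞ F) (k : ℕ) :
    cutoff L F k ∈ testFn L := by
  have hclosed : IsClosed {x : ℝ | 1 ≤ k * (x * (L - x))} :=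
    isClosed_le continuous_const (by fun_prop)
  have hIoo : {x : ℝ | 1 ≤ k * (x * (L - x))} ⊆ Ioo 0 L := by
    intro x hx
    have hpos : 0 < x * (L - x) := pos_of_mul_pos_right (zero_lt_one.trans_le hx) k.cast_nonneg
    constructor <;> nlinarith
  have hsupp : tsupport (cutoff L F k) ⊆ {x : ℝ | 1 ≤ k * (x * (L - x))} := by
    refine closure_minimal (fun x hx => ?_) hclosed
    by_contra hx'
    exact hx (by rw [cutoff, step_eq_zero (not_le.1 hx').le, Complex.ofReal_zero, zero_mul])
  have hsupp_Ioo := hsupp.trans hIoo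
  refine ⟨?_, HasCompactSupport.of_support_subset_isCompact isCompact_Icc
    ((subset_tsupport _).trans (hsupp_Ioo.trans Ioo_subset_Icc_self)), hsupp_Ioo⟩
  refine (Complex.ofRealCLM.contDiff.comp (contDiff_step.comp ?_)).mul hF
  fun_prop

theorem deriv_cutoff (hF : Differentiable ℝ F) (k : ℕ) (x : ℝ) :
    deriv (cutoff L F k) x =
      ((deriv step (k * (x * (L - x))) * (k * (L - 2 * x)) : ℝ) : ℂ) * F x +
        (step (k * (x * (L - x))) : ℂ) * deriv F x := by
  have hpoly : HasDerivAt (fun x : ℝ => k * (x * (L - x))) (k * (L - 2 * x)) x := by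
    refine (((hasDerivAt_id x).mul
      ((hasDerivAt_id x).const_sub L)).const_mul (k : ℝ)).congr_deriv ?_
    simp only [id_eq]
    ring
  have hstep := (contDiff_step.differentiable (by simp) (k * (x * (L - x)))).hasDerivAt
  exact ((hstep.comp x hpoly).ofReal_comp.mul (hF x).hasDerivAt).deriv

theorem norm_cutoff_le (k : ℕ) (x : ℝ) : ‖cutoff L F k x‖ ≤ ‖F x‖ := by
  rw [cutoff, norm_mul, Complex.norm_real]
  exact mul_le_of_le_one_left (norm_nonneg _) (abs_step_le_one _)

-- Where the cutoff varies, its derivative is of size `1 / (x(L - x))`, which the vanishing of `F`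
-- at the end points compensates.
theorem exists_norm_deriv_cutoff_le (hF : ContDiff ℝ 1 F) (h0 : F 0 = 0) (hL : F L = 0) :
    ∃ D, ∀ k : ℕ, ∀ x ∈ Ioo 0 L, ‖deriv (cutoff L F k) x‖ ≤ D := by
  obtain ⟨C, hC0, hC⟩ := exists_norm_le_mul_of_contDiff hF h0 hL
  obtain ⟨M, hM⟩ := exists_abs_mul_deriv_step_le
  obtain ⟨B, hB⟩ := isCompact_Icc.exists_bound_of_continuousOn
    (s := Icc 0 L) (hF.continuous_deriv le_rfl).continuousOn
  refine ⟨L * (C * M) + B, fun k x hx => ?_⟩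
  have hLpos : 0 < L := hx.1.trans hx.2
  have hpos : 0 < x * (L - x) := mul_pos hx.1 (sub_pos.2 hx.2)
  have hslope : |L - 2 * x| ≤ L := abs_le.2 ⟨by linarith [hx.2], by linarith [hx.1]⟩
  rw [deriv_cutoff (hF.differentiable one_ne_zero)]
  refine (norm_add_le _ _).trans (add_le_add ?_ ?_)
  · rw [norm_mul, Complex.norm_real, Real.norm_eq_abs, abs_mul, abs_mul, Nat.abs_cast]
    calc |deriv step (k * (x * (L - x)))| * (k * |L - 2 * x|) * ‖F x‖
        ≤ |deriv step (k * (x * (L - x)))| * (k * L) * (C * (x * (L - x))) := by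
          gcongr
          exact hC x hx
      _ = L * (C * |k * (x * (L - x)) * deriv step (k * (x * (L - x)))|) := by
          rw [abs_mul, abs_mul, Nat.abs_cast, abs_of_pos hpos]
          ring
      _ ≤ L * (C * M) := by
          gcongr
          exact hM _
  · rw [norm_mul, Complex.norm_real]
    exact (mul_le_of_le_one_left (norm_nonneg _) (abs_step_le_one _)).trans
      (hB x (Ioo_subset_Icc_self hx))

theorem eventually_cutoff_eq (hF : Differentiable ℝ F) (hx : x ∈ Ioo 0 L) :
    ∀ᶠ k in atTop, cutoff L F k x = F x ∧ deriv (cutoff L F k) x = deriv F x := by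
  have hpos : 0 < x * (L - x) := mul_pos hx.1 (sub_pos.2 hx.2)
  filter_upwards [(tendsto_natCast_atTop_atTop.atTop_mul_const hpos).eventually_gt_atTop 2]
    with k hk
  rw [deriv_cutoff hF, cutoff, step_eq_one hk.le, deriv_step_eq_zero_of_gt hk]
  simp only [Complex.ofReal_one, one_mul, zero_mul, Complex.ofReal_zero, zero_add, and_self]

theorem mem_H10graph_of_contDiff (hL : 0 < L) (hF : ContDiff ℝ ∞ F) (hF0 : F 0 = 0)
    (hFL : F L = 0) {f g : L2 L} (hf : f =ᵐ[volume.restrict (Ioo 0 L)] F)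
    (hg : g =ᵐ[volume.restrict (Ioo 0 L)] deriv F) : (f, g) ∈ H10graph L := by
  have hF1 : ContDiff ℝ 1 F := hF.of_le (by simp)
  have hFd : Differentiable ℝ F := hF1.differentiable one_ne_zero
  have hIoo := ae_restrict_mem (μ := volume) (measurableSet_Ioo (a := (0 : ℝ)) (b := L))
  choose q hqt hq hq' using fun k => exists_testGraph (cutoff_mem_testFn hL hF k)
  have hfst : Tendsto (fun k => (q k).1) atTop (𝓝 f) := by
    obtain ⟨B, hB⟩ := isCompact_Icc.exists_bound_of_continuousOn
      (s := Icc 0 L) hF.continuous.continuousOn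
    refine tendsto_Lp_of_ae_bounded ENNReal.ofNat_ne_top (C := B) (fun k => ?_) ?_
    · filter_upwards [hq k, hIoo] with x hx hxL
      rw [hx]
      exact (norm_cutoff_le k x).trans (hB x (Ioo_subset_Icc_self hxL))
    · filter_upwards [ae_all_iff.2 hq, hf, hIoo] with x hx hfx hxL
      refine tendsto_const_nhds.congr' ((eventually_cutoff_eq hFd hxL).mono fun k hk => ?_)
      exact hfx.trans (hk.1.symm.trans (hx k).symm)
  have hsnd : Tendsto (fun k => (q k).2) atTop (𝓝 g) := by
    obtain ⟨D, hD⟩ := exists_norm_deriv_cutoff_le hF1 hF0 hFL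
    refine tendsto_Lp_of_ae_bounded ENNReal.ofNat_ne_top (C := D) (fun k => ?_) ?_
    · filter_upwards [hq' k, hIoo] with x hx hxL
      rw [hx]
      exact hD k x hxL
    · filter_upwards [ae_all_iff.2 hq', hg, hIoo] with x hx hgx hxL
      refine tendsto_const_nhds.congr' ((eventually_cutoff_eq hFd hxL).mono fun k hk => ?_)
      exact hgx.trans (hk.2.symm.trans (hx k).symm)
  exact (testGraph L).isClosed_topologicalClosure.mem_of_tendsto (hfst.prodMk_nhds hsnd)
    (Eventually.of_forall fun k => (testGraph L).le_topologicalClosure (hqt k))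

end VanishingTrace

section Cosine

/-- The normalised cosines `√(2/L) cos((n+1)πx/L)` on the whole line. -/
def cosFn (L : ℝ) (n : ℕ) (x : ℝ) : ℝ := √(2 / L) * Real.cos (freq L n * x)

theorem memLp_cosine (L : ℝ) (n : ℕ) :
    MemLp (fun x => (cosFn L n x : ℂ)) 2 (volume.restrict (Ioo 0 L)) := by
  refine MemLp.of_bound (Continuous.aestronglyMeasurable (by unfold cosFn; fun_prop)) (√(2 / L))
    (Eventually.of_forall fun x => ?_)
  rw [Complex.norm_real, Real.norm_eq_abs, cosFn, abs_mul, abs_of_nonneg (Real.sqrt_nonneg _)]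
  exact mul_le_of_le_one_right (Real.sqrt_nonneg _) (Real.abs_cos_le_one _)

/-- The normalised cosines as elements of `L²(0, L)`; they are the normalised derivatives of the
`eigenfn L n`. -/
def cosine (L : ℝ) (n : ℕ) : L2 L := (memLp_cosine L n).toLp _

variable {L : ℝ} {n : ℕ}

theorem coeFn_cosine (L : ℝ) (n : ℕ) :
    cosine L n =ᵐ[volume.restrict (Ioo 0 L)] fun x => (cosFn L n x : ℂ) :=
  (memLp_cosine L n).coeFn_toLp

theorem hasDerivAt_sinFn (L : ℝ) (n : ℕ) (x : ℝ) :
    HasDerivAt (sinFn L n) (freq L n * cosFn L n x) x := by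
  refine ((((hasDerivAt_id x).const_mul (freq L n)).sin).const_mul (√(2 / L))).congr_deriv ?_
  simp only [cosFn, id]
  ring

theorem hasDerivAt_cosFn (L : ℝ) (n : ℕ) (x : ℝ) :
    HasDerivAt (cosFn L n) (-(freq L n * sinFn L n x)) x := by
  refine ((((hasDerivAt_id x).const_mul (freq L n)).cos).const_mul (√(2 / L))).congr_deriv ?_
  simp only [sinFn, id]
  ring

theorem isWeakDeriv_cosine (L : ℝ) (n : ℕ) :
    IsWeakDeriv L (cosine L n) (-((freq L n : ℂ) • eigenfn L n)) := by
  refine isWeakDeriv_of_hasDerivAt (fun x => (hasDerivAt_cosFn L n x).ofReal_comp)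
    (by unfold sinFn; fun_prop) (coeFn_cosine L n) ?_
  filter_upwards [Lp.coeFn_neg ((freq L n : ℂ) • eigenfn L n),
    Lp.coeFn_smul (freq L n : ℂ) (eigenfn L n), coeFn_eigenfn L n] with x hneg hsmul hx
  rw [hneg, Pi.neg_apply, hsmul, Pi.smul_apply, hx, Complex.ofReal_neg, Complex.ofReal_mul,
    smul_eq_mul]

theorem eigenfn_mem_H10graph (hL : 0 < L) (n : ℕ) :
    (eigenfn L n, (freq L n : ℂ) • cosine L n) ∈ H10graph L := by
  refine mem_H10graph_of_contDiff hL (F := fun x => (sinFn L n x : ℂ)) ?_ ?_ ?_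
    (coeFn_eigenfn L n) ?_
  · exact Complex.ofRealCLM.contDiff.comp
      (contDiff_const.mul (Real.contDiff_sin.comp (contDiff_const.mul contDiff_id)))
  · rw [sinFn, mul_zero, Real.sin_zero, mul_zero, Complex.ofReal_zero]
  · rw [sinFn, freq_mul_length hL, Real.sin_nat_mul_pi, mul_zero, Complex.ofReal_zero]
  · filter_upwards [Lp.coeFn_smul (freq L n : ℂ) (cosine L n), coeFn_cosine L n] with x hsmul hx
    rw [hsmul, Pi.smul_apply, hx, (hasDerivAt_sinFn L n x).ofReal_comp.deriv, Complex.ofReal_mul,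
      smul_eq_mul]

-- Integrating by parts, `⟨eₙ', cₘ⟩ = -⟨eₙ, cₘ'⟩` is a multiple of `⟨eₙ, eₘ⟩`.
theorem orthonormal_cosine (hL : 0 < L) : Orthonormal ℂ (cosine L) := by
  rw [orthonormal_iff_ite]
  intro n m
  have hparts := inner_H10graph (eigenfn_mem_H10graph hL n) (isWeakDeriv_cosine L m)
  rw [inner_neg_right, neg_neg, inner_smul_left, inner_smul_right, Complex.conj_ofReal,
    orthonormal_iff_ite.1 (orthonormal_eigenfn hL) n m] at hparts
  have hfreq : (freq L n : ℂ) ≠ 0 := Complex.ofReal_ne_zero.2 (freq_pos hL n).ne'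
  refine mul_left_cancel₀ hfreq (hparts.trans ?_)
  split_ifs with h
  · rw [h]
  · rw [mul_zero, mul_zero]

end Cosine

/-! ### The Dirichlet Laplacian and its fractional powers -/

section PartialMaps

variable {R E F : Type*} [Ring R] [AddCommGroup E] [Module R E] [AddCommGroup F] [Module R F]
  {T : E →ₗ.[R] F} {x : E} {y : F}

theorem mem_graph_neg : (x, y) ∈ (-T).graph ↔ (x, -y) ∈ T.graph := by
  simp only [LinearPMap.mem_graph_iff]
  constructor
  · rintro ⟨z, rfl, rfl⟩
    exact ⟨z, rfl, (neg_neg _).symm⟩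
  · rintro ⟨z, rfl, hz⟩
    exact ⟨z, rfl, neg_eq_iff_eq_neg.2 hz⟩

theorem mem_graph_domRestrict {S : Submodule R E} :
    (x, y) ∈ (T.domRestrict S).graph ↔ x ∈ S ∧ (x, y) ∈ T.graph := by
  constructor
  · intro h
    exact ⟨(LinearPMap.mem_domain_of_mem_graph h).1,
      LinearPMap.le_graph_of_le LinearPMap.domRestrict_le h⟩
  · rintro ⟨hx, h⟩
    obtain ⟨z, rfl, rfl⟩ := (LinearPMap.mem_graph_iff _).1 h
    exact (LinearPMap.mem_graph_iff _).2 ⟨⟨z, hx, z.2⟩, rfl, LinearPMap.domRestrict_apply rfl⟩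

end PartialMaps

section OrthonormalSeries

variable {ι E : Type*} [NormedAddCommGroup E] [InnerProductSpace ℂ E] {e : ι → E} {a : ι → ℂ}

theorem summable_smul_iff_of_orthonormal [CompleteSpace E] (he : Orthonormal ℂ e) :
    Summable (fun i => a i • e i) ↔ Summable fun i => ‖a i‖ ^ 2 :=
  he.orthogonalFamily.summable_iff_norm_sq_summable (f := a)

theorem inner_tsum_smul_of_orthonormal (he : Orthonormal ℂ e) (ha : Summable fun i => a i • e i)
    (i : ι) : inner ℂ (e i) (∑' j, a j • e j) = a i := by
  classical
  have hterm (j : ι) : innerSL ℂ (e i) (a j • e j) = if j = i then a i else 0 := by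
    rw [innerSL_apply_apply, inner_smul_right, orthonormal_iff_ite.1 he]
    obtain rfl | hji := eq_or_ne j i
    · rw [if_pos rfl, if_pos rfl, mul_one]
    · rw [if_neg hji.symm, if_neg hji, mul_zero]
  have hsum := ha.hasSum.mapL (innerSL ℂ (e i))
  simp only [hterm] at hsum
  exact hsum.unique (hasSum_ite_eq i (a i))

end OrthonormalSeries

section Laplacian

variable {L : ℝ} {u f g : L2 L}

theorem mem_graph_dx : (f, g) ∈ (dx L).graph ↔ IsWeakDeriv L f g := by
  rw [LinearPMap.mem_graph_iff]
  constructor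
  · rintro ⟨z, rfl, rfl⟩
    exact dx_spec z
  · intro h
    exact ⟨⟨f, g, h⟩, rfl, dx_eq _ h⟩

theorem mem_graph_lapA :
    (u, f) ∈ (lapA L).graph ↔ ∃ hu : u ∈ H10 L, IsWeakDeriv L (grad L ⟨u, hu⟩) (-f) := by
  rw [lapA, mem_graph_neg, mem_graph_domRestrict, mem_graph_ppow_succ (n := 1), ppow_one]
  simp only [mem_graph_dx]
  constructor
  · rintro ⟨hu, g, hug, hgf⟩
    rw [← (isWeakDeriv_grad ⟨u, hu⟩).unique hug] at hgf
    exact ⟨hu, hgf⟩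
  · rintro ⟨hu, hf⟩
    exact ⟨hu, _, isWeakDeriv_grad ⟨u, hu⟩, hf⟩

theorem mem_H10_of_mem_lapA (hu : u ∈ (lapA L).domain) : u ∈ H10 L :=
  (mem_graph_lapA.1 ((lapA L).mem_graph ⟨u, hu⟩)).1

theorem isWeakDeriv_grad_lapA (u : H10 L) (hu : (u : L2 L) ∈ (lapA L).domain) :
    IsWeakDeriv L (grad L u) (-lapA L ⟨u, hu⟩) :=
  (mem_graph_lapA.1 ((lapA L).mem_graph ⟨u, hu⟩)).2

theorem mem_graph_lapA_of_isWeakDeriv {u : H10 L} (h : IsWeakDeriv L (grad L u) g) :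
    ((u : L2 L), -g) ∈ (lapA L).graph :=
  mem_graph_lapA.2 ⟨u.2, by rwa [neg_neg]⟩

theorem mem_lapA_of_isWeakDeriv {u : H10 L} (h : IsWeakDeriv L (grad L u) g) :
    (u : L2 L) ∈ (lapA L).domain :=
  LinearPMap.mem_domain_of_mem_graph (mem_graph_lapA_of_isWeakDeriv h)

theorem lapA_eq {u : H10 L} (hu : (u : L2 L) ∈ (lapA L).domain)
    (hg : IsWeakDeriv L (grad L u) g) : lapA L ⟨u, hu⟩ = -g := by
  rw [← (isWeakDeriv_grad_lapA u hu).unique hg, neg_neg]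

theorem testGraph_mem_lapA {q : L2 L × L2 L} (hq : q ∈ testGraph L) :
    q.1 ∈ (lapA L).domain := by
  obtain ⟨r, hr⟩ := exists_testGraph_snd hq
  obtain ⟨hq1, hgrad⟩ := exists_grad_eq ((testGraph L).le_topologicalClosure hq)
  refine mem_lapA_of_isWeakDeriv (u := ⟨q.1, hq1⟩) (g := r) ?_
  rw [hgrad]
  exact testGraph_isWeakDeriv hr

end Laplacian

section Eigenfunctions

variable {L : ℝ} {f g f' g' : L2 L}

theorem inner_eigenfn_of_isWeakDeriv (hL : 0 < L) (n : ℕ) (h : IsWeakDeriv L f g) :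
    inner ℂ (eigenfn L n) g = -((freq L n : ℂ) * inner ℂ (cosine L n) f) := by
  have hparts := inner_H10graph (eigenfn_mem_H10graph hL n) h
  rw [inner_smul_left, Complex.conj_ofReal] at hparts
  rw [hparts, neg_neg]

theorem freq_mul_inner_eigenfn (n : ℕ) (u : H10 L) :
    (freq L n : ℂ) * inner ℂ (eigenfn L n) (u : L2 L) = inner ℂ (cosine L n) (grad L u) := by
  have hparts := inner_grad u (isWeakDeriv_cosine L n)
  rw [inner_neg_right, neg_neg, inner_smul_right] at hparts
  rw [← inner_conj_symm (cosine L n), hparts, map_mul, Complex.conj_ofReal, inner_conj_symm]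

theorem freq_mul_norm_inner (hL : 0 < L) (n : ℕ) (u : H10 L) :
    freq L n * ‖inner ℂ (eigenfn L n) (u : L2 L)‖ = ‖inner ℂ (cosine L n) (grad L u)‖ := by
  rw [← freq_mul_inner_eigenfn, norm_mul, Complex.norm_real,
    Real.norm_of_nonneg (freq_pos hL n).le]

theorem inner_eigenfn_of_isWeakDeriv_grad (hL : 0 < L) (n : ℕ) {u : H10 L}
    (h : IsWeakDeriv L (grad L u) g) :
    inner ℂ (eigenfn L n) g = -((eigenval L n : ℂ) * inner ℂ (eigenfn L n) (u : L2 L)) := by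
  rw [inner_eigenfn_of_isWeakDeriv hL n h, ← freq_mul_inner_eigenfn, eigenval_eq, ← mul_assoc,
    ← sq, Complex.ofReal_pow]

theorem inner_eigenfn_lapA (hL : 0 < L) (n : ℕ) {u : L2 L} (hu : u ∈ (lapA L).domain) :
    inner ℂ (eigenfn L n) (lapA L ⟨u, hu⟩) = (eigenval L n : ℂ) * inner ℂ (eigenfn L n) u := by
  rw [← neg_inj, ← inner_neg_right]
  exact inner_eigenfn_of_isWeakDeriv_grad hL n
    (isWeakDeriv_grad_lapA ⟨u, mem_H10_of_mem_lapA hu⟩ hu)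

theorem summable_freq_mul_inner (hL : 0 < L) (u : H10 L) :
    Summable fun n => (freq L n * ‖inner ℂ (eigenfn L n) (u : L2 L)‖) ^ 2 := by
  simp only [freq_mul_norm_inner hL]
  exact (orthonormal_cosine hL).inner_products_summable (grad L u)

theorem summable_eigenval_mul_inner (hL : 0 < L) {u : L2 L} (hu : u ∈ (lapA L).domain) :
    Summable fun n => (eigenval L n * ‖inner ℂ (eigenfn L n) u‖) ^ 2 := by
  refine ((orthonormal_eigenfn hL).inner_products_summable (lapA L ⟨u, hu⟩)).congr fun n => ?_
  rw [inner_eigenfn_lapA hL, norm_mul, Complex.norm_real,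
    Real.norm_of_nonneg (eigenval_pos hL n).le]

theorem exists_hilbertBasis_eigenfn (hL : 0 < L) :
    ∃ e : HilbertBasis ℕ ℂ (L2 L), ⇑e = eigenfn L := by
  refine ⟨HilbertBasis.mkOfOrthogonalEqBot (orthonormal_eigenfn hL) ?_,
    HilbertBasis.coe_mkOfOrthogonalEqBot _ _⟩
  refine (Submodule.eq_bot_iff _).2 fun f hf => eq_zero_of_inner_eigenfn hL fun n => ?_
  exact (Submodule.mem_orthogonal _ _).1 hf _ (Submodule.subset_span ⟨n, rfl⟩)

theorem inner_eq_inner_of_coeff (hL : 0 < L)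
    (h : ∀ n, inner ℂ f (eigenfn L n) * inner ℂ (eigenfn L n) g
      = inner ℂ f' (eigenfn L n) * inner ℂ (eigenfn L n) g') : inner ℂ f g = inner ℂ f' g' := by
  obtain ⟨e, he⟩ := exists_hilbertBasis_eigenfn hL
  rw [← e.tsum_inner_mul_inner f g, ← e.tsum_inner_mul_inner f' g', he]
  exact tsum_congr h

theorem isWeakDeriv_grad_of_inner_eigenfn (hL : 0 < L) {u : H10 L}
    (h : ∀ n, inner ℂ (eigenfn L n) g
      = -((eigenval L n : ℂ) * inner ℂ (eigenfn L n) (u : L2 L))) :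
    IsWeakDeriv L (grad L u) g := by
  refine isWeakDeriv_iff_inner.2 fun q hq => ?_
  obtain ⟨r, hr⟩ := exists_testGraph_snd hq
  obtain ⟨hq1, hgrad⟩ := exists_grad_eq ((testGraph L).le_topologicalClosure hq)
  have hqr : IsWeakDeriv L (grad L ⟨q.1, hq1⟩) r := hgrad ▸ testGraph_isWeakDeriv hr
  have hru : inner ℂ r (u : L2 L) = -inner ℂ q.2 (grad L u) :=
    isWeakDeriv_iff_inner.1 (isWeakDeriv_grad u) (q.2, r) hr
  rw [← neg_inj, neg_neg, ← hru]
  refine inner_eq_inner_of_coeff hL fun n => ?_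
  rw [h, ← inner_conj_symm r, inner_eigenfn_of_isWeakDeriv_grad hL n hqr, map_neg, map_mul,
    Complex.conj_ofReal, inner_conj_symm]
  ring

theorem mem_lapA_of_summable (hL : 0 < L) (u : H10 L)
    (h : Summable fun n => (eigenval L n * ‖inner ℂ (eigenfn L n) (u : L2 L)‖) ^ 2) :
    (u : L2 L) ∈ (lapA L).domain := by
  have ha : Summable fun n =>
      ((eigenval L n : ℂ) * inner ℂ (eigenfn L n) (u : L2 L)) • eigenfn L n := by
    refine (summable_smul_iff_of_orthonormal (orthonormal_eigenfn hL)).2 (h.congr fun n => ?_)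
    rw [norm_mul, Complex.norm_real, Real.norm_of_nonneg (eigenval_pos hL n).le]
  obtain ⟨y, hy⟩ : ∃ y, ∀ n, inner ℂ (eigenfn L n) y =
      (eigenval L n : ℂ) * inner ℂ (eigenfn L n) (u : L2 L) :=
    ⟨_, inner_tsum_smul_of_orthonormal (orthonormal_eigenfn hL) ha⟩
  exact mem_lapA_of_isWeakDeriv (isWeakDeriv_grad_of_inner_eigenfn hL (g := -y) fun n => by
    rw [inner_neg_right, hy])

end Eigenfunctions

section FractionalPowers

variable {L θ : ℝ}

theorem eigenval_zero_le (n : ℕ) : eigenval L 0 ≤ eigenval L n := by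
  simp only [eigenval, div_pow, mul_pow]
  gcongr
  exact n.zero_le

theorem rpow_eigenval_le (hL : 0 < L) {s t : ℝ} (hst : s ≤ t) (n : ℕ) :
    eigenval L n ^ s ≤ eigenval L 0 ^ (s - t) * eigenval L n ^ t := by
  calc eigenval L n ^ s = eigenval L n ^ (s - t) * eigenval L n ^ t := by
        rw [← Real.rpow_add (eigenval_pos hL n), sub_add_cancel]
    _ ≤ eigenval L 0 ^ (s - t) * eigenval L n ^ t :=
        mul_le_mul_of_nonneg_right (Real.rpow_le_rpow_of_nonpos (eigenval_pos hL 0)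
          (eigenval_zero_le n) (sub_nonpos.2 hst)) (Real.rpow_nonneg (eigenval_pos hL n).le _)

theorem rpow_half_eigenval (hL : 0 < L) (n : ℕ) : eigenval L n ^ (1 / 2 : ℝ) = freq L n := by
  rw [← Real.sqrt_eq_rpow, eigenval_eq, Real.sqrt_sq (freq_pos hL n).le]

theorem norm_rpow_eigenval (hL : 0 < L) (n : ℕ) :
    ‖((eigenval L n ^ θ : ℝ) : ℂ)‖ = eigenval L n ^ θ := by
  rw [Complex.norm_real, Real.norm_of_nonneg (Real.rpow_nonneg (eigenval_pos hL n).le _)]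

theorem mem_fracA_iff (hL : 0 < L) {f : L2 L} : f ∈ (fracA L θ).domain ↔
    Summable fun n => (eigenval L n ^ θ * ‖inner ℂ (eigenfn L n) f‖) ^ 2 := by
  refine (summable_smul_iff_of_orthonormal (orthonormal_eigenfn hL)).trans
    (summable_congr fun n => ?_)
  rw [norm_mul, norm_rpow_eigenval hL]

theorem fracA_hasSum (f : (fracA L θ).domain) :
    HasSum (fun n => (((eigenval L n ^ θ : ℝ) : ℂ) * inner ℂ (eigenfn L n) (f : L2 L))
      • eigenfn L n) (fracA L θ f) :=
  Summable.hasSum f.2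

theorem inner_eigenfn_fracA (hL : 0 < L) (f : (fracA L θ).domain) (n : ℕ) :
    inner ℂ (eigenfn L n) (fracA L θ f)
      = ((eigenval L n ^ θ : ℝ) : ℂ) * inner ℂ (eigenfn L n) (f : L2 L) := by
  rw [← (fracA_hasSum f).tsum_eq]
  exact inner_tsum_smul_of_orthonormal (orthonormal_eigenfn hL) (fracA_hasSum f).summable n

theorem mem_fracA_of_le (hL : 0 < L) {s t : ℝ} (hst : s ≤ t) {f : L2 L}
    (hf : f ∈ (fracA L t).domain) : f ∈ (fracA L s).domain := by
  rw [mem_fracA_iff hL] at hf ⊢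
  refine Summable.of_nonneg_of_le (fun n => sq_nonneg _) (fun n => ?_)
    (hf.mul_left ((eigenval L 0 ^ (s - t)) ^ 2))
  rw [← mul_pow, ← mul_assoc]
  exact pow_le_pow_left₀ (mul_nonneg (Real.rpow_nonneg (eigenval_pos hL n).le s) (norm_nonneg _))
    (mul_le_mul_of_nonneg_right (rpow_eigenval_le hL hst n) (norm_nonneg _)) 2

theorem H10_mem_fracA (hL : 0 < L) (hθ : θ ≤ 1 / 2) (u : H10 L) :
    (u : L2 L) ∈ (fracA L θ).domain := by
  refine mem_fracA_of_le hL hθ ((mem_fracA_iff hL).2 ?_)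
  simpa only [rpow_half_eigenval hL] using summable_freq_mul_inner hL u

theorem lapA_mem_fracA (hL : 0 < L) (hθ : θ ≤ 1) {u : L2 L} (hu : u ∈ (lapA L).domain) :
    u ∈ (fracA L θ).domain := by
  refine mem_fracA_of_le hL hθ ((mem_fracA_iff hL).2 ?_)
  simpa only [Real.rpow_one] using summable_eigenval_mul_inner hL hu

theorem inner_fracA_hasSum (f : (fracA L θ).domain) (g : L2 L) :
    HasSum (fun n => ((eigenval L n ^ θ : ℝ) : ℂ) *
      (inner ℂ (f : L2 L) (eigenfn L n) * inner ℂ (eigenfn L n) g)) (inner ℂ (fracA L θ f) g) := by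
  have hsum := ((fracA_hasSum f).mapL (innerSL ℂ g)).mapL Complex.conjCLE.toContinuousLinearMap
  simp only [innerSL_apply_apply, ContinuousLinearEquiv.coe_coe, Complex.conjCLE_apply,
    inner_conj_symm] at hsum
  refine hsum.congr_fun fun n => ?_
  rw [inner_smul_left, map_mul, Complex.conj_ofReal, inner_conj_symm, mul_assoc]

theorem re_inner_fracA_nonneg (hL : 0 < L) (f : (fracA L θ).domain) :
    0 ≤ (inner ℂ (fracA L θ f) (f : L2 L)).re := by
  refine ((inner_fracA_hasSum f (f : L2 L)).mapL Complex.reCLM).nonneg fun n => ?_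
  rw [Complex.reCLM_apply, Complex.re_ofReal_mul, ← inner_conj_symm, Complex.conj_mul',
    ← Complex.ofReal_pow, Complex.ofReal_re]
  exact mul_nonneg (Real.rpow_nonneg (eigenval_pos hL n).le _) (sq_nonneg _)

theorem norm_rpow_eigenval_mul_inner_le (hL : 0 < L) (hθ : θ ≤ 1) (w u : H10 L) (n : ℕ) :
    ‖((eigenval L n ^ θ : ℝ) : ℂ) *
        (inner ℂ (w : L2 L) (eigenfn L n) * inner ℂ (eigenfn L n) (u : L2 L))‖ ≤
      eigenval L 0 ^ (θ - 1) *
        (‖inner ℂ (cosine L n) (grad L w)‖ * ‖inner ℂ (cosine L n) (grad L u)‖) := by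
  have hle := rpow_eigenval_le hL hθ n
  rw [Real.rpow_one, eigenval_eq L n] at hle
  rw [norm_mul, norm_mul, norm_rpow_eigenval hL, norm_inner_symm, ← freq_mul_norm_inner hL,
    ← freq_mul_norm_inner hL, eigenval_eq L n]
  refine (mul_le_mul_of_nonneg_right hle (by positivity)).trans (le_of_eq ?_)
  ring

theorem norm_inner_fracA_le (hL : 0 < L) (hθ : θ ≤ 1) (w u : H10 L)
    (hw : (w : L2 L) ∈ (fracA L θ).domain) : ‖inner ℂ (fracA L θ ⟨w, hw⟩) (u : L2 L)‖
      ≤ eigenval L 0 ^ (θ - 1) * (‖grad L w‖ * ‖grad L u‖) := by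
  have hbessel (f : L2 L) (s : Finset ℕ) : √(∑ n ∈ s, ‖inner ℂ (cosine L n) f‖ ^ 2) ≤ ‖f‖ :=
    Real.sqrt_le_iff.2 ⟨norm_nonneg _, (orthonormal_cosine hL).sum_inner_products_le _⟩
  refine le_of_tendsto (inner_fracA_hasSum _ _).norm (Eventually.of_forall fun s => ?_)
  refine (norm_sum_le_of_le _ fun n _ =>
    norm_rpow_eigenval_mul_inner_le hL hθ w u n).trans ?_
  rw [← Finset.mul_sum]
  refine mul_le_mul_of_nonneg_left ?_ (Real.rpow_nonneg (eigenval_pos hL 0).le _)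
  exact (Real.sum_mul_le_sqrt_mul_sqrt _ _ _).trans
    (mul_le_mul (hbessel _ _) (hbessel _ _) (Real.sqrt_nonneg _) (norm_nonneg _))

end FractionalPowers

/-! ### The energy space -/

namespace Energy

variable {p : Beam} {ι : Type*} {l : Filter ι}

/-- The `L²` component `w` as a bounded operator. -/
def wCLM (p : Beam) : Energy p →L[ℂ] L2 p.L :=
  wL.mkContinuousOfExistsBound <| (exists_bound p).imp fun _ h U => (h.2 U).1

/-- The `L²` component `v` as a bounded operator. -/
def vCLM (p : Beam) : Energy p →L[ℂ] L2 p.L :=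
  vL.mkContinuousOfExistsBound <| (exists_bound p).imp fun _ h U => (h.2 U).2.1

/-- The shear strain `u_x + ψ` as a bounded operator. -/
def shearCLM (p : Beam) : Energy p →L[ℂ] L2 p.L :=
  shearL.mkContinuousOfExistsBound <| (exists_bound p).imp fun _ h U => (h.2 U).2.2.1

/-- The derivative `ψ_x` as a bounded operator. -/
def gradψCLM (p : Beam) : Energy p →L[ℂ] L2 p.L :=
  (grad p.L ∘ₗ ψL).mkContinuousOfExistsBound <| (exists_bound p).imp fun _ h U => (h.2 U).2.2.2

theorem exists_norm_ψ_le (p : Beam) : ∃ C, ∀ U : Energy p, ‖(U.ψ : L2 p.L)‖ ≤ C * ‖U‖ := by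
  obtain ⟨K, hK, hpoincare⟩ := exists_poincare p.L
  refine ⟨K * ‖gradψCLM p‖, fun U => (hpoincare U.ψ).trans ?_⟩
  rw [mul_assoc]
  exact mul_le_mul_of_nonneg_left ((gradψCLM p).le_opNorm U) hK

/-- The component `ψ`, viewed in `L²`, as a bounded operator. -/
def ψCLM (p : Beam) : Energy p →L[ℂ] L2 p.L :=
  ((H10 p.L).subtype ∘ₗ ψL).mkContinuousOfExistsBound (exists_norm_ψ_le p)

/-- The derivative `u_x` as a bounded operator. -/
def graduCLM (p : Beam) : Energy p →L[ℂ] L2 p.L :=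
  shearCLM p - ψCLM p

theorem graduCLM_apply (U : Energy p) : graduCLM p U = grad p.L U.u :=
  add_sub_cancel_right _ _

theorem exists_norm_u_le (p : Beam) : ∃ C, ∀ U : Energy p, ‖(U.u : L2 p.L)‖ ≤ C * ‖U‖ := by
  obtain ⟨K, hK, hpoincare⟩ := exists_poincare p.L
  refine ⟨K * ‖graduCLM p‖, fun U => (hpoincare U.u).trans ?_⟩
  rw [mul_assoc, ← graduCLM_apply]
  exact mul_le_mul_of_nonneg_left ((graduCLM p).le_opNorm U) hK

/-- The component `u`, viewed in `L²`, as a bounded operator. -/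
def uCLM (p : Beam) : Energy p →L[ℂ] L2 p.L :=
  LinearMap.mkContinuousOfExistsBound ⟨⟨fun U => (U.u : L2 p.L), fun _ _ => rfl⟩, fun _ _ => rfl⟩
    (exists_norm_u_le p)

theorem norm_le (U : Energy p) :
    ‖U‖ ≤ √p.ρ₁ * ‖U.w‖ + √p.ρ₂ * ‖U.v‖ + √p.κ * ‖U.shear‖ + √p.b * ‖grad p.L U.ψ‖ := by
  have hsq : ‖U‖ ^ 2 = (√p.ρ₁ * ‖U.w‖) ^ 2 + (√p.ρ₂ * ‖U.v‖) ^ 2 + (√p.κ * ‖U.shear‖) ^ 2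
      + (√p.b * ‖grad p.L U.ψ‖) ^ 2 := by
    simp only [norm_sq, mul_pow, Real.sq_sqrt p.ρ₁_pos.le, Real.sq_sqrt p.ρ₂_pos.le,
      Real.sq_sqrt p.κ_pos.le, Real.sq_sqrt p.b_pos.le]
  have hadd {a b : ℝ} (ha : 0 ≤ a) (hb : 0 ≤ b) : a ^ 2 + b ^ 2 ≤ (a + b) ^ 2 :=
    (le_add_of_nonneg_right (by positivity)).trans_eq (by ring : _ + 2 * a * b = _)
  refine le_of_sq_le_sq ?_ (by positivity)
  rw [hsq]
  refine (add_le_add_left ((add_le_add_left (hadd ?_ ?_) _).trans (hadd ?_ ?_)) _).trans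
    (hadd ?_ ?_) <;> positivity

theorem tendsto_of_components {s : ι → Energy p} {U : Energy p}
    (hu : Tendsto (fun i => grad p.L (s i).u) l (𝓝 (grad p.L U.u)))
    (hw : Tendsto (fun i => (s i).w) l (𝓝 U.w))
    (hψ : Tendsto (fun i => ((s i).ψ : L2 p.L)) l (𝓝 U.ψ))
    (hψ' : Tendsto (fun i => grad p.L (s i).ψ) l (𝓝 (grad p.L U.ψ)))
    (hv : Tendsto (fun i => (s i).v) l (𝓝 U.v)) : Tendsto s l (𝓝 U) := by
  have hshear : Tendsto (fun i => (s i).shear) l (𝓝 U.shear) := hu.add hψ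
  rw [tendsto_iff_norm_sub_tendsto_zero] at hw hv hshear hψ' ⊢
  have hbound := (((hw.const_mul √p.ρ₁).add (hv.const_mul √p.ρ₂)).add
    (hshear.const_mul √p.κ)).add (hψ'.const_mul √p.b)
  simp only [mul_zero, add_zero] at hbound
  refine squeeze_zero (fun i => norm_nonneg _) (fun i => ?_) hbound
  have hle := norm_le (s i - U)
  rwa [ψ_sub, map_sub, show (s i - U).shear = (s i).shear - U.shear from map_sub shearL _ _] at hle

/-- The state with displacement `u`, rotation `ψ` and zero velocities. Its inner products are the
elastic form `κ⟨u_x + ψ, ·⟩ + b⟨ψ_x, ·⟩`. -/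
def static (u ψ : H10 p.L) : Energy p := mk u 0 ψ 0

theorem inner_static (φ χ : H10 p.L) (U : Energy p) :
    inner ℂ (static φ χ) U = (p.κ : ℂ) * inner ℂ (grad p.L φ + (χ : L2 p.L)) U.shear
      + (p.b : ℂ) * inner ℂ (grad p.L χ) (grad p.L U.ψ) := by
  change (p.ρ₁ : ℂ) * inner ℂ 0 U.w + (p.ρ₂ : ℂ) * inner ℂ 0 U.v + _ + _ = _
  rw [inner_zero_left, inner_zero_left, mul_zero, mul_zero, add_zero, zero_add]
  rfl

theorem inner_eq_add_inner_static (U V : Energy p) : inner ℂ U V =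
    (p.ρ₁ : ℂ) * inner ℂ U.w V.w + (p.ρ₂ : ℂ) * inner ℂ U.v V.v
      + inner ℂ U (static V.u V.ψ) := by
  rw [← inner_conj_symm U (static V.u V.ψ), inner_static]
  simp only [map_add, map_mul, Complex.conj_ofReal, inner_conj_symm, ← add_assoc]
  rfl

theorem norm_static_sq (U : Energy p) :
    ((‖static U.u U.ψ‖ ^ 2 : ℝ) : ℂ) = inner ℂ (static U.u U.ψ) U := by
  rw [Complex.ofReal_pow, ← Complex.coe_algebraMap]
  exact (inner_self_eq_norm_sq_to_K _).symm.trans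
    ((inner_static U.u U.ψ (static U.u U.ψ)).trans (inner_static U.u U.ψ U).symm)

theorem norm_le_norm_static (U : Energy p) :
    ‖U‖ ≤ √p.ρ₁ * ‖U.w‖ + √p.ρ₂ * ‖U.v‖ + ‖static U.u U.ψ‖ := by
  have hsplit : U = mk 0 U.w 0 U.v + static U.u U.ψ :=
    Prod.ext (zero_add _).symm (Prod.ext (add_zero _).symm
      (Prod.ext (zero_add _).symm (add_zero _).symm))
  have hkinetic : ‖(mk 0 U.w 0 U.v : Energy p)‖ ≤ √p.ρ₁ * ‖U.w‖ + √p.ρ₂ * ‖U.v‖ := by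
    refine (norm_le _).trans_eq ?_
    have hshear : (mk 0 U.w 0 U.v : Energy p).shear = 0 := by
      change grad p.L 0 + ((0 : H10 p.L) : L2 p.L) = 0
      rw [map_zero, Submodule.coe_zero, add_zero]
    rw [hshear, norm_zero, mul_zero, add_zero]
    change _ + √p.b * ‖grad p.L 0‖ = _
    rw [map_zero, norm_zero, mul_zero, add_zero]
    rfl
  calc ‖U‖ = ‖mk 0 U.w 0 U.v + static U.u U.ψ‖ := congrArg norm hsplit
    _ ≤ _ := (norm_add_le _ _).trans (add_le_add_left hkinetic _)

end Energy

section Density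

variable {L : ℝ}

theorem dense_testGraph_fst (L : ℝ) :
    Dense ((testGraph L).map (LinearMap.fst ℂ _ _) : Set (L2 L)) := by
  rw [Submodule.dense_iff_topologicalClosure_eq_top, Submodule.topologicalClosure_eq_top_iff,
    Submodule.eq_bot_iff]
  intro f hf
  have hzero : IsWeakDeriv L 0 f := isWeakDeriv_iff_inner.2 fun q hq => by
    rw [inner_zero_right, (Submodule.mem_orthogonal _ _).1 hf q.1 ⟨q, hq, rfl⟩, neg_zero]
  exact hzero.unique (IsWeakDeriv.zero L)

theorem dense_lapA_domain (L : ℝ) : Dense ((lapA L).domain : Set (L2 L)) := by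
  refine (dense_testGraph_fst L).mono ?_
  rintro _ ⟨q, hq, rfl⟩
  exact testGraph_mem_lapA hq

theorem exists_seq_lapA_tendsto_grad (u : H10 L) :
    ∃ s : ℕ → H10 L, (∀ n, (s n : L2 L) ∈ (lapA L).domain) ∧
      Tendsto (fun n => (s n : L2 L)) atTop (𝓝 u) ∧
      Tendsto (fun n => grad L (s n)) atTop (𝓝 (grad L u)) := by
  obtain ⟨q, hq, hlim⟩ := mem_closure_iff_seq_limit.1 (show ((u : L2 L), grad L u) ∈
    closure (testGraph L : Set (L2 L × L2 L)) from grad_mem u)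
  choose hmem hgrad using fun n => exists_grad_eq ((testGraph L).le_topologicalClosure (hq n))
  refine ⟨fun n => ⟨(q n).1, hmem n⟩, fun n => testGraph_mem_lapA (hq n),
    (continuous_fst.tendsto _).comp hlim, ?_⟩
  simp only [hgrad]
  exact (continuous_snd.tendsto _).comp hlim

end Density

/-! ### The operator `B` -/

section Operator

variable {p : Beam} {τ σ : ℝ}

theorem dense_domB (hτ : τ ≤ 1) (hσ : σ ≤ 1) : Dense (domB p τ σ : Set (Energy p)) := by
  intro U
  obtain ⟨u, hu, -, hgradu⟩ := exists_seq_lapA_tendsto_grad U.u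
  obtain ⟨ψ, hψ, hψlim, hgradψ⟩ := exists_seq_lapA_tendsto_grad U.ψ
  obtain ⟨w, hw, hwlim⟩ := mem_closure_iff_seq_limit.1 (dense_lapA_domain p.L U.w)
  obtain ⟨v, hv, hvlim⟩ := mem_closure_iff_seq_limit.1 (dense_lapA_domain p.L U.v)
  refine mem_closure_of_tendsto (f := fun n => Energy.mk (u n) (w n) (ψ n) (v n)) (b := atTop)
    (Energy.tendsto_of_components hgradu hwlim hψlim hgradψ hvlim)
    (Eventually.of_forall fun n => ?_)
  exact ⟨hu n, ⟨mem_H10_of_mem_lapA (hw n), lapA_mem_fracA p.L_pos hτ (hw n)⟩, hψ n,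
    mem_H10_of_mem_lapA (hv n), lapA_mem_fracA p.L_pos hσ (hv n)⟩

theorem rho_smul_opB_w (U : (opB p τ σ).domain) : (p.ρ₁ : ℂ) • (opB p τ σ U).w =
    (p.κ : ℂ) • dx p.L ⟨U.1.shear, shear_mem_dx U⟩ - fracA p.L τ ⟨U.1.w, U.2.2.1.2⟩ := by
  rw [opB_apply]
  exact smul_inv_smul₀ (Complex.ofReal_ne_zero.2 p.ρ₁_pos.ne') _

theorem rho_smul_opB_v (U : (opB p τ σ).domain) : (p.ρ₂ : ℂ) • (opB p τ σ U).v =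
    -((p.b : ℂ) • lapA p.L ⟨U.1.ψ, U.2.2.2.1⟩) - (p.κ : ℂ) • U.1.shear
      - fracA p.L σ ⟨U.1.v, U.2.2.2.2.2⟩ := by
  rw [opB_apply]
  exact smul_inv_smul₀ (Complex.ofReal_ne_zero.2 p.ρ₂_pos.ne') _

theorem opB_weak (U : (opB p τ σ).domain) (φ χ : H10 p.L) :
    (p.ρ₁ : ℂ) * inner ℂ (φ : L2 p.L) (opB p τ σ U).w
        + (p.ρ₂ : ℂ) * inner ℂ (χ : L2 p.L) (opB p τ σ U).v
      = -inner ℂ (Energy.static φ χ) (U : Energy p)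
        - inner ℂ (φ : L2 p.L) (fracA p.L τ ⟨U.1.w, U.2.2.1.2⟩)
        - inner ℂ (χ : L2 p.L) (fracA p.L σ ⟨U.1.v, U.2.2.2.2.2⟩) := by
  have hshear : inner ℂ (grad p.L φ) U.1.shear = -inner ℂ (φ : L2 p.L) (dx p.L _) :=
    inner_grad φ (dx_spec ⟨U.1.shear, shear_mem_dx U⟩)
  have hψ := inner_grad χ (isWeakDeriv_grad_lapA U.1.ψ U.2.2.2.1)
  rw [inner_neg_right, neg_neg] at hψ
  rw [Energy.inner_static, inner_add_left, hshear, hψ, ← inner_smul_right, ← inner_smul_right,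
    rho_smul_opB_w, rho_smul_opB_v]
  simp only [inner_sub_right, inner_neg_right, inner_smul_right]
  ring

theorem isDissipative_opB : IsDissipative (opB p τ σ) := by
  intro U
  have hweak := opB_weak U ⟨U.1.w, U.2.2.1.1⟩ ⟨U.1.v, U.2.2.2.2.1⟩
  have hsplit := Energy.inner_eq_add_inner_static (U : Energy p) (opB p τ σ U)
  have hre : (inner ℂ (U : Energy p) (opB p τ σ U)).re =
      -(inner ℂ U.1.w (fracA p.L τ ⟨U.1.w, U.2.2.1.2⟩)).re
        - (inner ℂ U.1.v (fracA p.L σ ⟨U.1.v, U.2.2.2.2.2⟩)).re := by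
    have hsymm : (inner ℂ (U : Energy p) (Energy.static (opB p τ σ U).u (opB p τ σ U).ψ)).re =
        (inner ℂ (Energy.static ⟨U.1.w, U.2.2.1.1⟩ ⟨U.1.v, U.2.2.2.2.1⟩) (U : Energy p)).re :=
      inner_re_symm (𝕜 := ℂ) (U : Energy p) (Energy.static (opB p τ σ U).u (opB p τ σ U).ψ)
    have hre_weak := congrArg Complex.re hweak
    have hre_split := congrArg Complex.re hsplit
    simp only [Complex.add_re, Complex.sub_re, Complex.neg_re] at hre_weak hre_split
    linarith
  have hw := re_inner_fracA_nonneg p.L_pos (⟨U.1.w, U.2.2.1.2⟩ : (fracA p.L τ).domain)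
  have hv := re_inner_fracA_nonneg p.L_pos (⟨U.1.v, U.2.2.2.2.2⟩ : (fracA p.L σ).domain)
  rw [← inner_conj_symm, Complex.conj_re] at hw hv ⊢
  linarith

theorem norm_ofReal_mul_inner_apply_le {E F : Type*} [NormedAddCommGroup E] [NormedSpace ℂ E]
    [NormedAddCommGroup F] [InnerProductSpace ℂ F] {c : ℝ} (hc : 0 ≤ c) (S T : E →L[ℂ] F)
    (x y : E) : ‖(c : ℂ) * inner ℂ (S x) (T y)‖ ≤ c * (‖S‖ * ‖T‖) * (‖x‖ * ‖y‖) := by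
  rw [norm_mul, Complex.norm_real, Real.norm_of_nonneg hc, mul_assoc]
  refine mul_le_mul_of_nonneg_left ?_ hc
  exact (norm_inner_le_norm _ _).trans ((mul_le_mul (S.le_opNorm x) (T.le_opNorm y)
    (norm_nonneg _) (by positivity)).trans_eq (by ring))

theorem norm_inner_fracA_le_of_grad {E : Type*} [NormedAddCommGroup E] [NormedSpace ℂ E]
    {L θ : ℝ} (hL : 0 < L) (hθ : θ ≤ 1) {D : E →L[ℂ] L2 L} {x y : E} {u w : H10 L}
    (hu : D x = grad L u) (hw : D y = grad L w) (hdom : (w : L2 L) ∈ (fracA L θ).domain) :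
    ‖inner ℂ (u : L2 L) (fracA L θ ⟨w, hdom⟩)‖ ≤
      eigenval L 0 ^ (θ - 1) * ‖D‖ ^ 2 * (‖x‖ * ‖y‖) := by
  rw [norm_inner_symm]
  refine (norm_inner_fracA_le hL hθ w u hdom).trans ?_
  rw [← hu, ← hw, mul_assoc]
  refine mul_le_mul_of_nonneg_left ?_ (Real.rpow_nonneg (eigenval_pos hL 0).le _)
  exact (mul_le_mul (D.le_opNorm y) (D.le_opNorm x) (norm_nonneg _) (by positivity)).trans_eq
    (by ring)

theorem exists_norm_static_le (hτ : τ ≤ 1) (hσ : σ ≤ 1) :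
    ∃ M : ℝ, ∀ U : (opB p τ σ).domain, ‖Energy.static U.1.u U.1.ψ‖ ≤ M * ‖opB p τ σ U‖ := by
  let M : ℝ := p.ρ₁ * (‖Energy.uCLM p‖ * ‖Energy.wCLM p‖)
    + p.ρ₂ * (‖Energy.ψCLM p‖ * ‖Energy.vCLM p‖)
    + eigenval p.L 0 ^ (τ - 1) * ‖Energy.graduCLM p‖ ^ 2
    + eigenval p.L 0 ^ (σ - 1) * ‖Energy.gradψCLM p‖ ^ 2
  refine ⟨M, fun U => ?_⟩
  set Y := Energy.static U.1.u U.1.ψ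
  set F := opB p τ σ U
  have hsq : ((‖Y‖ ^ 2 : ℝ) : ℂ) = -((p.ρ₁ : ℂ) * inner ℂ (U.1.u : L2 p.L) F.w
      + (p.ρ₂ : ℂ) * inner ℂ (U.1.ψ : L2 p.L) F.v
      + inner ℂ (U.1.u : L2 p.L) (fracA p.L τ ⟨U.1.w, U.2.2.1.2⟩)
      + inner ℂ (U.1.ψ : L2 p.L) (fracA p.L σ ⟨U.1.v, U.2.2.2.2.2⟩)) := by
    rw [Energy.norm_static_sq]
    linear_combination opB_weak U U.1.u U.1.ψ
  have hw := norm_ofReal_mul_inner_apply_le p.ρ₁_pos.le (Energy.uCLM p) (Energy.wCLM p) Y F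
  have hv := norm_ofReal_mul_inner_apply_le p.ρ₂_pos.le (Energy.ψCLM p) (Energy.vCLM p) Y F
  have hτ_damping := norm_inner_fracA_le_of_grad p.L_pos hτ (D := Energy.graduCLM p) (x := Y)
    (y := F) (Energy.graduCLM_apply Y) (Energy.graduCLM_apply F) U.2.2.1.2
  have hσ_damping := norm_inner_fracA_le_of_grad p.L_pos hσ (D := Energy.gradψCLM p) (x := Y)
    (y := F) (u := U.1.ψ) (w := F.ψ) rfl rfl U.2.2.2.2.2
  have hYF : ‖Y‖ * ‖Y‖ ≤ M * ‖F‖ * ‖Y‖ := by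
    rw [← sq, ← Real.norm_of_nonneg (sq_nonneg ‖Y‖), ← Complex.norm_real, hsq, norm_neg]
    refine (norm_add_le_of_le (norm_add_le_of_le (norm_add_le_of_le hw hv) hτ_damping)
      hσ_damping).trans_eq ?_
    simp only [M]
    ring
  have hM : 0 ≤ M := by
    have hρ₁ := p.ρ₁_pos
    have hρ₂ := p.ρ₂_pos
    have hlam := eigenval_pos p.L_pos 0
    simp only [M]
    positivity
  rcases (norm_nonneg Y).eq_or_lt with hzero | hpos
  · rw [← hzero]
    positivity
  · exact le_of_mul_le_mul_right hYF hpos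

theorem exists_opB_lower_bound (hτ : τ ≤ 1) (hσ : σ ≤ 1) :
    ∃ K : ℝ, ∀ U : (opB p τ σ).domain, ‖(U : Energy p)‖ ≤ K * ‖opB p τ σ U‖ := by
  obtain ⟨M, hM⟩ := exists_norm_static_le (p := p) hτ hσ
  refine ⟨√p.ρ₁ * ‖Energy.uCLM p‖ + √p.ρ₂ * ‖Energy.ψCLM p‖ + M, fun U => ?_⟩
  have hw : ‖U.1.w‖ ≤ ‖Energy.uCLM p‖ * ‖opB p τ σ U‖ := (Energy.uCLM p).le_opNorm (opB p τ σ U)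
  have hv : ‖U.1.v‖ ≤ ‖Energy.ψCLM p‖ * ‖opB p τ σ U‖ := (Energy.ψCLM p).le_opNorm (opB p τ σ U)
  rw [add_mul, add_mul, mul_assoc, mul_assoc]
  exact (Energy.norm_le_norm_static _).trans (add_le_add_three
    (mul_le_mul_of_nonneg_left hw (Real.sqrt_nonneg _))
    (mul_le_mul_of_nonneg_left hv (Real.sqrt_nonneg _)) (hM U))

theorem exists_inner_static_eq (p : Beam) (f g : L2 p.L) : ∃ X : Energy p, ∀ φ χ : H10 p.L,
    inner ℂ (Energy.static φ χ) X = -inner ℂ (φ : L2 p.L) f - inner ℂ (χ : L2 p.L) g := by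
  let ℓ : StrongDual ℂ (Energy p) :=
    -((innerSL ℂ f).comp (Energy.uCLM p)) - (innerSL ℂ g).comp (Energy.ψCLM p)
  refine ⟨(InnerProductSpace.toDual ℂ (Energy p)).symm ℓ, fun φ χ => ?_⟩
  have happly : ℓ (Energy.static φ χ) = -inner ℂ f (φ : L2 p.L) - inner ℂ g (χ : L2 p.L) := rfl
  rw [← inner_conj_symm, InnerProductSpace.toDual_symm_apply, happly, map_sub, map_neg,
    inner_conj_symm, inner_conj_symm]

theorem isWeakDeriv_shear_of_inner_static {X : Energy p} {f : L2 p.L}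
    (hX : ∀ φ, inner ℂ (Energy.static φ 0) X = -inner ℂ (φ : L2 p.L) f) :
    IsWeakDeriv p.L X.shear ((p.κ : ℂ)⁻¹ • f) := by
  refine isWeakDeriv_of_inner_grad fun φ => ?_
  have hφ := hX φ
  rw [Energy.inner_static, map_zero, Submodule.coe_zero, add_zero, inner_zero_left, mul_zero,
    add_zero] at hφ
  rw [inner_smul_right, ← mul_neg, ← hφ,
    inv_mul_cancel_left₀ (Complex.ofReal_ne_zero.2 p.κ_pos.ne')]

theorem isWeakDeriv_grad_of_inner_static {X : Energy p} {g : L2 p.L}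
    (hX : ∀ χ, inner ℂ (Energy.static 0 χ) X = -inner ℂ (χ : L2 p.L) g) :
    IsWeakDeriv p.L (grad p.L X.ψ) ((p.b : ℂ)⁻¹ • ((p.κ : ℂ) • X.shear + g)) := by
  refine isWeakDeriv_of_inner_grad fun χ => ?_
  have hχ := hX χ
  rw [Energy.inner_static, map_zero, zero_add] at hχ
  rw [inner_smul_right, inner_add_right, inner_smul_right, ← mul_neg,
    eq_inv_mul_iff_mul_eq₀ (Complex.ofReal_ne_zero.2 p.b_pos.ne')]
  linear_combination hχ

theorem exists_isWeakDeriv_stationary (p : Beam) (f g : L2 p.L) : ∃ X : Energy p,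
    IsWeakDeriv p.L X.shear ((p.κ : ℂ)⁻¹ • f) ∧
    IsWeakDeriv p.L (grad p.L X.ψ) ((p.b : ℂ)⁻¹ • ((p.κ : ℂ) • X.shear + g)) := by
  obtain ⟨X, hX⟩ := exists_inner_static_eq p f g
  refine ⟨X, isWeakDeriv_shear_of_inner_static fun φ => ?_,
    isWeakDeriv_grad_of_inner_static fun χ => ?_⟩
  · rw [hX, Submodule.coe_zero, inner_zero_left, sub_zero]
  · rw [hX, Submodule.coe_zero, inner_zero_left, neg_zero, zero_sub]

theorem mem_lapA_of_isWeakDeriv_shear {X : Energy p} {f : L2 p.L}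
    (h : IsWeakDeriv p.L X.shear f) : (X.u : L2 p.L) ∈ (lapA p.L).domain := by
  have hu := h.add ((isWeakDeriv_grad X.ψ).smul (-1))
  rw [Energy.shear, neg_one_smul, add_neg_cancel_right] at hu
  exact mem_lapA_of_isWeakDeriv hu

theorem exists_opB_eq (F : Energy p) (hu : (F.u : L2 p.L) ∈ (fracA p.L τ).domain)
    (hψ : (F.ψ : L2 p.L) ∈ (fracA p.L σ).domain) : ∃ U, opB p τ σ U = F := by
  obtain ⟨X, hshear, hgradψ⟩ := exists_isWeakDeriv_stationary p
    ((p.ρ₁ : ℂ) • F.w + fracA p.L τ ⟨F.u, hu⟩) ((p.ρ₂ : ℂ) • F.v + fracA p.L σ ⟨F.ψ, hψ⟩)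
  have hXψ := mem_lapA_of_isWeakDeriv hgradψ
  let U : (opB p τ σ).domain := ⟨Energy.mk X.u F.u X.ψ F.ψ,
    mem_lapA_of_isWeakDeriv_shear hshear, ⟨F.u.2, hu⟩, hXψ, F.ψ.2, hψ⟩
  have hw : (p.ρ₁ : ℂ) • (opB p τ σ U).w = (p.ρ₁ : ℂ) • F.w := by
    have hdx : dx p.L ⟨U.1.shear, shear_mem_dx U⟩ = _ := dx_eq ⟨X.shear, _, hshear⟩ hshear
    rw [rho_smul_opB_w, hdx, smul_inv_smul₀ (Complex.ofReal_ne_zero.2 p.κ_pos.ne')]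
    exact add_sub_cancel_right _ _
  have hv : (p.ρ₂ : ℂ) • (opB p τ σ U).v = (p.ρ₂ : ℂ) • F.v := by
    have hlap : lapA p.L ⟨U.1.ψ, U.2.2.2.1⟩ = _ := lapA_eq hXψ hgradψ
    rw [rho_smul_opB_v, hlap, smul_neg, neg_neg,
      smul_inv_smul₀ (Complex.ofReal_ne_zero.2 p.b_pos.ne')]
    exact sub_eq_of_eq_add (add_sub_cancel_left _ _)
  exact ⟨U, Prod.ext rfl (Prod.ext
    (smul_right_injective _ (Complex.ofReal_ne_zero.2 p.ρ₁_pos.ne') hw) (Prod.ext rfl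
    (smul_right_injective _ (Complex.ofReal_ne_zero.2 p.ρ₂_pos.ne') hv)))⟩

theorem denseRange_opB (hτ : τ ≤ 1) (hσ : σ ≤ 1) : DenseRange (opB p τ σ) :=
  (dense_domB hτ hσ).mono fun F hF =>
    exists_opB_eq F (lapA_mem_fracA p.L_pos hτ hF.1) (lapA_mem_fracA p.L_pos hσ hF.2.2.1)

theorem surjective_opB (hτ : τ ≤ 1 / 2) (hσ : σ ≤ 1 / 2) : Function.Surjective (opB p τ σ) :=
  fun F => exists_opB_eq F (H10_mem_fracA p.L_pos hτ F.u) (H10_mem_fracA p.L_pos hσ F.ψ)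

end Operator

/-! ### Damped oscillators -/

theorem add_le_exp_mul_of_hasDerivWithinAt_le {φ φ' : ℝ → ℝ} {c T : ℝ} (hT : 0 ≤ T)
    (hφ : ∀ t, 0 ≤ t → HasDerivWithinAt φ (φ' t) (Ici 0) t)
    (hle : ∀ t, 0 ≤ t → φ' t ≤ φ t + c) : φ T + c ≤ Real.exp T * (φ 0 + c) := by
  have hcont : ContinuousOn φ (Icc 0 T) := fun t ht =>
    (hφ t ht.1).continuousWithinAt.mono Icc_subset_Ici_self
  have hgronwall := le_gronwallBound_of_liminf_deriv_right_le (K := 1) (ε := c) hcont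
    (fun t ht r hr => ((hφ t ht.1).mono (Ici_subset_Ici.2 ht.1)).liminf_right_slope_le hr) le_rfl
    (fun t ht => (hle t ht.1).trans_eq (by rw [one_mul])) T (right_mem_Icc.2 hT)
  simp only [gronwallBound_of_K_ne_0 (one_ne_zero (α := ℝ)), sub_zero, one_mul, div_one]
    at hgronwall
  linarith

section Oscillator

variable {F : Type*} [NormedAddCommGroup F] [InnerProductSpace ℝ F] {ρ κ lam d : ℝ}

/-- The motion of a damped oscillator `ρ a'' + d a' + κ λ a = f` for `t ≥ 0`, with velocity `w = a'`
and a forcing `f` with derivative `f'`. -/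
structure IsDampedOscillator (ρ κ lam d : ℝ) (a w f f' : ℝ → F) : Prop where
  hasDerivWithinAt_position : ∀ t, 0 ≤ t → HasDerivWithinAt a (w t) (Ici 0) t
  hasDerivWithinAt_velocity : ∀ t, 0 ≤ t →
    HasDerivWithinAt w (ρ⁻¹ • (f t - (κ * lam) • a t - d • w t)) (Ici 0) t
  hasDerivWithinAt_forcing : ∀ t, 0 ≤ t → HasDerivWithinAt f (f' t) (Ici 0) t

/-- `λ` times the energy of a forced oscillator, including the potential `-⟨f, a⟩` of the forcing.
With this weight the sum over all the modes controls the `H²` norm of the position. -/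
def oscillatorEnergy (ρ κ lam : ℝ) (f a w : F) : ℝ :=
  ρ / 2 * (lam * ‖w‖ ^ 2) + κ / 2 * (lam * ‖a‖) ^ 2 - lam * inner ℝ f a

theorem abs_mul_inner_le (hκ : 0 < κ) (hlam : 0 ≤ lam) (f a : F) :
    |lam * inner ℝ f a| ≤ κ / 4 * (lam * ‖a‖) ^ 2 + ‖f‖ ^ 2 / κ := by
  have hyoung : κ / 4 * (lam * ‖a‖) ^ 2 + ‖f‖ ^ 2 / κ - lam * (‖f‖ * ‖a‖) =
      (κ / 2 * (lam * ‖a‖) - ‖f‖) ^ 2 / κ := by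
    field_simp
    ring
  have hnonneg : 0 ≤ (κ / 2 * (lam * ‖a‖) - ‖f‖) ^ 2 / κ := by positivity
  rw [abs_mul, abs_of_nonneg hlam]
  linarith [mul_le_mul_of_nonneg_left (abs_real_inner_le_norm f a) hlam]

theorem le_oscillatorEnergy (hρ : 0 ≤ ρ) (hκ : 0 < κ) (hlam : 0 ≤ lam) (f a w : F) :
    κ / 4 * (lam * ‖a‖) ^ 2 - ‖f‖ ^ 2 / κ ≤ oscillatorEnergy ρ κ lam f a w := by
  have hkinetic : 0 ≤ ρ / 2 * (lam * ‖w‖ ^ 2) := by positivity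
  simp only [oscillatorEnergy]
  linarith [le_of_abs_le (abs_mul_inner_le hκ hlam f a)]

theorem oscillatorEnergy_le (hκ : 0 < κ) (hlam : 0 ≤ lam) (f a w : F) :
    oscillatorEnergy ρ κ lam f a w ≤
      ρ / 2 * (lam * ‖w‖ ^ 2) + κ * (lam * ‖a‖) ^ 2 + ‖f‖ ^ 2 / κ := by
  have hpotential : 0 ≤ κ / 4 * (lam * ‖a‖) ^ 2 := by positivity
  simp only [oscillatorEnergy]
  linarith [neg_le_of_abs_le (abs_mul_inner_le hκ hlam f a)]

theorem IsDampedOscillator.hasDerivWithinAt_energy {a w f f' : ℝ → F}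
    (h : IsDampedOscillator ρ κ lam d a w f f') (hρ : ρ ≠ 0) {t : ℝ} (ht : 0 ≤ t) :
    HasDerivWithinAt (fun t => oscillatorEnergy ρ κ lam (f t) (a t) (w t))
      (-(lam * d * ‖w t‖ ^ 2) - lam * inner ℝ (f' t) (a t)) (Ici 0) t := by
  have ha := h.hasDerivWithinAt_position t ht
  have hw := h.hasDerivWithinAt_velocity t ht
  have hpotential : HasDerivWithinAt (fun t => (lam * ‖a t‖) ^ 2)
      (lam ^ 2 * (2 * inner ℝ (a t) (w t))) (Ici 0) t := by
    simp only [mul_pow]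
    exact ha.norm_sq.const_mul _
  refine (((hw.norm_sq.const_mul lam).const_mul (ρ / 2)).add (hpotential.const_mul (κ / 2))
    |>.sub (((h.hasDerivWithinAt_forcing t ht).inner ℝ ha).const_mul lam)).congr_deriv ?_
  rw [inner_smul_right, inner_sub_right, inner_sub_right, inner_smul_right, inner_smul_right,
    real_inner_self_eq_norm_sq, real_inner_comm (a t) (w t), real_inner_comm (f t) (w t)]
  field_simp
  ring

theorem energy_deriv_le (hρ : 0 ≤ ρ) (hκ : 0 < κ) (hlam : 0 ≤ lam) (hd : 0 ≤ d) (f f' a w : F) :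
    -(lam * d * ‖w‖ ^ 2) - lam * inner ℝ f' a ≤
      oscillatorEnergy ρ κ lam f a w + (‖f‖ ^ 2 / κ + ‖f'‖ ^ 2 / κ) := by
  have hdamping : 0 ≤ lam * d * ‖w‖ ^ 2 := by positivity
  linarith [neg_le_of_abs_le (abs_mul_inner_le hκ hlam f' a),
    le_oscillatorEnergy hρ hκ hlam f a w]

section Sum

variable {G T : ℝ} {lam d : ℕ → ℝ} {a w f f' : ℕ → ℝ → F}

theorem sum_oscillatorEnergy_add_le (hρ : 0 < ρ) (hκ : 0 < κ) (hlam : ∀ n, 0 ≤ lam n)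
    (hd : ∀ n, 0 ≤ d n) (hosc : ∀ n, IsDampedOscillator ρ κ (lam n) (d n) (a n) (w n) (f n) (f' n))
    {s : Finset ℕ} (hf : ∀ t, 0 ≤ t → ∑ n ∈ s, (‖f n t‖ ^ 2 + ‖f' n t‖ ^ 2) ≤ G) (hT : 0 ≤ T) :
    ∑ n ∈ s, oscillatorEnergy ρ κ (lam n) (f n T) (a n T) (w n T) + G / κ ≤
      Real.exp T * (∑ n ∈ s, oscillatorEnergy ρ κ (lam n) (f n 0) (a n 0) (w n 0) + G / κ) := by
  refine add_le_exp_mul_of_hasDerivWithinAt_le hT (φ := fun t => ∑ n ∈ s, oscillatorEnergy ρ κ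
    (lam n) (f n t) (a n t) (w n t)) (fun t ht => HasDerivWithinAt.fun_sum fun n _ =>
    (hosc n).hasDerivWithinAt_energy hρ.ne' ht) fun t ht => ?_
  refine (Finset.sum_le_sum fun n _ => energy_deriv_le hρ.le hκ (hlam n) (hd n) (f n t) (f' n t)
    (a n t) (w n t)).trans ?_
  simp only [Finset.sum_add_distrib, ← add_div, ← Finset.sum_div] at hf ⊢
  exact add_le_add_right (div_le_div_of_nonneg_right (hf t ht) hκ.le) _

theorem summable_of_isDampedOscillator (hρ : 0 < ρ) (hκ : 0 < κ) (hlam : ∀ n, 0 ≤ lam n)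
    (hd : ∀ n, 0 ≤ d n) (hosc : ∀ n, IsDampedOscillator ρ κ (lam n) (d n) (a n) (w n) (f n) (f' n))
    (hf : ∀ (s : Finset ℕ) (t), 0 ≤ t → ∑ n ∈ s, (‖f n t‖ ^ 2 + ‖f' n t‖ ^ 2) ≤ G)
    (ha₀ : Summable fun n => (lam n * ‖a n 0‖) ^ 2) (hw₀ : Summable fun n => lam n * ‖w n 0‖ ^ 2)
    (hT : 0 ≤ T) : Summable fun n => (lam n * ‖a n T‖) ^ 2 := by
  have hforce (s : Finset ℕ) {t : ℝ} (ht : 0 ≤ t) : (∑ n ∈ s, ‖f n t‖ ^ 2) / κ ≤ G / κ :=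
    div_le_div_of_nonneg_right ((Finset.sum_le_sum fun n _ =>
      le_add_of_nonneg_right (sq_nonneg _)).trans (hf s t ht)) hκ.le
  have hinit₀ := (hw₀.mul_left (ρ / 2)).add (ha₀.mul_left κ)
  set C : ℝ := ∑' n, (ρ / 2 * (lam n * ‖w n 0‖ ^ 2) + κ * (lam n * ‖a n 0‖) ^ 2)
  have hinit (s : Finset ℕ) :
      ∑ n ∈ s, oscillatorEnergy ρ κ (lam n) (f n 0) (a n 0) (w n 0) ≤ C + G / κ := by
    refine (Finset.sum_le_sum fun n _ => oscillatorEnergy_le hκ (hlam n) _ _ _).trans ?_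
    rw [Finset.sum_add_distrib, ← Finset.sum_div]
    refine add_le_add (hinit₀.sum_le_tsum _ fun n _ => ?_) (hforce s le_rfl)
    have hlam_n := hlam n
    positivity
  have hfinal (s : Finset ℕ) : κ / 4 * ∑ n ∈ s, (lam n * ‖a n T‖) ^ 2 ≤
      ∑ n ∈ s, oscillatorEnergy ρ κ (lam n) (f n T) (a n T) (w n T) + G / κ := by
    rw [← sub_le_iff_le_add]
    refine (sub_le_sub_left (hforce s hT) _).trans ?_
    rw [Finset.mul_sum, Finset.sum_div, ← Finset.sum_sub_distrib]
    exact Finset.sum_le_sum fun n _ => le_oscillatorEnergy hρ.le hκ (hlam n) _ _ _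
  refine (summable_mul_left_iff (by positivity : κ / 4 ≠ 0)).1 (summable_of_sum_le
    (c := Real.exp T * (C + G / κ + G / κ)) (fun n => by positivity) fun s => ?_)
  rw [← Finset.mul_sum]
  calc _ ≤ _ := hfinal s
    _ ≤ _ := sum_oscillatorEnergy_add_le hρ hκ hlam hd hosc (hf s) hT
    _ ≤ _ := mul_le_mul_of_nonneg_left (add_le_add_left (hinit s) _) (Real.exp_pos T).le

end Sum

end Oscillator

/-! ### Invariance of the domain -/

section Component

variable {E : Type*} [NormedAddCommGroup E] [NormedSpace ℂ E] {T A : E →ₗ.[ℂ] E}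
  {S : ContractionSemigroup E} {L ρ κ θ : ℝ} {D V P : E →L[ℂ] L2 L} {x y : E}

/-- Along `U' = T U`, the component `u = D U` has velocity `V U` and satisfies the damped wave
equation `ρ u'' + A^θ u' + κ A u = P U`. The equation is imposed on the sine modes, so that it makes
sense for `u` outside the domain of `A` and is inherited by the closure of `T`. -/
structure IsDampedComponent (T : E →ₗ.[ℂ] E) (ρ κ θ : ℝ) (D V P : E →L[ℂ] L2 L) : Prop where
  velocity : ∀ {x y}, (x, y) ∈ T.graph → D y = V x
  modes : ∀ {x y}, (x, y) ∈ T.graph → ∀ n, (ρ : ℂ) * inner ℂ (eigenfn L n) (V y) =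
    inner ℂ (eigenfn L n) (P x) - ((κ * eigenval L n : ℝ) : ℂ) * inner ℂ (eigenfn L n) (D x)
      - ((eigenval L n ^ θ : ℝ) : ℂ) * inner ℂ (eigenfn L n) (V x)

theorem mem_fracA_of_inner_eigenfn_eq (hL : 0 < L) {f g : L2 L}
    (h : ∀ n, inner ℂ (eigenfn L n) g = ((eigenval L n ^ θ : ℝ) : ℂ) * inner ℂ (eigenfn L n) f) :
    f ∈ (fracA L θ).domain := by
  rw [mem_fracA_iff hL]
  refine ((orthonormal_eigenfn hL).inner_products_summable g).congr fun n => ?_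
  rw [h, norm_mul, norm_rpow_eigenval hL]

/-- The `n`-th sine coefficient of the observation `D` along the orbit of `x`, as a function of
time. -/
def ContractionSemigroup.sineMode (S : ContractionSemigroup E) (D : E →L[ℂ] L2 L) (x : E) (n : ℕ)
    (t : ℝ) : ℂ := inner ℂ (eigenfn L n) (D (S.orbit x t))

theorem sum_norm_sineMode_sq_le (hL : 0 < L) (S : ContractionSemigroup E) (D : E →L[ℂ] L2 L)
    (x : E) (t : ℝ) (s : Finset ℕ) : ∑ n ∈ s, ‖S.sineMode D x n t‖ ^ 2 ≤ (‖D‖ * ‖x‖) ^ 2 :=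
  ((orthonormal_eigenfn hL).sum_inner_products_le _).trans <| pow_le_pow_left₀ (norm_nonneg _)
    ((D.le_opNorm _).trans (mul_le_mul_of_nonneg_left (S.norm_apply_le _ x) (norm_nonneg _))) 2

theorem hasDerivWithinAt_sineMode (D : E →L[ℂ] L2 L) (n : ℕ) {t : ℝ}
    (h : HasDerivWithinAt (S.orbit x) y (Ici 0) t) :
    HasDerivWithinAt (S.sineMode D x n) (inner ℂ (eigenfn L n) (D y)) (Ici 0) t :=
  (((innerSL ℂ (eigenfn L n)).comp D).restrictScalars ℝ).hasFDerivAt.comp_hasDerivWithinAt t h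

namespace IsDampedComponent

theorem closure (h : IsDampedComponent T ρ κ θ D V P) (hT : T.IsClosable) :
    IsDampedComponent T.closure ρ κ θ D V P where
  velocity {x y} hxy := by
    rw [← hT.graph_closure_eq_closure_graph] at hxy
    exact closure_minimal (s := (T.graph : Set (E × E))) (t := {q | D q.2 = V q.1})
      (fun q hq => h.velocity hq) (isClosed_eq (by fun_prop) (by fun_prop)) hxy
  modes {x y} hxy n := by
    rw [← hT.graph_closure_eq_closure_graph] at hxy
    exact closure_minimal (s := (T.graph : Set (E × E)))
      (t := {q | (ρ : ℂ) * inner ℂ (eigenfn L n) (V q.2) = inner ℂ (eigenfn L n) (P q.1)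
        - ((κ * eigenval L n : ℝ) : ℂ) * inner ℂ (eigenfn L n) (D q.1)
        - ((eigenval L n ^ θ : ℝ) : ℂ) * inner ℂ (eigenfn L n) (V q.1)})
      (fun q hq => h.modes hq n) (isClosed_eq (by fun_prop) (by fun_prop)) hxy

theorem mem_fracA (h : IsDampedComponent T ρ κ θ D V P) (hL : 0 < L) (hxy : (x, y) ∈ T.graph)
    (hx : D x ∈ (lapA L).domain) : V x ∈ (fracA L θ).domain := by
  refine mem_fracA_of_inner_eigenfn_eq hL
    (g := P x - (κ : ℂ) • lapA L ⟨D x, hx⟩ - (ρ : ℂ) • V y) fun n => ?_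
  rw [inner_sub_right, inner_sub_right, inner_smul_right, inner_smul_right, inner_eigenfn_lapA hL,
    h.modes hxy]
  push_cast
  ring

variable [CompleteSpace E]

theorem isDampedOscillator (h : IsDampedComponent A ρ κ θ D V P) (hS : IsGenerator A S)
    (hρ : ρ ≠ 0) (hxy : (x, y) ∈ A.graph) (n : ℕ) :
    IsDampedOscillator ρ κ (eigenval L n) (eigenval L n ^ θ)
      (S.sineMode D x n) (S.sineMode V x n) (S.sineMode P x n) (S.sineMode P y n) := by
  have horbit (t : ℝ) (ht : 0 ≤ t) := S.hasDerivWithinAt_orbit (hS.mem_graph_iff.1 hxy) ht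
  have hgraph (t : ℝ) : (S.orbit x t, S.orbit y t) ∈ A.graph := hS.map_graph _ hxy
  refine ⟨fun t ht => ?_, fun t ht => ?_,
    fun t ht => hasDerivWithinAt_sineMode P n (horbit t ht)⟩
  · refine (hasDerivWithinAt_sineMode D n (horbit t ht)).congr_deriv ?_
    rw [h.velocity (hgraph t), ContractionSemigroup.sineMode]
  · refine (hasDerivWithinAt_sineMode V n (horbit t ht)).congr_deriv ?_
    rw [eq_inv_smul_iff₀ hρ, Complex.real_smul, Complex.real_smul, Complex.real_smul]
    exact h.modes (hgraph t) n

theorem orbit_mem_lapA (h : IsDampedComponent A ρ κ θ D V P) (hS : IsGenerator A S)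
    (hL : 0 < L) (hρ : 0 < ρ) (hκ : 0 < κ) (hxy : (x, y) ∈ A.graph)
    (hD : ∀ z, D z ∈ H10 L) (hx : D x ∈ (lapA L).domain) (t : ℝ≥0) :
    D (S.toFun t x) ∈ (lapA L).domain := by
  have hmodes : Summable fun n =>
      (eigenval L n * ‖S.sineMode D x n t‖) ^ 2 := by
    refine summable_of_isDampedOscillator (G := (‖P‖ * ‖x‖) ^ 2 + (‖P‖ * ‖y‖) ^ 2) hρ hκ
      (fun n => (eigenval_pos hL n).le) (fun n => Real.rpow_nonneg (eigenval_pos hL n).le θ)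
      (h.isDampedOscillator hS hρ.ne' hxy) (fun s t _ => ?_) ?_ ?_ t.2
    · rw [Finset.sum_add_distrib]
      exact add_le_add (sum_norm_sineMode_sq_le hL S P x t s)
        (sum_norm_sineMode_sq_le hL S P y t s)
    · simpa only [ContractionSemigroup.sineMode, S.orbit_zero] using
        summable_eigenval_mul_inner hL hx
    · simp only [ContractionSemigroup.sineMode, S.orbit_zero, ← h.velocity hxy]
      refine (summable_freq_mul_inner hL ⟨D y, hD y⟩).congr fun n => ?_
      rw [mul_pow, eigenval_eq]
  simp only [ContractionSemigroup.sineMode, S.orbit_coe] at hmodes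
  exact mem_lapA_of_summable hL ⟨_, hD _⟩ hmodes

end IsDampedComponent

end Component

section Operator

variable {p : Beam} {τ σ : ℝ} {S : ContractionSemigroup (Energy p)}

theorem isDampedComponent_u (p : Beam) (τ σ : ℝ) : IsDampedComponent (opB p τ σ) p.ρ₁ p.κ τ
    (Energy.uCLM p) (Energy.wCLM p) ((p.κ : ℂ) • Energy.gradψCLM p) where
  velocity {x y} hxy := by
    obtain ⟨U, rfl, rfl⟩ := (LinearPMap.mem_graph_iff _).1 hxy
    rfl
  modes {x y} hxy n := by
    obtain ⟨U, rfl, rfl⟩ := (LinearPMap.mem_graph_iff _).1 hxy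
    change (p.ρ₁ : ℂ) * inner ℂ (eigenfn p.L n) (opB p τ σ U).w =
      inner ℂ (eigenfn p.L n) ((p.κ : ℂ) • grad p.L U.1.ψ)
        - ((p.κ * eigenval p.L n : ℝ) : ℂ) * inner ℂ (eigenfn p.L n) (U.1.u : L2 p.L)
        - ((eigenval p.L n ^ τ : ℝ) : ℂ) * inner ℂ (eigenfn p.L n) U.1.w
    have hdx : inner ℂ (eigenfn p.L n) (dx p.L ⟨U.1.shear, shear_mem_dx U⟩) =
        inner ℂ (eigenfn p.L n) (grad p.L U.1.ψ)
          - (eigenval p.L n : ℂ) * inner ℂ (eigenfn p.L n) (U.1.u : L2 p.L) := by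
      rw [inner_eigenfn_of_isWeakDeriv p.L_pos n (dx_spec ⟨U.1.shear, shear_mem_dx U⟩),
        inner_eigenfn_of_isWeakDeriv p.L_pos n (isWeakDeriv_grad U.1.ψ),
        show inner ℂ (cosine p.L n) U.1.shear = _ from inner_add_right _ _ _,
        ← freq_mul_inner_eigenfn, eigenval_eq]
      push_cast
      ring
    rw [← inner_smul_right, rho_smul_opB_w, inner_sub_right, inner_smul_right, hdx,
      inner_eigenfn_fracA p.L_pos, inner_smul_right]
    push_cast
    ring

theorem isDampedComponent_ψ (p : Beam) (τ σ : ℝ) : IsDampedComponent (opB p τ σ) p.ρ₂ p.b σ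
    (Energy.ψCLM p) (Energy.vCLM p) (-((p.κ : ℂ) • Energy.shearCLM p)) where
  velocity {x y} hxy := by
    obtain ⟨U, rfl, rfl⟩ := (LinearPMap.mem_graph_iff _).1 hxy
    rfl
  modes {x y} hxy n := by
    obtain ⟨U, rfl, rfl⟩ := (LinearPMap.mem_graph_iff _).1 hxy
    change (p.ρ₂ : ℂ) * inner ℂ (eigenfn p.L n) (opB p τ σ U).v =
      inner ℂ (eigenfn p.L n) (-((p.κ : ℂ) • U.1.shear))
        - ((p.b * eigenval p.L n : ℝ) : ℂ) * inner ℂ (eigenfn p.L n) (U.1.ψ : L2 p.L)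
        - ((eigenval p.L n ^ σ : ℝ) : ℂ) * inner ℂ (eigenfn p.L n) U.1.v
    rw [← inner_smul_right, rho_smul_opB_v, inner_sub_right, inner_sub_right, inner_neg_right,
      inner_smul_right, inner_smul_right, inner_eigenfn_fracA p.L_pos, inner_eigenfn_lapA p.L_pos,
      inner_neg_right, inner_smul_right]
    push_cast
    ring

theorem IsGenerator.mem_domB (hcl : (opB p τ σ).IsClosable)
    (hS : IsGenerator (opB p τ σ).closure S) {U : Energy p} (hU : U ∈ domB p τ σ) (t : ℝ≥0) :
    S.toFun t U ∈ domB p τ σ := by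
  have hu := (isDampedComponent_u p τ σ).closure hcl
  have hψ := (isDampedComponent_ψ p τ σ).closure hcl
  have hgraph := LinearPMap.le_graph_of_le (opB p τ σ).le_closure ((opB p τ σ).mem_graph ⟨U, hU⟩)
  have hgraph_t := hS.map_graph t hgraph
  have hu_t := hu.orbit_mem_lapA hS p.L_pos p.ρ₁_pos p.κ_pos hgraph (fun Z => Z.u.2) hU.1 t
  have hψ_t := hψ.orbit_mem_lapA hS p.L_pos p.ρ₂_pos p.b_pos hgraph (fun Z => Z.ψ.2) hU.2.2.1 t
  have hw : (S.toFun t U).w ∈ H10 p.L := by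
    rw [← show _ = (S.toFun t U).w from hu.velocity hgraph_t]
    exact Submodule.coe_mem _
  have hv : (S.toFun t U).v ∈ H10 p.L := by
    rw [← show _ = (S.toFun t U).v from hψ.velocity hgraph_t]
    exact Submodule.coe_mem _
  exact ⟨hu_t, ⟨hw, hu.mem_fracA p.L_pos hgraph_t hu_t⟩, hψ_t, hv,
    hψ.mem_fracA p.L_pos hgraph_t hψ_t⟩

end Operator

end Timoshenko

end

theorem theorem2_general (p : Timoshenko.Beam) (τ σ : ℝ) (hτ : τ ≤ 1) (hσ : σ ≤ 1) :
    Dense ((Timoshenko.opB p τ σ).domain : Set (Timoshenko.Energy p)) ∧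
    Timoshenko.IsDissipative (Timoshenko.opB p τ σ) ∧
    (Timoshenko.opB p τ σ).IsClosable ∧
    (τ ≤ 1 / 2 → σ ≤ 1 / 2 → (Timoshenko.opB p τ σ).closure = Timoshenko.opB p τ σ) ∧
    Timoshenko.InResolventSet (Timoshenko.opB p τ σ).closure 0 ∧
    ∃ S : Timoshenko.ContractionSemigroup (Timoshenko.Energy p),
      Timoshenko.IsGenerator (Timoshenko.opB p τ σ).closure S ∧
      ∀ U₀ : Timoshenko.Energy p, ∃ U : ℝ → Timoshenko.Energy p,
        (∀ t : ℝ≥0, U t = S.toFun t U₀) ∧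
        Timoshenko.IsWeakSolution (Timoshenko.opB p τ σ) U₀ U ∧
        (∀ U' : ℝ → Timoshenko.Energy p,
          Timoshenko.IsWeakSolution (Timoshenko.opB p τ σ) U₀ U' → ∀ t : ℝ, 0 ≤ t → U' t = U t) ∧
        ∀ k : ℕ,
          (U₀ ∈ (Timoshenko.ppow (Timoshenko.opB p τ σ) k).domain →
            ∀ j ≤ k, Timoshenko.IsCmInto (Timoshenko.opB p τ σ) (k - j) j U) ∧
          (U₀ ∈ (Timoshenko.ppow (Timoshenko.opB p τ σ).closure k).domain →
            ∀ j ≤ k, Timoshenko.IsCmInto (Timoshenko.opB p τ σ).closure (k - j) j U) := by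
  have hd := Timoshenko.dense_domB (p := p) hτ hσ
  have hdiss := Timoshenko.isDissipative_opB (p := p) (τ := τ) (σ := σ)
  obtain ⟨K, hK⟩ := Timoshenko.exists_opB_lower_bound (p := p) hτ hσ
  obtain ⟨R, hcl, hR, hRdiss, hRd⟩ :=
    hdiss.exists_isBoundedInverse_closure hd (Timoshenko.denseRange_opB hτ hσ) hK
  have hle := (Timoshenko.opB p τ σ).le_closure
  have hRB (U : (Timoshenko.opB p τ σ).domain) : R (Timoshenko.opB p τ σ U) = U :=
    (hR _ _).1 (LinearPMap.le_graph_of_le hle (LinearPMap.mem_graph _ U))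
  have hS := hRdiss.isGenerator_semigroup hRd hR
  have hinv := hS.hasInvariantGraph
  have hinvB := hinv.of_le hle fun t _ hU => hS.mem_domB hcl hU t
  refine ⟨hd, hdiss, hcl, fun hτ' hσ' => hR.eq_of_le hle (Timoshenko.surjective_opB hτ' hσ'),
    hR.inResolventSet_zero, hRdiss.semigroup hRd, hS, fun U₀ => ?_⟩
  have hU := hS.isWeakSolution_orbit hd hcl U₀
  exact ⟨_, (hRdiss.semigroup hRd).orbit_coe U₀, hU,
    fun U' hU' t ht => hU.unique hd hRdiss hRd hRB hU' ht, fun k =>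
    ⟨fun hU₀ j hj => hinvB.isCmInto_orbit hS hle hU₀ hj,
      fun hU₀ j hj => hinv.isCmInto_orbit hS le_rfl hU₀ hj⟩⟩

theorem theorem2 (p : Timoshenko.Beam) (τ σ : ℝ) (hτ : τ ∈ Set.Icc (0 : ℝ) 1)
    (hσ : σ ∈ Set.Icc (0 : ℝ) 1) :
    Dense ((Timoshenko.opB p τ σ).domain : Set (Timoshenko.Energy p)) ∧
    Timoshenko.IsDissipative (Timoshenko.opB p τ σ) ∧
    (Timoshenko.opB p τ σ).IsClosable ∧
    (τ ≤ 1 / 2 → σ ≤ 1 / 2 → (Timoshenko.opB p τ σ).closure = Timoshenko.opB p τ σ) ∧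
    Timoshenko.InResolventSet (Timoshenko.opB p τ σ).closure 0 ∧
    ∃ S : Timoshenko.ContractionSemigroup (Timoshenko.Energy p),
      Timoshenko.IsGenerator (Timoshenko.opB p τ σ).closure S ∧
      ∀ U₀ : Timoshenko.Energy p, ∃ U : ℝ → Timoshenko.Energy p,
        (∀ t : ℝ≥0, U t = S.toFun t U₀) ∧
        Timoshenko.IsWeakSolution (Timoshenko.opB p τ σ) U₀ U ∧
        (∀ U' : ℝ → Timoshenko.Energy p,
          Timoshenko.IsWeakSolution (Timoshenko.opB p τ σ) U₀ U' → ∀ t : ℝ, 0 ≤ t → U' t = U t) ∧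
        ∀ k : ℕ,
          (U₀ ∈ (Timoshenko.ppow (Timoshenko.opB p τ σ) k).domain →
            ∀ j ≤ k, Timoshenko.IsCmInto (Timoshenko.opB p τ σ) (k - j) j U) ∧
          (U₀ ∈ (Timoshenko.ppow (Timoshenko.opB p τ σ).closure k).domain →
            ∀ j ≤ k, Timoshenko.IsCmInto (Timoshenko.opB p τ σ).closure (k - j) j U) :=
  theorem2_general p τ σ hτ.2 hσ.2
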